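/- Let $H$ be a separable infinite-dimensional complex Hilbert space. A *history* is a pair $(U,M)$ consisting of a one-parameter group $U=\{U_t:t\in\mathbb R\}$ of unitary operators on $H$ and a type I factor $M\subseteq\mathcal B(H)$ (a von Neumann algebra $*$-isomorphic to $\mathcal B(K)$ for some Hilbert space $K$) such that, with $\gamma_t(X)=U_tXU_t^*$, one has $\gamma_t(M)\subseteq M$ for $t<0$, $\bigl(\bigcup_{t\in\mathbb R}\gamma_t(M)\bigr)''=\mathcal B(H)$ and $\bigcap_{t\in\mathbb R}\gamma_t(M)=\mathbb C\cdot\mathbf 1$. It is an *interaction* with past state $\omega_-$ and future state $\omega_+$ if $\omega_-$ is a normal state of $M$ with $\omega_-\circ\gamma_{-t}|_M=\omega_-$ for all $t\ge 0$ and $\omega_+$ is a normal state of the commutant $M'$ with $\omega_+\circ\gamma_t|_{M'}=\omega_+$ for all $t\ge0$. For $s\le t$ put $\mathcal A_{[s,t]}=\gamma_t(M)\cap\gamma_s(M)'$, and let the local $C^*$-algebra $\mathcal A$ be the norm closure of the union of all $\mathcal A_{[s,t]}$. For normal states $\rho,\sigma$ of type I factors identified with $\mathcal B(K)$ and $\mathcal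 B(L)$, $\rho\otimes\sigma$ denotes the normal state of $\mathcal B(K\otimes L)$ with $(\rho\otimes\sigma)(a\otimes b)=\rho(a)\sigma(b)$, and $\Lambda(\rho\otimes\sigma)=(\lambda_1\ge\lambda_2\ge\cdots)$ is the list of positive eigenvalues, counted with multiplicity and arranged in decreasing order (with zeros appended if there are only finitely many), of its density operator $T$, i.e. of the positive operator $T$ of trace $1$ with $(\rho\otimes\sigma)(X)=\operatorname{trace}(TX)$ for all $X$. For two such lists write $\|\Lambda-\Lambda'\|=\sum_{n}|\lambda_n-\lambda_n'|$. **Theorem B.** Let $(U,M)$ be an interaction with past and future states $\omega_-$ and $\omega_+$. There is a unique $\gamma$-invariant state $\bar\omega_-$ of $\mathcal A$ that agrees with $\omega_-$ on $\mathcal A_I$ for every compact interval $I\subseteq(-\infty,0]$, and a unique $\gamma$-invariant state $\bar\omega_+$ of $\mathcal A$ that agrees with $\omega_+$ on $\mathcal A_I$ for every compact interval $I\subseteq[0,\infty)$; the eigenvalue lists $\Lambda(\omega_-\otimes\omega_-)$ and $\Lambda(\omega_+\otimes\omega_+)$ exist, and $$\|\bar\omega_--\bar\omega_+\|\ \ge\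 \|\Lambda(\omega_-\otimes\omega_-)-\Lambda(\omega_+\otimes\omega_+)\| ,$$ where the norm on the left is the norm of bounded linear functionals on $\mathcal A$. -/

import Mathlib

universe u

namespace NCDynamics

open scoped TensorProduct ComplexOrder InnerProductSpace

noncomputable section

/-! ### States and normal states -/

/-- A state of a unital `*`-algebra: a unital positive linear functional. -/
structure IsState {A : Type*} [Ring A] [StarRing A] [Algebra ℂ A] (φ : A →ₗ[ℂ] ℂ) : Prop where
  map_one : φ 1 = 1
  nonneg : ∀ a : A, 0 ≤ φ (star a * a)

/-- A normal state of a `*`-algebra `S` of operators (used for von Neumann algebras): a state which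
preserves suprema of increasing bounded nets of positive elements.  The order of `S` is the usual
operator order. -/
structure IsNormalState {H : Type u} [NormedAddCommGroup H] [InnerProductSpace ℂ H]
    [CompleteSpace H] (S : StarSubalgebra ℂ (H →L[ℂ] H)) (φ : S →ₗ[ℂ] ℂ) : Prop
    extends IsState φ where
  normal : ∀ (D : Set S) (s : S), D.Nonempty → DirectedOn (· ≤ ·) D → (∀ x ∈ D, 0 ≤ x) →
    IsLUB D s → IsLUB ((fun x => (φ x).re) '' D) (φ s).re

/-! ### Traces, density operators and eigenvalue lists -/

section Trace

variable {K : Type u} [NormedAddCommGroup K] [InnerProductSpace ℂ K]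

/-- `A` has trace `c`: for every orthonormal basis the diagonal matrix entries of `A` are
(unconditionally) summable with sum `c`. -/
def HasTrace (A : K →L[ℂ] K) (c : ℂ) : Prop :=
  ∀ (ι : Type u) (b : HilbertBasis ι ℂ K), HasSum (fun i => ⟪b i, A (b i)⟫_ℂ) c

/-- `R` is the density operator of the functional `φ` on `B(K)`: `R` is positive, `trace R = 1` and
`φ T = trace (R T)` for all `T`. -/
structure IsDensityOperator [CompleteSpace K] (φ : (K →L[ℂ] K) →ₗ[ℂ] ℂ) (R : K →L[ℂ] K) :
    Prop where
  isPositive : R.IsPositive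
  trace_eq_one : HasTrace R 1
  eq_trace : ∀ T : K →L[ℂ] K, HasTrace (R * T) (φ T)

/-- `Λ` is the eigenvalue list of the positive trace class operator `A`: a decreasing summable
sequence of nonnegative reals in which every `μ > 0` occurs as many times as its multiplicity as an
eigenvalue of `A` (so that zeros are appended if there are only finitely many positive
eigenvalues). -/
structure IsEigenvalueList (A : K →L[ℂ] K) (Λ : ℕ → ℝ) : Prop where
  antitone : Antitone Λ
  nonneg : ∀ n, 0 ≤ Λ n
  summable : Summable Λ
  multiplicity : ∀ μ : ℝ, 0 < μ →
    Module.Finite ℂ (Module.End.eigenspace (A : K →ₗ[ℂ] K) (μ : ℂ)) ∧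
      Module.finrank ℂ (Module.End.eigenspace (A : K →ₗ[ℂ] K) (μ : ℂ)) = {n | Λ n = μ}.ncard

end Trace

/-- The `ℓ¹`-distance of two eigenvalue lists. -/
def listDist (Λ Λ' : ℕ → ℝ) : ℝ := ∑' n, |Λ n - Λ' n|

/-! ### Tensor products of states of type I factors -/

/-- The tensor product of Hilbert spaces. -/
abbrev HilbertTensor (K L : Type u) [NormedAddCommGroup K] [InnerProductSpace ℂ K]
    [NormedAddCommGroup L] [InnerProductSpace ℂ L] : Type u :=
  UniformSpace.Completion (K ⊗[ℂ] L)

/-- The tensor product `A ⊗ B` of bounded operators, acting on the tensor product of the Hilbert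
spaces. -/
def tensorOp {K L : Type u} [NormedAddCommGroup K] [InnerProductSpace ℂ K]
    [NormedAddCommGroup L] [InnerProductSpace ℂ L] (A : K →L[ℂ] K) (B : L →L[ℂ] L) :
    HilbertTensor K L →L[ℂ] HilbertTensor K L :=
  (TensorProduct.mapL A B).completion

/-- A type I factor: a von Neumann algebra that is `*`-isomorphic to `B(K)` for some (nonzero)
Hilbert space `K`. -/
def IsTypeIFactor {H : Type u} [NormedAddCommGroup H] [InnerProductSpace ℂ H] [CompleteSpace H]
    (M : VonNeumannAlgebra H) : Prop :=
  ∃ (K : Type u) (_ : NormedAddCommGroup K) (_ : InnerProductSpace ℂ K) (_ : CompleteSpace K)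
    (_ : Nontrivial K), Nonempty (M.toStarSubalgebra ≃⋆ₐ[ℂ] (K →L[ℂ] K))

/-- `Λ` is the eigenvalue list `Λ(φ ⊗ ψ)` for states `φ`, `ψ` of type I factors `A`, `B`.
After identifying `A` with `B(K)` and `B` with `B(L)`, the tensor product of the factors is
`B(K ⊗ L)`; the state `φ ⊗ ψ` is the normal state `χ` of it with
`χ (a ⊗ b) = φ a * ψ b` (normality is expressed by its density operator `T`), and `Λ(φ ⊗ ψ)` is the
eigenvalue list of `T`. -/
def IsTensorEigenvalueList {A B : Type u} [Ring A] [StarRing A] [Algebra ℂ A]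
    [Ring B] [StarRing B] [Algebra ℂ B] (φ : A →ₗ[ℂ] ℂ) (ψ : B →ₗ[ℂ] ℂ) (Λ : ℕ → ℝ) : Prop :=
  ∃ (K : Type u) (_ : NormedAddCommGroup K) (_ : InnerProductSpace ℂ K) (_ : CompleteSpace K)
    (L : Type u) (_ : NormedAddCommGroup L) (_ : InnerProductSpace ℂ L) (_ : CompleteSpace L)
    (θ : A ≃⋆ₐ[ℂ] (K →L[ℂ] K)) (η : B ≃⋆ₐ[ℂ] (L →L[ℂ] L))
    (χ : (HilbertTensor K L →L[ℂ] HilbertTensor K L) →ₗ[ℂ] ℂ)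
    (T : HilbertTensor K L →L[ℂ] HilbertTensor K L),
    (∀ (a : A) (b : B), χ (tensorOp (θ a) (η b)) = φ a * ψ b) ∧
      IsDensityOperator χ T ∧ IsEigenvalueList T Λ

/-! ### Histories, interactions and the local C*-algebra -/

section History

variable {H : Type u} [NormedAddCommGroup H] [InnerProductSpace ℂ H] [CompleteSpace H]

/-- The automorphism `γ_t(X) = U_t X U_t^*` of `B(H)` associated with a one-parameter group of
unitary operators. -/
def flow (U : Multiplicative ℝ →* unitary (H →L[ℂ] H)) (t : ℝ) :
    (H →L[ℂ] H) ≃⋆ₐ[ℂ] (H →L[ℂ] H) :=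
  Unitary.conjStarAlgAut ℂ (H →L[ℂ] H) (U (Multiplicative.ofAdd t))

variable (U : Multiplicative ℝ →* unitary (H →L[ℂ] H)) (M : VonNeumannAlgebra H)

/-- The subalgebra `γ_t(M)`. -/
def translate (t : ℝ) : StarSubalgebra ℂ (H →L[ℂ] H) :=
  M.toStarSubalgebra.map (flow U t).toStarAlgHom

/-- A history. -/
structure IsHistory : Prop where
  typeI : IsTypeIFactor M
  invariant : ∀ t < 0, translate U M t ≤ M.toStarSubalgebra
  irreducible : Set.centralizer (Set.centralizer
    (⋃ t : ℝ, (translate U M t : Set (H →L[ℂ] H)))) = Set.univ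
  remote_past : ⋂ t : ℝ, (translate U M t : Set (H →L[ℂ] H)) =
    Set.range (fun c : ℂ => c • (1 : H →L[ℂ] H))

/-- An interaction with past state `ωPast` and future state `ωFut`: a history together with normal states
of `M` and of its commutant that are invariant under the restriction of `γ_{-t}`, respectively of
`γ_t`, for all `t ≥ 0`. -/
structure IsInteraction (ωPast : M.toStarSubalgebra →ₗ[ℂ] ℂ)
    (ωFut : M.commutant.toStarSubalgebra →ₗ[ℂ] ℂ) : Prop extends IsHistory U M where
  normal_past : IsNormalState M.toStarSubalgebra ωPast
  normal_future : IsNormalState M.commutant.toStarSubalgebra ωFut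
  invariant_past : ∀ t : ℝ, 0 ≤ t → ∀ x y : M.toStarSubalgebra,
    (y : H →L[ℂ] H) = flow U (-t) x → ωPast y = ωPast x
  invariant_future : ∀ t : ℝ, 0 ≤ t → ∀ x y : M.commutant.toStarSubalgebra,
    (y : H →L[ℂ] H) = flow U t x → ωFut y = ωFut x

/-- The local algebra `A_[s,t] = γ_t(M) ∩ γ_s(M)'`. -/
def intervalAlgebra (s t : ℝ) : StarSubalgebra ℂ (H →L[ℂ] H) :=
  translate U M t ⊓ StarSubalgebra.centralizer ℂ (translate U M s : Set (H →L[ℂ] H))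

/-- The local C*-algebra: the norm closure of the `*`-algebra generated by all `A_[s,t]`.  For a
history the union of the `A_[s,t]` is itself a `*`-algebra, see `coe_localAlgebra`. -/
def localAlgebra : StarSubalgebra ℂ (H →L[ℂ] H) :=
  (⨆ I : {I : ℝ × ℝ // I.1 ≤ I.2}, intervalAlgebra U M I.1.1 I.1.2).topologicalClosure

variable {U M}

theorem translate_mono (h : IsHistory U M) {s t : ℝ} (hst : s ≤ t) :
    translate U M s ≤ translate U M t := by
  rcases hst.eq_or_lt with rfl | hlt
  · exact le_rfl
  rintro _ ⟨x, hx, rfl⟩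
  refine ⟨flow U (s - t) x, h.invariant (s - t) (by linarith) ⟨x, hx, rfl⟩, ?_⟩
  have : flow U s = flow U t * flow U (s - t) := by
    simp only [flow, ← map_mul, ← ofAdd_add]
    congr 3; ring
  simp [this, StarAlgEquiv.mul_apply]

theorem intervalAlgebra_mono (h : IsHistory U M) {s s' t t' : ℝ} (hs : s' ≤ s) (ht : t ≤ t') :
    intervalAlgebra U M s t ≤ intervalAlgebra U M s' t' :=
  inf_le_inf (translate_mono h ht)
    (StarSubalgebra.centralizer_le _ _ _ (translate_mono h hs))

/-- For a history, the local C*-algebra is the norm closure of the union of all `A_[s,t]`. -/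
theorem coe_localAlgebra (h : IsHistory U M) :
    (localAlgebra U M : Set (H →L[ℂ] H)) =
      closure (⋃ I : {I : ℝ × ℝ // I.1 ≤ I.2},
        (intervalAlgebra U M I.1.1 I.1.2 : Set (H →L[ℂ] H))) := by
  have : Nonempty {I : ℝ × ℝ // I.1 ≤ I.2} := ⟨⟨(0, 0), le_rfl⟩⟩
  rw [localAlgebra, StarSubalgebra.topologicalClosure_coe, StarSubalgebra.coe_iSup_of_directed]
  rintro ⟨⟨a, b⟩, hI⟩ ⟨⟨c, d⟩, hJ⟩
  exact ⟨⟨(min a c, max b d), (min_le_left _ _).trans (hI.trans (le_max_left _ _))⟩,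
    intervalAlgebra_mono h (min_le_left _ _) (le_max_left _ _),
    intervalAlgebra_mono h (min_le_right _ _) (le_max_right _ _)⟩

/-- A `γ`-invariant state of the local C*-algebra. -/
structure IsInvariantState (φ : localAlgebra U M →L[ℂ] ℂ) : Prop where
  isState : IsState (φ : localAlgebra U M →ₗ[ℂ] ℂ)
  invariant : ∀ (t : ℝ) (x y : localAlgebra U M),
    (y : H →L[ℂ] H) = flow U t x → φ y = φ x

/-- `φ` is a `γ`-invariant state of the local C*-algebra that extends the past state: it agrees with
`ωPast` on `A_I` for every compact interval `I ⊆ (-∞, 0]`. -/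
structure IsPastExtension (ωPast : M.toStarSubalgebra →ₗ[ℂ] ℂ) (φ : localAlgebra U M →L[ℂ] ℂ) :
    Prop extends IsInvariantState φ where
  extends_past : ∀ s t : ℝ, s ≤ t → t ≤ 0 → ∀ (x : M.toStarSubalgebra) (y : localAlgebra U M),
    (x : H →L[ℂ] H) = y → (y : H →L[ℂ] H) ∈ intervalAlgebra U M s t → φ y = ωPast x

/-- `φ` is a `γ`-invariant state of the local C*-algebra that extends the future state: it agrees
with `ωFut` on `A_I` for every compact interval `I ⊆ [0, ∞)`. -/
structure IsFutureExtension (ωFut : M.commutant.toStarSubalgebra →ₗ[ℂ] ℂ)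
    (φ : localAlgebra U M →L[ℂ] ℂ) : Prop extends IsInvariantState φ where
  extends_future : ∀ s t : ℝ, 0 ≤ s → s ≤ t →
    ∀ (x : M.commutant.toStarSubalgebra) (y : localAlgebra U M),
    (x : H →L[ℂ] H) = y → (y : H →L[ℂ] H) ∈ intervalAlgebra U M s t → φ y = ωFut x

end History

end

end NCDynamics

/-! Write H = K ⊗ L with M = B(K) ⊗ 1 and M' = 1 ⊗ B(L). Because L turns out to be infinite
dimensional, ω₋ is implemented on M by a unit vector ξ of H. Let R_t be the relative commutant of
γ_{-t}(M) in M. Splitting γ_{-t}(M) off M gives H = (K ⊗ L) ⊗ G, where R_t = 1 ⊗ B(G) and its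
commutant B(K ⊗ L) ⊗ 1 is generated by γ_{-t}(M) and M' (`IsPureShift.exists_split`). By the Schmidt
decomposition, the restrictions of ξ to R_t and to R_t' have the same positive eigenvalues
(`IsTens.exists_isDiag_flip`).

Since the γ_{-t}(M) decrease to the scalars, the R_t generate M, so R_t' decreases to M'. Let σ be
the product of the marginals of ξ on M and M'. It agrees with ξ on M', and weak compactness makes ξ
and σ close in norm on R_t' for large t (`IsPureShift.exists_norm_sub_le`). By invariance of ω₋, the
restriction of σ to R_t' is a copy of ω₋ ⊗ ξ|M', and ξ|M' again has the eigenvalues of ω₋. Hence the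
eigenvalue list of ξ on R_t tends to Λ(ω₋ ⊗ ω₋) (`IsPureShift.exists_list_near`).

Now γ_t carries R_t onto A_[0,t], and there the past extension is X ↦ ⟨ξ, γ_{-t}(X) ξ⟩. Reversing
time and exchanging M with M' treats the future state in the same way; its relative commutant is
A_[0,t] itself. So both extensions restrict to normal states of one type I factor A_[0,t], with
lists close to Λ(ω₋ ⊗ ω₋) and Λ(ω₊ ⊗ ω₊). Eigenvalue lists are no further apart in ℓ¹ than the
states are in norm (`IsDiag.list_contraction`), and t → ∞ gives the inequality
(`IsHistory.listDist_le`).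

The extensions themselves are limits of ξ ∘ γ_{-t} along an ultrafilter; they are unique because γ
moves every local observable into M or into M'. -/

namespace NCDynamics

open scoped TensorProduct ComplexOrder InnerProductSpace
open InnerProductSpace ContinuousLinearMap Filter Topology

noncomputable section

set_option linter.unusedSectionVars false

/-! ### Hilbert space tensor decompositions, amplifications and their commutants. -/

section Tens

variable {K G H : Type u} [NormedAddCommGroup K] [InnerProductSpace ℂ K]
  [NormedAddCommGroup G] [InnerProductSpace ℂ G]
  [NormedAddCommGroup H] [InnerProductSpace ℂ H]

/-- `m` exhibits `H` as the Hilbert space tensor product of `K` and `G`. -/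
structure IsTens (m : K →L[ℂ] G →L[ℂ] H) : Prop where
  inner : ∀ k g k' g', ⟪m k g, m k' g'⟫_ℂ = ⟪k, k'⟫_ℂ * ⟪g, g'⟫_ℂ
  total : ∀ h, (∀ k g, ⟪m k g, h⟫_ℂ = 0) → h = 0

variable {m : K →L[ℂ] G →L[ℂ] H}

theorem IsTens.flip (hm : IsTens m) : IsTens m.flip where
  inner k g k' g' := by simp [hm.inner, mul_comm]
  total h hh := hm.total h fun k g => hh g k

theorem IsTens.norm (hm : IsTens m) (k : K) (g : G) : ‖m k g‖ = ‖k‖ * ‖g‖ := by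
  have h := hm.inner k g k g
  rw [inner_self_eq_norm_sq_to_K, inner_self_eq_norm_sq_to_K, inner_self_eq_norm_sq_to_K] at h
  have h2 : ‖m k g‖ ^ 2 = (‖k‖ * ‖g‖) ^ 2 := by
    rw [mul_pow]; exact_mod_cast h
  exact (sq_eq_sq₀ (norm_nonneg _) (by positivity)).1 h2

/-- The linear span of the elementary tensors is dense. -/
theorem IsTens.dense [CompleteSpace H] (hm : IsTens m) :
    Dense (Submodule.span ℂ {h : H | ∃ k g, m k g = h} : Set H) := by
  rw [Submodule.dense_iff_topologicalClosure_eq_top, Submodule.topologicalClosure_eq_top_iff,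
    Submodule.eq_bot_iff]
  intro h hh
  refine hm.total h fun k g => ?_
  exact (Submodule.mem_orthogonal _ _).1 hh _ (Submodule.subset_span ⟨k, g, rfl⟩)

theorem IsTens.ext [CompleteSpace H] {E : Type*} [NormedAddCommGroup E] [NormedSpace ℂ E]
    (hm : IsTens m) {A B : H →L[ℂ] E}
    (h : ∀ k g, A (m k g) = B (m k g)) : A = B := by
  refine ContinuousLinearMap.ext_on hm.dense ?_
  rintro _ ⟨k, g, rfl⟩
  exact h k g

/-- A bilinear map compatible with the inner products up to a factor extends to the Hilbert
space tensor product. -/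
theorem exists_extension [CompleteSpace H] (f : K →L[ℂ] G →L[ℂ] H) (c : ℝ)
    (hf : ∀ k g k' g', ⟪f k g, f k' g'⟫_ℂ = c ^ 2 * (⟪k, k'⟫_ℂ * ⟪g, g'⟫_ℂ)) :
    ∃ F : HilbertTensor K G →L[ℂ] H,
      (∀ k g, F ((k ⊗ₜ[ℂ] g : K ⊗[ℂ] G) : HilbertTensor K G) = f k g) ∧
      ∀ z z', ⟪F z, F z'⟫_ℂ = c ^ 2 * ⟪z, z'⟫_ℂ := by
  let f0 : K ⊗[ℂ] G →ₗ[ℂ] H := TensorProduct.lift (f.toLinearMap₁₂)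
  have h0 : ∀ k g, f0 (k ⊗ₜ g) = f k g := fun k g => by simp [f0]
  have hin : ∀ x y, ⟪f0 x, f0 y⟫_ℂ = c ^ 2 * ⟪x, y⟫_ℂ := by
    intro x y
    induction x using TensorProduct.induction_on with
    | zero => simp
    | add a b ha hb => rw [map_add, inner_add_left, ha, hb, inner_add_left, mul_add]
    | tmul k g =>
      induction y using TensorProduct.induction_on with
      | zero => simp
      | add a b ha hb => rw [map_add, inner_add_right, ha, hb, inner_add_right, mul_add]
      | tmul k' g' => rw [h0, h0, hf, TensorProduct.inner_tmul]
  have hnorm : ∀ x, ‖f0 x‖ ≤ |c| * ‖x‖ := by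
    intro x
    have h := hin x x
    have hx : ⟪x, x⟫_ℂ = ((‖x‖ : ℝ) : ℂ) ^ 2 := inner_self_eq_norm_sq_to_K x
    rw [inner_self_eq_norm_sq_to_K, hx] at h
    have h2 : ‖f0 x‖ ^ 2 = (|c| * ‖x‖) ^ 2 := by
      rw [mul_pow, sq_abs]; exact Complex.ofReal_injective (by push_cast; exact h)
    exact ((sq_eq_sq₀ (norm_nonneg _) (by positivity)).1 h2).le
  let f1 : K ⊗[ℂ] G →L[ℂ] H := f0.mkContinuous _ hnorm
  let F : HilbertTensor K G →L[ℂ] H := f1.extend UniformSpace.Completion.toComplL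
  have hF : ∀ x : K ⊗[ℂ] G, F (x : HilbertTensor K G) = f0 x := by
    intro x
    exact ContinuousLinearMap.extend_eq f1 (e := UniformSpace.Completion.toComplL)
      UniformSpace.Completion.denseRange_coe
      (UniformSpace.Completion.isUniformInducing_coe _) x
  refine ⟨F, fun k g => by rw [hF, h0], fun z z' => ?_⟩
  induction z, z' using UniformSpace.Completion.induction_on₂ with
  | hp => exact isClosed_eq (by fun_prop) (by fun_prop)
  | ih a b => rw [hF, hF, hin, UniformSpace.Completion.inner_coe]

/-- The canonical tensor decomposition. -/
def tmulL (K G : Type u) [NormedAddCommGroup K] [InnerProductSpace ℂ K]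
    [NormedAddCommGroup G] [InnerProductSpace ℂ G] : K →L[ℂ] G →L[ℂ] HilbertTensor K G :=
  (UniformSpace.Completion.toComplL.postcomp G).comp (TensorProduct.mkL ℂ K G)

theorem tmulL_apply (k : K) (g : G) :
    tmulL K G k g = ((k ⊗ₜ[ℂ] g : K ⊗[ℂ] G) : HilbertTensor K G) := rfl

theorem isTens_tmulL : IsTens (tmulL K G) where
  inner k g k' g' := by
    rw [tmulL_apply, tmulL_apply, UniformSpace.Completion.inner_coe, TensorProduct.inner_tmul]
  total h hh := by
    have h1 : ∀ x : K ⊗[ℂ] G, ⟪(x : HilbertTensor K G), h⟫_ℂ = 0 := by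
      intro x
      induction x using TensorProduct.induction_on with
      | zero => rw [UniformSpace.Completion.coe_zero, inner_zero_left]
      | add a b ha hb =>
        rw [UniformSpace.Completion.coe_add, inner_add_left, ha, hb, add_zero]
      | tmul k g => exact hh k g
    have h2 : ∀ z : HilbertTensor K G, ⟪z, h⟫_ℂ = 0 := by
      intro z
      induction z using UniformSpace.Completion.induction_on with
      | hp => exact isClosed_eq (by fun_prop) (by fun_prop)
      | ih a => exact h1 a
    exact inner_self_eq_zero.1 (h2 h)

theorem tensorOp_tmulL (A : K →L[ℂ] K) (B : G →L[ℂ] G) (k : K) (g : G) :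
    tensorOp A B (tmulL K G k g) = tmulL K G (A k) (B g) := by
  rw [tmulL_apply, tmulL_apply, tensorOp, ← TensorProduct.mapL_tmul]
  exact UniformSpace.Completion.map_coe (ContinuousLinearMap.uniformContinuous _) _

/-- The identification of `H` with the Hilbert space tensor product. -/
theorem IsTens.exists_equiv [CompleteSpace H] (hm : IsTens m) :
    ∃ W : HilbertTensor K G ≃ₗᵢ[ℂ] H, ∀ k g, W (tmulL K G k g) = m k g := by
  obtain ⟨F, hF, hFi⟩ := exists_extension m 1 (fun k g k' g' => by simp [hm.inner])
  let F' : HilbertTensor K G →ₗᵢ[ℂ] H := F.toLinearMap.isometryOfInner (by simpa using hFi)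
  have hF' : ∀ k g, F' (tmulL K G k g) = m k g := hF
  have hsurj : Function.Surjective F' := by
    have hcl : IsClosed (Set.range F') := F'.isometry.isClosedEmbedding.isClosed_range
    have hd : Dense (Set.range F') := by
      refine hm.dense.mono ?_
      change _ ⊆ ((LinearMap.range F'.toLinearMap : Submodule ℂ H) : Set H)
      refine Submodule.span_le.2 ?_
      rintro _ ⟨k, g, rfl⟩
      exact ⟨_, hF' k g⟩
    exact Set.range_eq_univ.1 (by rw [← hcl.closure_eq, hd.closure_eq])
  exact ⟨LinearIsometryEquiv.ofSurjective F' hsurj, hF'⟩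

/-- `A ⊗ B` on `H = K ⊗ G`. -/
def IsTens.op [CompleteSpace H] (hm : IsTens m) (A : K →L[ℂ] K) (B : G →L[ℂ] G) : H →L[ℂ] H :=
  let W := hm.exists_equiv.choose
  (W : HilbertTensor K G →L[ℂ] H) ∘L tensorOp A B ∘L (W.symm : H →L[ℂ] HilbertTensor K G)

theorem IsTens.op_apply [CompleteSpace H] (hm : IsTens m) (A : K →L[ℂ] K) (B : G →L[ℂ] G)
    (k : K) (g : G) : hm.op A B (m k g) = m (A k) (B g) := by
  have h := hm.exists_equiv.choose_spec
  set W := hm.exists_equiv.choose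
  change W (tensorOp A B (W.symm (m k g))) = _
  rw [← h, LinearIsometryEquiv.symm_apply_apply, tensorOp_tmulL, h]

/-- The amplification `A ↦ A ⊗ 1`. -/
def IsTens.amp [CompleteSpace H] [CompleteSpace K] (hm : IsTens m) :
    (K →L[ℂ] K) →⋆ₐ[ℂ] (H →L[ℂ] H) where
  toFun A := hm.op A 1
  map_one' := hm.ext fun k g => by simp [hm.op_apply]
  map_mul' A B := hm.ext fun k g => by simp [hm.op_apply]
  map_zero' := hm.ext fun k g => by simp [hm.op_apply]
  map_add' A B := hm.ext fun k g => by simp [hm.op_apply]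
  commutes' c := hm.ext fun k g => by simp [hm.op_apply, Algebra.algebraMap_eq_smul_one]
  map_star' A := by
    rw [star_eq_adjoint, star_eq_adjoint]
    refine hm.ext fun k g => ?_
    rw [← sub_eq_zero]
    refine hm.total _ fun k' g' => ?_
    rw [inner_sub_right, adjoint_inner_right, hm.op_apply, hm.op_apply, hm.inner, hm.inner,
      adjoint_inner_right]
    simp

variable [CompleteSpace H] [CompleteSpace K] (hm : IsTens m)

@[simp]
theorem IsTens.amp_apply (A : K →L[ℂ] K) (k : K) (g : G) : hm.amp A (m k g) = m (A k) g := by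
  change hm.op A 1 _ = _
  rw [hm.op_apply]; rfl

theorem IsTens.amp_unique {A : K →L[ℂ] K}
    {X : H →L[ℂ] H} (hX : ∀ k g, X (m k g) = m (A k) g) : X = hm.amp A :=
  hm.ext fun k g => by rw [hX, hm.amp_apply]

theorem IsTens.amp_injective [Nontrivial G] : Function.Injective hm.amp := by
  intro A B h
  obtain ⟨g, hg⟩ := exists_ne (0 : G)
  ext k
  have h1 : m (A k - B k) g = 0 := by
    rw [map_sub, sub_apply, ← hm.amp_apply, ← hm.amp_apply, h, sub_self]
  have h2 := hm.norm (A k - B k) g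
  rw [h1, norm_zero, eq_comm, mul_eq_zero, norm_eq_zero, norm_eq_zero] at h2
  exact sub_eq_zero.1 (h2.resolve_right hg)

theorem IsTens.amp_commute [CompleteSpace G] (A : K →L[ℂ] K) (B : G →L[ℂ] G) :
    hm.amp A * hm.flip.amp B = hm.flip.amp B * hm.amp A := by
  refine hm.ext fun k g => ?_
  have h1 : ∀ k g, hm.flip.amp B (m k g) = m k (B g) := fun k g => hm.flip.amp_apply B g k
  simp [h1]

theorem IsTens.flip_amp_apply [CompleteSpace G] (B : G →L[ℂ] G) (k : K) (g : G) :
    hm.flip.amp B (m k g) = m k (B g) := hm.flip.amp_apply B g k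

theorem IsTens.adjoint_slice (hm : IsTens m) [CompleteSpace G] (k k' : K) (g : G) :
    adjoint (m k) (m k' g) = ⟪k, k'⟫_ℂ • g := by
  refine ext_inner_left ℂ fun g' => ?_
  rw [adjoint_inner_right, hm.inner, inner_smul_right]

/-- The operator |k⟩⟨k'| ⊗ 1 factors through the second space by two slices. This turns commutation
with rank one operators into identities between slices. -/
theorem IsTens.amp_rankOne [CompleteSpace G] (k k' : K) (h : H) :
    hm.amp (rankOne ℂ k k') h = m k (adjoint (m k') h) := by
  have : hm.amp (rankOne ℂ k k') = (m k) ∘L adjoint (m k') := hm.ext fun x g => by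
    simp [hm.adjoint_slice]
  rw [this]; rfl

/-- Commutant of `B(K) ⊗ 1`, tested on enough rank one operators. -/
theorem IsTens.exists_of_commute_rankOne [CompleteSpace G] (s : Set K)
    (hs : Dense (Submodule.span ℂ s : Set K)) (k₀ : K) (hk₀ : k₀ ≠ 0)
    (X : H →L[ℂ] H)
    (hX : ∀ k ∈ s, hm.amp (rankOne ℂ k k₀) * X = X * hm.amp (rankOne ℂ k k₀)) :
    ∃ Z, X = hm.flip.amp Z := by
  have h0 : ⟪k₀, k₀⟫_ℂ ≠ 0 := inner_self_ne_zero.2 hk₀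
  -- The second factor of X is its compression to the slice k₀ ⊗ G, normalized since k₀ need not be
  -- a unit vector.
  refine ⟨(⟪k₀, k₀⟫_ℂ)⁻¹ • (adjoint (m k₀) ∘L X ∘L m k₀), ?_⟩
  refine hm.flip.amp_unique fun g k => ?_
  change X (m k g) = m k _
  have hs' : ∀ k ∈ s, X (m k g) = m k (((⟪k₀, k₀⟫_ℂ)⁻¹ • (adjoint (m k₀) ∘L X ∘L m k₀)) g) := by
    intro k hk
    have h1 : hm.amp (rankOne ℂ k k₀) (X (m k₀ g)) = X (hm.amp (rankOne ℂ k k₀) (m k₀ g)) :=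
      congr($(hX k hk) (m k₀ g))
    rw [hm.amp_rankOne, hm.amp_rankOne, hm.adjoint_slice, map_smul, map_smul] at h1
    rw [smul_apply, map_smul, eq_inv_smul_iff₀ h0, ← h1]
    rfl
  have := ContinuousLinearMap.ext_on (f := X ∘L m.flip g)
    (g := m.flip (((⟪k₀, k₀⟫_ℂ)⁻¹ • (adjoint (m k₀) ∘L X ∘L m k₀)) g)) hs hs'
  exact congr($this k)

theorem IsTens.exists_of_commute [CompleteSpace G] [Nontrivial K] (X : H →L[ℂ] H)
    (hX : ∀ A, hm.amp A * X = X * hm.amp A) : ∃ Z, X = hm.flip.amp Z := by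
  obtain ⟨k₀, hk₀⟩ := exists_ne (0 : K)
  refine hm.exists_of_commute_rankOne Set.univ ?_ k₀ hk₀ X fun k _ => hX _
  simp

/-- A nondegenerate representation of `B(K)` is an amplification. -/
theorem exists_isTens (π : (K →L[ℂ] K) →⋆ₐ[ℂ] (H →L[ℂ] H)) [Nontrivial K]
    (hπ : ∀ h, (∀ k k', π (rankOne ℂ k k') h = 0) → h = 0) :
    ∃ (G : Type u) (_ : NormedAddCommGroup G) (_ : InnerProductSpace ℂ G) (_ : CompleteSpace G)
      (m : K →L[ℂ] G →L[ℂ] H), IsTens m ∧ ∀ A k g, π A (m k g) = m (A k) g := by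
  obtain ⟨k₀, hk₀⟩ := exists_norm_eq K (zero_le_one : (0 : ℝ) ≤ 1)
  have hmul : ∀ A B h, π A (π B h) = π (A * B) h := fun A B h => by rw [map_mul]; rfl
  have hrr : ∀ a b c d : K, rankOne ℂ a b * rankOne ℂ c d = ⟪b, c⟫_ℂ • rankOne ℂ a d := by
    intro a b c d
    exact InnerProductSpace.rankOne_comp_rankOne a b c d
  have h00 : ⟪k₀, k₀⟫_ℂ = 1 := by rw [inner_self_eq_norm_sq_to_K, hk₀]; simp
  have hadj : ∀ a b : K, adjoint (π (rankOne ℂ a b)) = π (rankOne ℂ b a) := by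
    intro a b
    rw [← star_eq_adjoint, ← map_star, star_eq_adjoint, InnerProductSpace.adjoint_rankOne]
  -- The multiplicity space is the range of the projection π(|k₀⟩⟨k₀|), and the matrix units |k⟩⟨k₀|
  -- transport it to the other slices.
  let G : Submodule ℂ H := (π (rankOne ℂ k₀ k₀) - 1).ker
  have hG : ∀ h, h ∈ G ↔ π (rankOne ℂ k₀ k₀) h = h := fun h => by
    simp [G, LinearMap.mem_ker, sub_eq_zero]
  have hGc : IsClosed (G : Set H) := (π (rankOne ℂ k₀ k₀) - 1).isClosed_ker
  have : CompleteSpace G := hGc.completeSpace_coe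
  have hπc : Continuous π := map_continuous π
  let πL : (K →L[ℂ] K) →L[ℂ] (H →L[ℂ] H) := ⟨π.toAlgHom.toLinearMap, hπc⟩
  let m : K →L[ℂ] G →L[ℂ] H :=
    (ContinuousLinearMap.precomp H G.subtypeL) ∘L πL ∘L ((rankOne ℂ : K →L[ℂ] K →L⋆[ℂ] _).flip k₀)
  have hmdef : ∀ k (g : G), m k g = π (rankOne ℂ k k₀) g := fun k g => rfl
  refine ⟨G, inferInstance, inferInstance, inferInstance, m, ⟨?_, ?_⟩, ?_⟩
  · intro k g k' g'
    rw [hmdef, hmdef, ← adjoint_inner_right, hadj, hmul, hrr, map_smul, smul_apply,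
      (hG _).1 g'.2, inner_smul_right]
    rfl
  · intro h hh
    have h1 : ∀ k, π (rankOne ℂ k₀ k) h = 0 := by
      intro k
      have hmem : π (rankOne ℂ k₀ k) h ∈ G := by
        rw [hG, hmul, hrr, h00, one_smul]
      have := hh k ⟨_, hmem⟩
      rw [hmdef, ← adjoint_inner_right, hadj] at this
      exact inner_self_eq_zero.1 this
    refine hπ h fun k k' => ?_
    have : rankOne ℂ k k' = rankOne ℂ k k₀ * rankOne ℂ k₀ k' := by rw [hrr, h00, one_smul]
    rw [this, ← hmul, h1, map_zero]
  · intro A k g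
    rw [hmdef, hmdef, hmul]
    congr 2
    exact InnerProductSpace.comp_rankOne k k₀ A

/-- Regrouping `K ⊗ (L ⊗ G)` as `(K ⊗ L) ⊗ G`. -/
theorem IsTens.exists_assoc {L₀ L : Type u} [NormedAddCommGroup L₀] [InnerProductSpace ℂ L₀]
    [NormedAddCommGroup L] [InnerProductSpace ℂ L] [CompleteSpace L₀]
    {m : K →L[ℂ] L₀ →L[ℂ] H} (hm : IsTens m) {n : L →L[ℂ] G →L[ℂ] L₀} (hn : IsTens n) :
    ∃ w : HilbertTensor K L →L[ℂ] G →L[ℂ] H, IsTens w ∧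
      ∀ k l g, w (tmulL K L k l) g = m k (n l g) := by
  have hE := isTens_tmulL (K := K) (G := L)
  -- For fixed g, the map (k, l) ↦ m k (n l g) multiplies inner products by ‖g‖², so it extends to K
  -- ⊗ L.
  have key : ∀ g : G, ∃ F : HilbertTensor K L →L[ℂ] H, ∀ k l, F (tmulL K L k l) = m k (n l g) := by
    intro g
    obtain ⟨F, hF, -⟩ := exists_extension ((ContinuousLinearMap.precomp H (n.flip g)) ∘L m) ‖g‖ (by
      intro k l k' l'
      have h1 : ⟪m k (n l g), m k' (n l' g)⟫_ℂ = ‖g‖ ^ 2 * (⟪k, k'⟫_ℂ * ⟪l, l'⟫_ℂ) := by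
        rw [hm.inner, hn.inner, inner_self_eq_norm_sq_to_K]
        simp only [Complex.coe_algebraMap]
        ring
      exact h1)
    exact ⟨F, hF⟩
  choose F hF using key
  have hinner : ∀ g g' z z', ⟪F g z, F g' z'⟫_ℂ = ⟪z, z'⟫_ℂ * ⟪g, g'⟫_ℂ := by
    intro g g' z z'
    -- The inner product formula for arbitrary z, z' is an operator identity, which only has to be
    -- checked on elementary tensors.
    have h1 : adjoint (F g) ∘L F g' =
        ⟪g, g'⟫_ℂ • ContinuousLinearMap.id ℂ (HilbertTensor K L) := by
      refine hE.ext fun k' l' => ?_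
      rw [← sub_eq_zero]
      refine hE.total _ fun k l => ?_
      rw [inner_sub_right, comp_apply, adjoint_inner_right, hF, hF, hm.inner, hn.inner, smul_apply,
        inner_smul_right, ContinuousLinearMap.id_apply, hE.inner]
      ring
    rw [← adjoint_inner_right, ← comp_apply, h1, smul_apply, inner_smul_right,
      ContinuousLinearMap.id_apply, mul_comm]
  have hnorm : ∀ g z, ‖F g z‖ = ‖z‖ * ‖g‖ := by
    intro g z
    have h := hinner g g z z
    rw [inner_self_eq_norm_sq_to_K, inner_self_eq_norm_sq_to_K, inner_self_eq_norm_sq_to_K] at h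
    have h2 : ‖F g z‖ ^ 2 = (‖z‖ * ‖g‖) ^ 2 := by
      rw [mul_pow]; exact Complex.ofReal_injective (by push_cast; exact h)
    exact (sq_eq_sq₀ (norm_nonneg _) (by positivity)).1 h2
  have hadd : ∀ g g', F (g + g') = F g + F g' := fun g g' => hE.ext fun k l => by
    simp [hF]
  have hsmul : ∀ (c : ℂ) g, F (c • g) = c • F g := fun c g => hE.ext fun k l => by
    simp [hF]
  let w : HilbertTensor K L →L[ℂ] G →L[ℂ] H :=
    LinearMap.mkContinuous₂ (LinearMap.mk₂ ℂ (fun z g => F g z) (fun z z' g => map_add _ _ _)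
      (fun c z g => map_smul _ _ _) (fun z g g' => by rw [hadd]; rfl)
      (fun c z g => by rw [hsmul]; rfl)) 1 (fun z g => by simp [hnorm])
  have hw : ∀ z g, w z g = F g z := fun z g => rfl
  refine ⟨w, ⟨fun z g z' g' => by rw [hw, hw, hinner], fun h hh => ?_⟩, fun k l g => by
    rw [hw, hF]⟩
  have h2 : ∀ k, adjoint (m k) h = 0 := by
    intro k
    refine hn.total _ fun l g => ?_
    rw [adjoint_inner_right, ← hF, ← hw]
    exact hh _ _
  refine hm.total h fun k l => ?_
  rw [← adjoint_inner_right, h2, inner_zero_right]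

theorem hilbertBasis_ext_zero {E ι : Type*} [NormedAddCommGroup E] [InnerProductSpace ℂ E]
    (b : HilbertBasis ι ℂ E) (x : E) (hx : ∀ i, ⟪b i, x⟫_ℂ = 0) : x = 0 := by
  have := b.hasSum_repr x
  simp only [HilbertBasis.repr_apply_apply, hx, zero_smul] at this
  exact this.unique hasSum_zero

/-- Tensor products of Hilbert bases. -/
theorem IsTens.exists_hilbertBasis [CompleteSpace G] (hm : IsTens m) {ι κ : Type*}
    (e : HilbertBasis ι ℂ K) (c : HilbertBasis κ ℂ G) :
    ∃ b : HilbertBasis (ι × κ) ℂ H, ∀ p, b p = m (e p.1) (c p.2) := by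
  classical
  have he := orthonormal_iff_ite.1 e.orthonormal
  have hc := orthonormal_iff_ite.1 c.orthonormal
  have ho : Orthonormal ℂ (fun p : ι × κ => m (e p.1) (c p.2)) := by
    rw [orthonormal_iff_ite]
    intro p q
    rw [hm.inner, he, hc]
    by_cases h1 : p.1 = q.1 <;> by_cases h2 : p.2 = q.2 <;> simp [h1, h2, Prod.ext_iff]
  refine ⟨HilbertBasis.mkOfOrthogonalEqBot ho ?_, fun p => by
    rw [HilbertBasis.coe_mkOfOrthogonalEqBot]⟩
  rw [Submodule.eq_bot_iff]
  intro h hh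
  have h0 : ∀ i j, ⟪m (e i) (c j), h⟫_ℂ = 0 := fun i j =>
    (Submodule.mem_orthogonal _ _).1 hh _ (Submodule.subset_span ⟨(i, j), rfl⟩)
  have h1 : ∀ i, adjoint (m (e i)) h = 0 := fun i =>
    hilbertBasis_ext_zero c _ fun j => by rw [adjoint_inner_right, h0]
  have h2 : ∀ g, adjoint (m.flip g) h = 0 := fun g =>
    hilbertBasis_ext_zero e _ fun i => by
      rw [adjoint_inner_right, flip_apply, ← adjoint_inner_right, h1, inner_zero_right]
  refine hm.total h fun k g => ?_
  have := adjoint_inner_right (m.flip g) k h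
  rw [h2, inner_zero_right] at this
  exact this.symm

end Tens

/-! ### States: hermiticity and the Cauchy–Schwarz inequality. -/

section State

variable {A : Type*} [Ring A] [StarRing A] [Algebra ℂ A] [StarModule ℂ A] {φ : A →ₗ[ℂ] ℂ}

/-- Polarization: φ(c*c) is real for c = a + b and for c = a + ib, which gives the imaginary and the
real part of the identity. -/
theorem IsState.hermitian (h : IsState φ) (a b : A) :
    (starRingEnd ℂ) (φ (star b * a)) = φ (star a * b) := by
  have im0 : ∀ c : A, (φ (star c * c)).im = 0 := fun c =>
    ((Complex.nonneg_iff).1 (h.nonneg c)).2.symm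
  have h1 := im0 (a + b)
  have h2 := im0 (a + Complex.I • b)
  have ha := im0 a
  have hb := im0 b
  have hc := im0 (Complex.I • b)
  simp only [star_add, star_smul, add_mul, mul_add, map_add, smul_mul_assoc, mul_smul_comm,
    map_smul, smul_eq_mul, Complex.add_im] at h1 h2 hc
  simp at h1 h2 hc
  apply Complex.ext
  · rw [Complex.conj_re]; linarith
  · rw [Complex.conj_im]; linarith

/-- The Cauchy-Schwarz inequality for states. -/
theorem IsState.cauchy_schwarz (h : IsState φ) (a b : A) :
    ‖φ (star a * b)‖ ^ 2 ≤ (φ (star a * a)).re * (φ (star b * b)).re := by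
  let c : PreInnerProductSpace.Core ℂ A :=
    { inner := fun a b => φ (star a * b)
      conj_inner_symm := fun x y => h.hermitian x y
      re_inner_nonneg := fun x => (Complex.nonneg_iff.1 (h.nonneg x)).1
      add_left := fun x y z => by simp [add_mul]
      smul_left := fun x y r => by simp }
  have h1 := @InnerProductSpace.Core.inner_mul_inner_self_le ℂ A _ _ _ c a b
  have h2 : ‖φ (star b * a)‖ = ‖φ (star a * b)‖ := by
    rw [← h.hermitian, RCLike.norm_conj]
  change ‖φ (star a * b)‖ * ‖φ (star b * a)‖ ≤ (φ (star a * a)).re * (φ (star b * b)).re at h1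
  rw [h2, ← sq] at h1
  exact h1

theorem IsState.comp {B : Type*} [Ring B] [StarRing B] [Algebra ℂ B] (h : IsState φ)
    (π : B →⋆ₐ[ℂ] A) : IsState (φ ∘ₗ (π.toAlgHom.toLinearMap : B →ₗ[ℂ] A)) where
  map_one := by simpa using h.map_one
  nonneg a := by
    change 0 ≤ φ (π (star a * a))
    rw [map_mul, map_star]
    exact h.nonneg (π a)

end State

/-! ### Diagonalization of normal states of B(K), compact operators and the Schmidt decomposition.
-/

variable {K G H : Type u} [NormedAddCommGroup K] [InnerProductSpace ℂ K]
  [NormedAddCommGroup G] [InnerProductSpace ℂ G]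
  [NormedAddCommGroup H] [InnerProductSpace ℂ H] [CompleteSpace H] [CompleteSpace K]
  [CompleteSpace G]

/-- Cauchy–Schwarz against the identity, combined with X*X ≤ ‖X‖². -/
theorem IsState.norm_le {f : (K →L[ℂ] K) →ₗ[ℂ] ℂ} (hf : IsState f) (X : K →L[ℂ] K) :
    ‖f X‖ ≤ ‖X‖ := by
  have h1 : (0 : K →L[ℂ] K) ≤ algebraMap ℝ _ (‖X‖ ^ 2) - star X * X :=
    sub_nonneg.2 CStarAlgebra.star_mul_le_algebraMap_norm_sq
  obtain ⟨c, hc⟩ := CStarAlgebra.nonneg_iff_eq_star_mul_self.1 h1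
  have h2 := hf.nonneg c
  have h3 : f (algebraMap ℝ (K →L[ℂ] K) (‖X‖ ^ 2)) = ((‖X‖ ^ 2 : ℝ) : ℂ) := by
    rw [IsScalarTower.algebraMap_apply ℝ ℂ (K →L[ℂ] K), Algebra.algebraMap_eq_smul_one, map_smul,
      hf.map_one]
    simp
  rw [← hc, map_sub, h3] at h2
  have h4 : (f (star X * X)).re ≤ ‖X‖ ^ 2 := by
    have := (Complex.nonneg_iff.1 h2).1
    rw [Complex.sub_re, Complex.ofReal_re] at this
    linarith
  have h5 := hf.cauchy_schwarz 1 X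
  simp only [star_one, one_mul, hf.map_one, Complex.one_re] at h5
  exact (sq_le_sq₀ (norm_nonneg _) (norm_nonneg _)).1 (h5.trans h4)

/-- The functional `X ↦ ⟪ξ, X ξ⟫`. -/
def vec (ξ : H) : (H →L[ℂ] H) →ₗ[ℂ] ℂ where
  toFun X := ⟪ξ, X ξ⟫_ℂ
  map_add' X Y := by simp
  map_smul' c X := by simp

@[simp] theorem vec_apply (ξ : H) (X : H →L[ℂ] H) : vec ξ X = ⟪ξ, X ξ⟫_ℂ := rfl

theorem isState_vec (ξ : H) (hξ : ‖ξ‖ = 1) : IsState (vec ξ) where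
  map_one := by
    change ⟪ξ, ξ⟫_ℂ = 1
    rw [inner_self_eq_norm_sq_to_K, hξ]; simp
  nonneg a := by
    change 0 ≤ ⟪ξ, (star a) (a ξ)⟫_ℂ
    rw [star_eq_adjoint, adjoint_inner_right, inner_self_eq_norm_sq_to_K]
    simp only [Complex.coe_algebraMap]
    exact_mod_cast sq_nonneg ‖a ξ‖

/-- `f = ∑ a i ⟪b i, · b i⟫` is a diagonalization of the functional `f` with positive weights. -/
structure IsDiag (f : (K →L[ℂ] K) → ℂ) {ι : Type*} (a : ι → ℝ) (b : ι → K) : Prop where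
  orthonormal : Orthonormal ℂ b
  pos : ∀ i, 0 < a i
  hasSum : ∀ X : K →L[ℂ] K, HasSum (fun i => (a i : ℂ) * ⟪b i, X (b i)⟫_ℂ) (f X)

theorem IsDiag.hasSum_weights {f : (K →L[ℂ] K) → ℂ} {ι : Type*} {a : ι → ℝ} {b : ι → K}
    (h : IsDiag f a b) (h1 : f 1 = 1) : HasSum a 1 := by
  have := h.hasSum 1
  have hb : ∀ i, ⟪b i, (1 : K →L[ℂ] K) (b i)⟫_ℂ = 1 := fun i => by
    change ⟪b i, b i⟫_ℂ = 1
    rw [inner_self_eq_norm_sq_to_K, h.orthonormal.1]; simp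
  simp only [hb, mul_one, h1] at this
  exact Complex.hasSum_ofReal.1 (by simpa using this)

/-- Orthonormality leaves a single term of the series. Conversely, by `isDiag_of_rankOne`, these
values and total mass 1 determine a diagonal state. -/
theorem IsDiag.apply_rankOne {f : (K →L[ℂ] K) → ℂ} {ι : Type*} {a : ι → ℝ} {b : ι → K}
    (h : IsDiag f a b) (i : ι) (x : K) : f (rankOne ℂ x (b i)) = a i * ⟪b i, x⟫_ℂ := by
  classical
  have h1 := h.hasSum (rankOne ℂ x (b i))
  have h2 : ∀ j, j ≠ i → (a j : ℂ) * ⟪b j, rankOne ℂ x (b i) (b j)⟫_ℂ = 0 := by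
    intro j hj
    rw [rankOne_apply, h.orthonormal.2 hj.symm, zero_smul, inner_zero_right, mul_zero]
  have h3 := (hasSum_single i h2).unique h1
  rw [← h3, rankOne_apply, inner_self_eq_norm_sq_to_K, h.orthonormal.1]
  simp

theorem IsDiag.apply_rankOne' {f : (K →L[ℂ] K) → ℂ} {ι : Type*} {a : ι → ℝ} {b : ι → K}
    (h : IsDiag f a b) (i : ι) (x : K) : f (rankOne ℂ (b i) x) = a i * ⟪x, b i⟫_ℂ := by
  classical
  have h1 := h.hasSum (rankOne ℂ (b i) x)
  have h2 : ∀ j, j ≠ i → (a j : ℂ) * ⟪b j, rankOne ℂ (b i) x (b j)⟫_ℂ = 0 := by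
    intro j hj
    rw [rankOne_apply, inner_smul_right, h.orthonormal.2 hj, mul_zero, mul_zero]
  have h3 := (hasSum_single i h2).unique h1
  rw [← h3, rankOne_apply, inner_smul_right, inner_self_eq_norm_sq_to_K, h.orthonormal.1]
  simp

/-- A state that behaves like a normal state on rank one operators, with total mass `1`, is
normal. -/
theorem isDiag_of_rankOne {f : (K →L[ℂ] K) →ₗ[ℂ] ℂ} (hf : IsState f) {ι : Type*} {a : ι → ℝ}
    {b : ι → K} (hb : Orthonormal ℂ b) (ha : ∀ i, 0 < a i) (hsum : HasSum a 1)
    (h : ∀ i x, f (rankOne ℂ x (b i)) = a i * ⟪b i, x⟫_ℂ) : IsDiag f a b := by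
  classical
  refine ⟨hb, ha, fun X => ?_⟩
  let P : Finset ι → (K →L[ℂ] K) := fun s => ∑ i ∈ s, rankOne ℂ (b i) (b i)
  have hPstar : ∀ s, star (P s) = P s := fun s => by
    simp [P, star_sum, star_eq_adjoint]
  have hPb : ∀ s, ∀ i ∈ s, P s (b i) = b i := by
    intro s i hi
    simp only [P, sum_apply, rankOne_apply, orthonormal_iff_ite.1 hb]
    simp [hi]
  have hPP : ∀ s, P s * P s = P s := by
    intro s
    ext x
    change P s (P s x) = P s x
    conv_lhs => rw [show P s x = ∑ i ∈ s, ⟪b i, x⟫_ℂ • b i by simp [P, sum_apply]]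
    rw [map_sum, show P s x = ∑ i ∈ s, ⟪b i, x⟫_ℂ • b i by simp [P, sum_apply]]
    exact Finset.sum_congr rfl fun i hi => by rw [map_smul, hPb s i hi]
  have hfP : ∀ s, f (P s) = ((∑ i ∈ s, a i : ℝ) : ℂ) := by
    intro s
    simp only [P, map_sum, h]
    push_cast
    refine Finset.sum_congr rfl fun i _ => ?_
    rw [inner_self_eq_norm_sq_to_K, hb.1]; simp
  have hfXP : ∀ s, f (X * P s) = ∑ i ∈ s, (a i : ℂ) * ⟪b i, X (b i)⟫_ℂ := by
    intro s
    simp only [P, Finset.mul_sum, map_sum]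
    refine Finset.sum_congr rfl fun i _ => ?_
    rw [← h]
    congr 1
    exact InnerProductSpace.comp_rankOne _ _ X
  -- Cauchy–Schwarz for X and the projection 1 - P s: the missing mass of the weights controls the
  -- error of cutting X down to finitely many b i.
  have hbound : ∀ s, ‖f X - f (X * P s)‖ ^ 2 ≤ (f (X * star X)).re * (1 - ∑ i ∈ s, a i) := by
    intro s
    have h1 := hf.cauchy_schwarz (star X) (1 - P s)
    have h2 : star (1 - P s) * (1 - P s) = 1 - P s := by
      rw [star_sub, star_one, hPstar, sub_mul, one_mul, mul_sub, mul_one, hPP]; simp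
    rw [h2, star_star, map_sub, hfP, hf.map_one, mul_sub, mul_one, map_sub] at h1
    simpa using h1
  rw [HasSum, SummationFilter.unconditional_filter]
  simp only [← hfXP]
  rw [tendsto_iff_norm_sub_tendsto_zero]
  have h0 : Tendsto (fun s : Finset ι => Real.sqrt ((f (X * star X)).re * (1 - ∑ i ∈ s, a i)))
      atTop (𝓝 0) := by
    have h1 : Tendsto (fun s : Finset ι => ∑ i ∈ s, a i) atTop (𝓝 1) := hsum
    have := ((tendsto_const_nhds (x := (1 : ℝ))).sub h1).const_mul ((f (X * star X)).re)
    simpa using this.sqrt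
  refine squeeze_zero (fun _ => norm_nonneg _) (fun s => ?_) h0
  rw [norm_sub_rev]
  exact Real.le_sqrt_of_sq_le (hbound s)

theorem isCompactOperator_rankOne (x y : K) : IsCompactOperator (rankOne ℂ x y) := by
  have h : IsCompactOperator (id : ℂ → ℂ) :=
    (isCompactOperator_id_iff_finiteDimensional (𝕜 := ℂ) (E := ℂ)).2 inferInstance
  rw [rankOne_def']
  exact (h.comp_clm (innerSL ℂ y)).clm_comp (toSpanSingleton ℂ x)

theorem isCompactOperator_sum {ι : Type*} (s : Finset ι) (F : ι → K →L[ℂ] K)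
    (h : ∀ i ∈ s, IsCompactOperator (F i)) : IsCompactOperator (∑ i ∈ s, F i : K →L[ℂ] K) := by
  classical
  induction s using Finset.induction_on with
  | empty => simpa using isCompactOperator_zero
  | insert i s hi ih =>
    rw [Finset.sum_insert hi]
    exact (h i (by simp)).add (ih fun j hj => h j (by simp [hj]))

/-- Hilbert-Schmidt operators are compact. -/
theorem isCompactOperator_of_summable_sq {ι : Type*} (e : HilbertBasis ι ℂ K) (S : K →L[ℂ] K)
    (hS : Summable fun i => ‖S (e i)‖ ^ 2) : IsCompactOperator S := by
  classical
  let F : Finset ι → (K →L[ℂ] K) := fun s => ∑ i ∈ s, rankOne ℂ (S (e i)) (e i)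
  have hF : ∀ s x, F s x = ∑ i ∈ s, ⟪e i, x⟫_ℂ • S (e i) := fun s x => by simp [F, sum_apply]
  have hconv : ∀ x, Tendsto (fun s => F s x) atTop (𝓝 (S x)) := by
    intro x
    have h1 := (e.hasSum_repr x).mapL S
    simp only [HilbertBasis.repr_apply_apply, map_smul] at h1
    simp only [hF]
    exact h1
  -- Cauchy–Schwarz and Bessel bound the tail uniformly in x, so the finite rank truncations
  -- converge in operator norm.
  have hbd : ∀ s x, ‖S x - F s x‖ ≤
      Real.sqrt (∑' i, ‖S (e i)‖ ^ 2 - ∑ i ∈ s, ‖S (e i)‖ ^ 2) * ‖x‖ := by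
    intro s x
    refine le_of_tendsto ((hconv x).sub_const (F s x)).norm ?_
    filter_upwards [eventually_ge_atTop s] with t ht
    have h1 : F t x - F s x = ∑ i ∈ t \ s, ⟪e i, x⟫_ℂ • S (e i) := by
      rw [hF, hF, ← Finset.sum_sdiff ht]; abel
    have h2 : ∑ i ∈ t \ s, ‖S (e i)‖ ^ 2 ≤ ∑' i, ‖S (e i)‖ ^ 2 - ∑ i ∈ s, ‖S (e i)‖ ^ 2 := by
      have := hS.sum_le_tsum t fun i _ => sq_nonneg ‖S (e i)‖
      rw [← Finset.sum_sdiff ht] at this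
      linarith
    rw [h1]
    calc ‖∑ i ∈ t \ s, ⟪e i, x⟫_ℂ • S (e i)‖ ≤ ∑ i ∈ t \ s, ‖⟪e i, x⟫_ℂ‖ * ‖S (e i)‖ := by
          refine (norm_sum_le _ _).trans (Finset.sum_le_sum fun i _ => ?_)
          rw [norm_smul]
      _ ≤ Real.sqrt (∑ i ∈ t \ s, ‖⟪e i, x⟫_ℂ‖ ^ 2) * Real.sqrt (∑ i ∈ t \ s, ‖S (e i)‖ ^ 2) :=
          Real.sum_mul_le_sqrt_mul_sqrt _ _ _
      _ ≤ ‖x‖ * Real.sqrt (∑' i, ‖S (e i)‖ ^ 2 - ∑ i ∈ s, ‖S (e i)‖ ^ 2) := by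
          gcongr
          rw [Real.sqrt_le_left (norm_nonneg _)]
          exact e.orthonormal.sum_inner_products_le x
      _ = _ := mul_comm _ _
  have hlim : Tendsto F atTop (𝓝 S) := by
    rw [tendsto_iff_norm_sub_tendsto_zero]
    have h0 : Tendsto (fun s : Finset ι =>
        Real.sqrt (∑' i, ‖S (e i)‖ ^ 2 - ∑ i ∈ s, ‖S (e i)‖ ^ 2)) atTop (𝓝 0) := by
      have h1 : Tendsto (fun s : Finset ι => ∑ i ∈ s, ‖S (e i)‖ ^ 2) atTop _ := hS.hasSum
      have := ((tendsto_const_nhds (x := ∑' i, ‖S (e i)‖ ^ 2)).sub h1)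
      simpa using this.sqrt
    refine squeeze_zero (fun _ => norm_nonneg _) (fun s => ?_) h0
    rw [norm_sub_rev]
    exact opNorm_le_bound _ (Real.sqrt_nonneg _) fun x => hbd s x
  exact isCompactOperator_of_tendsto hlim (Eventually.of_forall fun s =>
    isCompactOperator_sum _ _ fun i _ => isCompactOperator_rankOne _ _)

/-- With R = S*S the diagonal entries of R are ‖S e i‖², so finite trace means that S is
Hilbert–Schmidt. -/
theorem isCompactOperator_of_trace {ι : Type*} (e : HilbertBasis ι ℂ K) (R : K →L[ℂ] K)
    (hR : R.IsPositive) (hs : Summable fun i => ⟪e i, R (e i)⟫_ℂ) : IsCompactOperator R := by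
  obtain ⟨S, hS⟩ := CStarAlgebra.nonneg_iff_eq_star_mul_self.1 (R.nonneg_iff_isPositive.2 hR)
  have h1 : ∀ i, ⟪e i, R (e i)⟫_ℂ = ((‖S (e i)‖ ^ 2 : ℝ) : ℂ) := by
    intro i
    rw [hS, star_eq_adjoint]
    change ⟪e i, adjoint S (S (e i))⟫_ℂ = _
    rw [adjoint_inner_right, inner_self_eq_norm_sq_to_K]
    simp
  simp only [h1] at hs
  have h2 : IsCompactOperator S := isCompactOperator_of_summable_sq e S (by exact_mod_cast hs)
  rw [hS]
  exact h2.clm_comp (star S)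

/-- The spectral theorem for compact self-adjoint operators. -/
theorem exists_eigenbasis (D : K →L[ℂ] K) (hD : IsCompactOperator D)
    (hs : (D : K →ₗ[ℂ] K).IsSymmetric) :
    ∃ (ι : Type u) (e : HilbertBasis ι ℂ K) (d : ι → ℝ), ∀ i, D (e i) = (d i : ℂ) • e i := by
  -- All complex μ are admitted: those that are not eigenvalues contribute an empty basis, and μ = 0
  -- supplies the kernel.
  let E : ℂ → Submodule ℂ K := fun μ => Module.End.eigenspace (D : K →ₗ[ℂ] K) μ
  have hE : ∀ μ x, x ∈ E μ ↔ D x = μ • x := fun μ x => by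
    simp [E]
  have hEc : ∀ μ, CompleteSpace (E μ) := by
    intro μ
    have : IsClosed (E μ : Set K) := by
      have : (E μ : Set K) = {x | D x = μ • x} := by ext x; exact hE μ x
      rw [this]
      exact isClosed_eq (by fun_prop) (by fun_prop)
    exact this.completeSpace_coe
  choose w b hb using fun μ => _root_.exists_hilbertBasis ℂ (E μ)
  let v : (Σ μ, w μ) → K := fun p => ((b p.1 p.2 : E p.1) : K)
  have hv : Orthonormal ℂ v :=
    (hs.orthogonalFamily_eigenspaces).orthonormal_sigma_orthonormal fun μ => (b μ).orthonormal
  have hsp : (Submodule.span ℂ (Set.range v))ᗮ = ⊥ := by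
    rw [Submodule.eq_bot_iff]
    intro h hh
    have h1 := orthogonalComplement_iSup_eigenspaces_eq_bot hD hs
    rw [Submodule.eq_bot_iff] at h1
    refine h1 h ?_
    rw [← Submodule.iInf_orthogonal, Submodule.mem_iInf]
    intro μ
    rw [Submodule.mem_orthogonal']
    intro x hx
    have h2 := (b μ).hasSum_repr ⟨x, hx⟩
    have h3 := h2.mapL ((innerSL ℂ h) ∘L (E μ).subtypeL)
    have h4 : ∀ i, ((innerSL ℂ h) ∘L (E μ).subtypeL)
        ((b μ).repr ⟨x, hx⟩ i • b μ i) = 0 := by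
      intro i
      have h5 : ⟪h, v ⟨μ, i⟩⟫_ℂ = 0 :=
        (Submodule.mem_orthogonal' _ _).1 hh _ (Submodule.subset_span ⟨⟨μ, i⟩, rfl⟩)
      rw [map_smul]
      change _ • ⟪h, v ⟨μ, i⟩⟫_ℂ = 0
      rw [h5, smul_zero]
    simp only [h4] at h3
    exact h3.unique hasSum_zero
  refine ⟨_, HilbertBasis.mkOfOrthogonalEqBot hv hsp, fun p => p.1.re, fun p => ?_⟩
  rw [HilbertBasis.coe_mkOfOrthogonalEqBot]
  have hmem : D (v p) = p.1 • v p := (hE _ _).1 (b p.1 p.2).2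
  have hne : v p ≠ 0 := hv.ne_zero p
  have hreal := hs.conj_eigenvalue_eq_self (μ := p.1)
    (Module.End.hasEigenvalue_of_hasEigenvector
      ⟨by rw [Module.End.mem_genEigenspace_one]; exact hmem, hne⟩)
  rw [hmem]
  congr 1
  exact (Complex.conj_eq_iff_re.1 hreal).symm

theorem hasSum_subtype_pos {ι : Type*} {a : ι → ℝ} (h0 : ∀ i, 0 ≤ a i) {c : ℝ} (h : HasSum a c) :
    HasSum (fun i : {i // 0 < a i} => a i) c := by
  have : Function.support a ⊆ {i | 0 < a i} := fun i hi => (h0 i).lt_of_ne' hi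
  exact (hasSum_subtype_iff_of_support_subset this).2 h

/-- A state of `B(K)` that is completely additive on Hilbert bases is diagonalizable. -/
theorem exists_isDiag {f : (K →L[ℂ] K) →ₗ[ℂ] ℂ} (hf : IsState f)
    (hn : ∀ (ι : Type u) (e : HilbertBasis ι ℂ K), HasSum (fun i => f (rankOne ℂ (e i) (e i))) 1) :
    ∃ (ι : Type u) (a : ι → ℝ) (b : ι → K), IsDiag f a b := by
  have hfc : Continuous f :=
    AddMonoidHomClass.continuous_of_bound f 1 fun X => by simpa using hf.norm_le X
  let fL : (K →L[ℂ] K) →L[ℂ] ℂ := ⟨f, hfc⟩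
  -- The candidate density operator R is the Riesz representative of the form (v, w) ↦ f(|w⟩⟨v|).
  let B : K →L⋆[ℂ] K →L[ℂ] ℂ :=
    (ContinuousLinearMap.postcomp K fL).comp ((rankOne ℂ : K →L[ℂ] K →L⋆[ℂ] (K →L[ℂ] K)).flip)
  let R := continuousLinearMapOfBilin B
  have hR : ∀ v w, ⟪R v, w⟫_ℂ = f (rankOne ℂ w v) := fun v w =>
    continuousLinearMapOfBilin_apply B v w
  have hpos1 : ∀ v, 0 ≤ f (rankOne ℂ v v) := by
    intro v
    obtain ⟨c, hc⟩ := CStarAlgebra.nonneg_iff_eq_star_mul_self.1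
      ((nonneg_iff_isPositive _).2 (isPositive_rankOne_self (𝕜 := ℂ) v))
    rw [hc]
    exact hf.nonneg c
  have hRpos : R.IsPositive := by
    rw [isPositive_iff_complex]
    intro x
    rw [hR]
    have := Complex.nonneg_iff.1 (hpos1 x)
    exact ⟨Complex.ext rfl this.2, this.1⟩
  have hRR : ∀ v w, ⟪w, R v⟫_ℂ = f (rankOne ℂ v w) := fun v w => by
    rw [← hR]; exact (hRpos.isSymmetric w v).symm
  obtain ⟨w, e₀, -⟩ := _root_.exists_hilbertBasis ℂ K
  have hRc : IsCompactOperator R := isCompactOperator_of_trace e₀ R hRpos (by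
    simp only [hRR]; exact (hn _ e₀).summable)
  obtain ⟨ι, e, d, hd⟩ := exists_eigenbasis R hRc hRpos.isSymmetric
  have hre : ∀ i x, f (rankOne ℂ x (e i)) = d i * ⟪e i, x⟫_ℂ := by
    intro i x
    rw [← hR, hd, inner_smul_left]; simp
  have hself : ∀ i, ⟪e i, e i⟫_ℂ = 1 := fun i => by
    rw [inner_self_eq_norm_sq_to_K, e.orthonormal.1]; simp
  have hd0 : ∀ i, 0 ≤ d i := by
    intro i
    have := hpos1 (e i)
    rw [hre, hself, mul_one] at this
    exact_mod_cast this
  have hsum : HasSum d 1 := by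
    have := hn _ e
    simp only [hre, hself, mul_one] at this
    exact Complex.hasSum_ofReal.1 (by simpa using this)
  exact ⟨{i // 0 < d i}, fun i => d i, fun i => e i, isDiag_of_rankOne hf
    (e.orthonormal.comp _ Subtype.val_injective) (fun i => i.2) (hasSum_subtype_pos hd0 hsum)
    fun i x => hre i x⟩

theorem hasSum_norm_sq_inner {ι E : Type*} [NormedAddCommGroup E] [InnerProductSpace ℂ E]
    (e : HilbertBasis ι ℂ E) (x : E) :
    HasSum (fun i => ‖⟪e i, x⟫_ℂ‖ ^ 2) (‖x‖ ^ 2) := by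
  have h := e.hasSum_inner_mul_inner x x
  rw [inner_self_eq_norm_sq_to_K] at h
  have h1 : ∀ i, ⟪x, e i⟫_ℂ * ⟪e i, x⟫_ℂ = ((‖⟪e i, x⟫_ℂ‖ ^ 2 : ℝ) : ℂ) := by
    intro i
    rw [← inner_conj_symm x (e i), RCLike.conj_mul]; simp
  simp only [h1] at h
  exact Complex.hasSum_ofReal.1 (by simpa using h)

variable {m : K →L[ℂ] G →L[ℂ] H}

/-- Parseval for a product basis, summed first over the second factor. It provides the complete
additivity that makes vector states diagonalizable on a factor. -/
theorem IsTens.hasSum_norm_sq (hm : IsTens m) {ι : Type*} (e : HilbertBasis ι ℂ K) (ξ : H) :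
    HasSum (fun i => ‖adjoint (m (e i)) ξ‖ ^ 2) (‖ξ‖ ^ 2) := by
  obtain ⟨w, c, -⟩ := _root_.exists_hilbertBasis ℂ G
  obtain ⟨b, hb⟩ := hm.exists_hilbertBasis e c
  refine (hasSum_norm_sq_inner b ξ).prod_fiberwise fun i => ?_
  simp only [hb, ← adjoint_inner_right]
  exact hasSum_norm_sq_inner c _

theorem IsTens.vec_amp_rankOne (hm : IsTens m) (ξ : H) (k k' : K) :
    vec ξ (hm.amp (rankOne ℂ k k')) = ⟪adjoint (m k) ξ, adjoint (m k') ξ⟫_ℂ := by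
  rw [vec_apply, hm.amp_rankOne, adjoint_inner_left]

/-- Vector states are diagonalizable on tensor factors. -/
theorem IsTens.exists_isDiag_vec (hm : IsTens m) (ξ : H) (hξ : ‖ξ‖ = 1) :
    ∃ (ι : Type u) (a : ι → ℝ) (b : ι → K), IsDiag (fun A => vec ξ (hm.amp A)) a b := by
  refine exists_isDiag ((isState_vec ξ hξ).comp hm.amp) fun ι e => ?_
  have h := hm.hasSum_norm_sq e ξ
  rw [hξ, one_pow] at h
  have h1 : ∀ i, vec ξ (hm.amp (rankOne ℂ (e i) (e i))) =
      ((‖adjoint (m (e i)) ξ‖ ^ 2 : ℝ) : ℂ) := fun i => by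
    rw [hm.vec_amp_rankOne, inner_self_eq_norm_sq_to_K]; simp
  change HasSum (fun i => vec ξ (hm.amp (rankOne ℂ (e i) (e i)))) 1
  simp only [h1]
  simpa using Complex.hasSum_ofReal.2 h

/-- The two marginals of a vector state have the same weights. -/
theorem IsTens.exists_isDiag_flip (hm : IsTens m) (ξ : H) (hξ : ‖ξ‖ = 1) {ι : Type*} {a : ι → ℝ}
    {b : ι → K} (h : IsDiag (fun A => vec ξ (hm.amp A)) a b) :
    ∃ b' : ι → G, IsDiag (fun B => vec ξ (hm.flip.amp B)) a b' := by
  classical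
  have hst := isState_vec ξ hξ
  have hsum : HasSum a 1 := h.hasSum_weights (by simpa using hst.map_one)
  -- The Schmidt partner of b i: contracting ξ with b i gives orthogonal vectors with squared norm a
  -- i, and contracting back with g i returns a i • b i.
  let g : ι → G := fun i => adjoint (m (b i)) ξ
  have hg : ∀ i j, ⟪g i, g j⟫_ℂ = a j * ⟪b j, b i⟫_ℂ := fun i j => by
    rw [← hm.vec_amp_rankOne, h.apply_rankOne]
  let s : ι → ℝ := fun i => Real.sqrt (a i)
  have hs : ∀ i, s i * s i = a i := fun i => Real.mul_self_sqrt (h.pos i).le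
  have hs0 : ∀ i, s i ≠ 0 := fun i => (Real.sqrt_pos.2 (h.pos i)).ne'
  have hsC : ∀ i, (s i : ℂ) * s i = a i := fun i => by exact_mod_cast hs i
  have hs0C : ∀ i, (s i : ℂ) ≠ 0 := fun i => by exact_mod_cast hs0 i
  have hgk : ∀ i, adjoint (m.flip (g i)) ξ = (a i : ℂ) • b i := by
    intro i
    refine ext_inner_left ℂ fun k => ?_
    rw [adjoint_inner_right, flip_apply, ← adjoint_inner_right, ← hm.vec_amp_rankOne,
      h.apply_rankOne', inner_smul_right]
  refine ⟨fun i => ((s i : ℂ)⁻¹) • g i, isDiag_of_rankOne (hst.comp hm.flip.amp) ?_ h.pos hsum ?_⟩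
  · rw [orthonormal_iff_ite]
    intro i j
    rw [inner_smul_left, inner_smul_right, hg, orthonormal_iff_ite.1 h.orthonormal]
    by_cases hij : i = j
    · subst hij
      simp only [if_true, mul_one, map_inv₀, Complex.conj_ofReal]
      rw [← hsC]
      field_simp [hs0C i]
    · rw [if_neg hij, if_neg (Ne.symm hij)]; simp
  · intro i y
    change vec ξ (hm.flip.amp (rankOne ℂ y (((s i : ℂ)⁻¹) • g i))) = _
    rw [hm.flip.vec_amp_rankOne, adjoint_inner_left, inner_smul_left, map_smul, map_smulₛₗ,
      smul_apply, hgk, flip_apply, map_smul, map_smul, smul_apply, smul_apply, inner_smul_right,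
      inner_smul_right, ← adjoint_inner_left]
    ring

/-! ### Decreasing lists of weights and their counting functions. -/

section Lists

/-- The sequence `Λ` lists the members of the family `a`, followed by zeros if necessary. -/
def Lists {ι : Type*} (a : ι → ℝ) (Λ : ℕ → ℝ) : Prop :=
  ∃ e : ι ≃ {n // 0 < Λ n}, ∀ i, Λ (e i) = a i

theorem Lists.of_fibers {ι : Type*} {a : ι → ℝ} {Λ : ℕ → ℝ} (ha : ∀ i, 0 < a i)
    (h : ∀ μ, 0 < μ → Nonempty ({i // a i = μ} ≃ {n // Λ n = μ})) : Lists a Λ := by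
  let g : {n // 0 < Λ n} → ℝ := fun n => Λ n
  have h' : ∀ μ, Nonempty ({i // a i = μ} ≃ {n // g n = μ}) := by
    intro μ
    by_cases hμ : 0 < μ
    · obtain ⟨e⟩ := h μ hμ
      refine ⟨e.trans ⟨fun n => ⟨⟨n, by rw [n.2]; exact hμ⟩, n.2⟩, fun n => ⟨n.1, n.2⟩,
        fun _ => rfl, fun _ => rfl⟩⟩
    · have : IsEmpty {i // a i = μ} := ⟨fun i => hμ (i.2 ▸ ha i)⟩
      have : IsEmpty {n // g n = μ} := ⟨fun i => hμ (i.2 ▸ i.1.2)⟩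
      exact ⟨Equiv.equivOfIsEmpty _ _⟩
  let e := fun μ => (h' μ).some
  exact ⟨Equiv.ofFiberEquiv e, fun i => Equiv.ofFiberEquiv_map e i⟩

/-- Counting is insensitive to the padding zeros as long as p forces positivity. -/
theorem Lists.fiber {ι : Type*} {a : ι → ℝ} {Λ : ℕ → ℝ} (h : Lists a Λ) (p : ℝ → Prop)
    (hp : ∀ x, p x → 0 < x) : Nonempty ({i // p (a i)} ≃ {n // p (Λ n)}) := by
  obtain ⟨e, he⟩ := h
  refine ⟨(e.subtypeEquiv (q := fun n : {n // 0 < Λ n} => p (Λ n)) fun i => by rw [he]).trans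
    ⟨fun n => ⟨n.1, n.2⟩, fun n => ⟨⟨n, hp _ n.2⟩, n.2⟩, fun _ => rfl, fun _ => rfl⟩⟩

theorem Lists.congr {ι κ : Type*} {a : ι → ℝ} {c : κ → ℝ} {Λ : ℕ → ℝ} (h : Lists a Λ) (e : κ ≃ ι)
    (he : ∀ k, a (e k) = c k) : Lists c Λ := by
  obtain ⟨e', he'⟩ := h
  exact ⟨e.trans e', fun k => by simp [he', he]⟩

theorem Lists.equiv {ι κ : Type*} {a : ι → ℝ} {c : κ → ℝ} {Λ : ℕ → ℝ} (h : Lists a Λ)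
    (h' : Lists c Λ) : ∃ e : ι ≃ κ, ∀ i, c (e i) = a i := by
  obtain ⟨e, he⟩ := h
  obtain ⟨e', he'⟩ := h'
  exact ⟨e.trans e'.symm, fun i => by rw [← he', Equiv.trans_apply, Equiv.apply_symm_apply, he]⟩

theorem Lists.hasSum {ι : Type*} {a : ι → ℝ} {Λ : ℕ → ℝ} (h : Lists a Λ) (h0 : ∀ n, 0 ≤ Λ n)
    {c : ℝ} (ha : HasSum a c) : HasSum Λ c := by
  obtain ⟨e, he⟩ := h
  have h1 : HasSum (fun n : {n // 0 < Λ n} => Λ n) c := by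
    rw [← e.hasSum_iff]
    convert ha using 1
    ext i; exact he i
  have : Function.support Λ ⊆ {n | 0 < Λ n} := fun i hi => (h0 i).lt_of_ne' hi
  exact (hasSum_subtype_iff_of_support_subset this).1 h1

theorem finite_lt_of_summable {ι : Type*} {a : ι → ℝ} (ha : Summable a) {s : ℝ} (hs : 0 < s) :
    {i | s < a i}.Finite := by
  have := ha.tendsto_cofinite_zero.eventually (gt_mem_nhds hs)
  rw [eventually_cofinite] at this
  exact this.subset fun i hi => not_lt.2 (le_of_lt hi)

theorem finite_eq_of_summable {ι : Type*} {a : ι → ℝ} (ha : Summable a) {s : ℝ} (hs : 0 < s) :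
    {i | a i = s}.Finite :=
  (finite_lt_of_summable ha (half_pos hs)).subset fun i hi => by
    simp only [Set.mem_ofPred_eq] at hi ⊢
    rw [hi]; exact half_lt_self hs

/-- Decreasing rearrangement. -/
theorem exists_lists {ι : Type*} {a : ι → ℝ} (ha : ∀ i, 0 < a i) (hs : Summable a) :
    ∃ Λ : ℕ → ℝ, Antitone Λ ∧ (∀ n, 0 ≤ Λ n) ∧ Lists a Λ := by
  have hfin : ∀ s, 0 < s → {i | s < a i}.Finite := fun s h => finite_lt_of_summable hs h
  -- The rearrangement is the generalized inverse of the counting function N; `key` below is the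
  -- resulting equivalence s < Λ n ↔ n < N s.
  let N : ℝ → ℕ := fun s => {i | s < a i}.ncard
  have hN : ∀ s t, 0 < s → s ≤ t → N t ≤ N s := fun s t h hst =>
    Set.ncard_le_ncard (fun i (hi : t < a i) => lt_of_le_of_lt hst hi) (hfin s h)
  let S : ℕ → Set ℝ := fun n => {s | 0 < s ∧ N s ≤ n}
  have hSne : ∀ n, (S n).Nonempty := by
    intro n
    have : ∃ s : ℝ, 0 < s ∧ N s = 0 := by
      have : 0 ≤ ∑' i, a i := tsum_nonneg fun i => (ha i).le
      refine ⟨∑' i, a i + 1, by linarith, ?_⟩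
      have : {i | ∑' i, a i + 1 < a i} = ∅ := by
        ext i
        simp only [Set.mem_ofPred_eq, Set.mem_empty_iff_false, iff_false, not_lt]
        have := hs.le_tsum i (fun j _ => (ha j).le)
        linarith
      simp only [N, this, Set.ncard_empty]
    obtain ⟨s, h1, h2⟩ := this
    exact ⟨s, h1, by omega⟩
  have hSbdd : ∀ n, BddBelow (S n) := fun n => ⟨0, fun s hs => hs.1.le⟩
  let Λ : ℕ → ℝ := fun n => sInf (S n)
  -- near `s` from the right, and near `μ` from the left, `N` is constant
  have hright : ∀ s, 0 < s → ∃ s', s < s' ∧ N s' = N s := by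
    intro s h
    rcases (hfin s h).toFinset.eq_empty_or_nonempty with he | hne
    · refine ⟨s + 1, by linarith, le_antisymm (hN _ _ h (by linarith)) ?_⟩
      rw [Set.Finite.toFinset_eq_empty] at he
      simp only [N, he, Set.ncard_empty, zero_le]
    · obtain ⟨i, hi, hmin⟩ := Finset.exists_min_image _ a hne
      rw [Set.Finite.mem_toFinset] at hi
      have hi' : s < a i := hi
      refine ⟨(s + a i) / 2, by linarith, le_antisymm (hN _ _ h (by linarith)) ?_⟩
      refine Set.ncard_le_ncard (fun j hj => ?_) (hfin _ (by linarith))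
      have := hmin j ((Set.Finite.mem_toFinset _).2 hj)
      simp only [Set.mem_ofPred_eq]
      linarith
  have key : ∀ n s, 0 < s → (s < Λ n ↔ n < N s) := by
    intro n s h
    constructor
    · intro hlt
      by_contra hcon
      exact absurd (csInf_le (hSbdd n) ⟨h, not_lt.1 hcon⟩) (not_le.2 hlt)
    · intro hlt
      obtain ⟨s', h1, h2⟩ := hright s h
      refine lt_of_lt_of_le h1 (le_csInf (hSne n) fun t ht => ?_)
      by_contra hcon
      have := hN t s' ht.1 (not_le.1 hcon).le
      have := ht.2
      omega
  have h0 : ∀ n, 0 ≤ Λ n := fun n => le_csInf (hSne n) fun s hs => hs.1.le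
  refine ⟨Λ, fun n m hnm => ?_, h0, Lists.of_fibers ha fun μ hμ => ?_⟩
  · exact csInf_le_csInf (hSbdd m) (hSne n) fun s hs => ⟨hs.1, hs.2.trans hnm⟩
  · have hleft : ∃ t, 0 < t ∧ t < μ ∧ ∀ s, t ≤ s → s < μ → {i | s < a i} = {i | μ ≤ a i} := by
      have hf2 : {i | μ / 2 < a i ∧ a i < μ}.Finite :=
        (hfin (μ / 2) (by linarith)).subset fun i hi => hi.1
      rcases hf2.toFinset.eq_empty_or_nonempty with he | hne
      · refine ⟨μ / 2, by linarith, by linarith, fun s h1 h2 => ?_⟩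
        rw [Set.Finite.toFinset_eq_empty] at he
        ext i
        constructor
        · intro hi
          by_contra hcon
          have : i ∈ ({i | μ / 2 < a i ∧ a i < μ} : Set ι) :=
            ⟨lt_of_le_of_lt h1 hi, not_le.1 hcon⟩
          rw [he] at this
          exact this
        · intro hi
          exact lt_of_lt_of_le h2 hi
      · obtain ⟨j, hj, hmax⟩ := Finset.exists_max_image _ a hne
        rw [Set.Finite.mem_toFinset] at hj
        refine ⟨a j, ha j, hj.2, fun s h1 h2 => ?_⟩
        ext i
        constructor
        · intro hi
          by_contra hcon
          have hi' : s < a i := hi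
          have := hmax i ((Set.Finite.mem_toFinset _).2
            ⟨lt_trans (lt_of_lt_of_le hj.1 h1) hi, not_le.1 hcon⟩)
          linarith
        · intro hi
          exact lt_of_lt_of_le h2 hi
    obtain ⟨t, ht0, htμ, ht⟩ := hleft
    have hge : ∀ n, μ ≤ Λ n ↔ n < {i | μ ≤ a i}.ncard := by
      intro n
      constructor
      · intro h
        have := (key n t ht0).1 (lt_of_lt_of_le htμ h)
        simp only [N, ht t le_rfl htμ] at this
        exact this
      · intro h
        refine le_of_forall_lt fun s hs => ?_
        rcases le_total t s with h1 | h1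
        · rw [key n s (lt_of_lt_of_le ht0 h1)]
          simp only [N, ht s h1 hs]
          exact h
        · refine lt_of_le_of_lt h1 ?_
          rw [key n t ht0]
          simp only [N, ht t le_rfl htμ]
          exact h
    -- With indices starting at 0, the weights above μ occupy the first N μ places and the weights
    -- equal to μ follow them.
    have hset : {n | Λ n = μ} = Set.Ico (N μ) ({i | μ ≤ a i}.ncard) := by
      ext n
      have h1 := key n μ hμ
      have h2 := hge n
      simp only [Set.mem_ofPred_eq, Set.mem_Ico]
      rw [← h2, ← not_lt, ← h1, not_lt]
      constructor
      · intro h; exact ⟨h.le, h.ge⟩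
      · intro h; exact le_antisymm h.1 h.2
    have hfge : {i | μ ≤ a i}.Finite := (hfin t ht0).subset fun i hi => lt_of_lt_of_le htμ hi
    have hcard : {i | a i = μ}.ncard = {n | Λ n = μ}.ncard := by
      have h1 : {i | a i = μ} = {i | μ ≤ a i} \ {i | μ < a i} := by
        ext i
        simp only [Set.mem_ofPred_eq, Set.mem_sdiff, not_lt]
        constructor
        · intro h; exact ⟨h.ge, h.le⟩
        · intro h; exact le_antisymm h.2 h.1
      have h2 : {n | Λ n = μ}.ncard = {i | μ ≤ a i}.ncard - N μ := by
        rw [hset, Set.ncard_eq_toFinset_card', Set.toFinset_Ico, Nat.card_Ico]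
      have hsub : {i | μ < a i} ⊆ {i | μ ≤ a i} := by
        intro i hi
        simp only [Set.mem_ofPred_eq] at hi ⊢
        exact hi.le
      rw [h1, h2, Set.ncard_sdiff hsub (hfin μ hμ)]
    have hf1 : {i | a i = μ}.Finite := finite_eq_of_summable hs hμ
    have hf2 : {n | Λ n = μ}.Finite := by rw [hset]; exact Set.finite_Ico _ _
    have : Finite {i // a i = μ} := hf1.to_subtype
    have : Finite {n // Λ n = μ} := hf2.to_subtype
    exact Finite.card_eq.1 hcard

/-- Comparison of decreasing sequences through their counting functions. -/
theorem le_of_embedding {Λ Λ' : ℕ → ℝ} (h : Antitone Λ) (h' : Antitone Λ') (h0 : ∀ n, 0 ≤ Λ' n)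
    (hc : ∀ s, 0 < s → Nonempty ({n // s < Λ n} ↪ {n // s < Λ' n})) (n : ℕ) : Λ n ≤ Λ' n := by
  by_contra hlt
  obtain ⟨s, hs1, hs2⟩ := exists_between (not_le.1 hlt)
  obtain ⟨e⟩ := hc s ((h0 n).trans_lt hs1)
  -- Pigeonhole: the n + 1 indices up to n satisfy s < Λ, while an index with s < Λ' must be below n
  -- because Λ' n < s.
  let f : Fin (n + 1) → Fin n := fun i =>
    ⟨e ⟨i, hs2.trans_le (h (Nat.lt_succ_iff.1 i.2))⟩, by
      by_contra hge
      exact absurd (h' (not_lt.1 hge)) (not_le.2 (hs1.trans (e _).2))⟩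
  have hf : Function.Injective f := by
    intro i j hij
    have h1 : ((e ⟨i, _⟩ : {n // s < Λ' n}) : ℕ) = e ⟨j, _⟩ := congrArg Fin.val hij
    have h2 := e.injective (Subtype.ext h1)
    exact Fin.ext (congrArg Subtype.val h2)
  have := Fintype.card_le_of_injective f hf
  simp at this

end Lists

theorem hasSum_of_eq {ι E : Type*} [AddCommMonoid E] [TopologicalSpace E] {f g : ι → E} {c : E}
    (h : HasSum f c) (e : ∀ i, f i = g i) : HasSum g c := (funext e : f = g) ▸ h

/-! ### Diagonal density operators, the minimax principle and the ℓ¹ contraction of eigenvalue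
lists. -/

section Diag

variable {K : Type u} [NormedAddCommGroup K] [InnerProductSpace ℂ K] [CompleteSpace K]
  {ι : Type*} {a : ι → ℝ} {b : ι → K}

/-- The operator `∑ a i |b i⟩⟨b i|`. -/
def diagOp (a : ι → ℝ) (b : ι → K) : K →L[ℂ] K := ∑' i, (a i : ℂ) • rankOne ℂ (b i) (b i)

theorem hasSum_diagOp (hb : Orthonormal ℂ b) (ha : Summable a) :
    HasSum (fun i => (a i : ℂ) • rankOne ℂ (b i) (b i)) (diagOp a b) := by
  refine Summable.hasSum (Summable.of_norm ?_)
  have : ∀ i, ‖(a i : ℂ) • rankOne ℂ (b i) (b i)‖ = |a i| := fun i => by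
    simp [norm_smul, hb.1]
  simp only [this]
  exact ha.abs

theorem hasSum_diagOp_apply (hb : Orthonormal ℂ b) (ha : Summable a) (x : K) :
    HasSum (fun i => ((a i : ℂ) * ⟪b i, x⟫_ℂ) • b i) (diagOp a b x) := by
  have : HasSum _ (diagOp a b x) := (hasSum_diagOp hb ha).mapL (ContinuousLinearMap.apply ℂ K x)
  refine hasSum_of_eq this fun i => ?_
  simp [mul_smul]

theorem hasSum_inner_diagOp (hb : Orthonormal ℂ b) (ha : Summable a) (x y : K) :
    HasSum (fun i => (a i : ℂ) * (⟪b i, x⟫_ℂ * ⟪y, b i⟫_ℂ)) ⟪y, diagOp a b x⟫_ℂ := by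
  have : HasSum _ ⟪y, diagOp a b x⟫_ℂ := (hasSum_diagOp_apply hb ha x).mapL (innerSL ℂ y)
  refine hasSum_of_eq this fun i => ?_
  simp [mul_assoc]

theorem inner_mul_inner_swap (x y : K) : ⟪x, y⟫_ℂ * ⟪y, x⟫_ℂ = ((‖⟪x, y⟫_ℂ‖ ^ 2 : ℝ) : ℂ) := by
  rw [← inner_conj_symm y x, RCLike.mul_conj]; simp

theorem hasSum_inner_diagOp_self (hb : Orthonormal ℂ b) (ha : Summable a) (x : K) :
    HasSum (fun i => a i * ‖⟪b i, x⟫_ℂ‖ ^ 2) (⟪x, diagOp a b x⟫_ℂ).re := by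
  have h := Complex.hasSum_re (hasSum_inner_diagOp hb ha x x)
  convert h using 1
  ext i
  rw [inner_mul_inner_swap, ← Complex.ofReal_mul, Complex.ofReal_re]

theorem isSymmetric_diagOp (hb : Orthonormal ℂ b) (ha : Summable a) :
    (diagOp a b : K →ₗ[ℂ] K).IsSymmetric := by
  intro x y
  have h1 := hasSum_inner_diagOp hb ha y x
  have h2 := (hasSum_inner_diagOp hb ha x y).star
  change ⟪diagOp a b x, y⟫_ℂ = ⟪x, diagOp a b y⟫_ℂ
  rw [← inner_conj_symm]
  refine h2.unique ?_
  convert h1 using 1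
  ext i
  simp [mul_comm]

theorem isPositive_diagOp (hb : Orthonormal ℂ b) (ha : Summable a) (h0 : ∀ i, 0 ≤ a i) :
    (diagOp a b).IsPositive := by
  refine isPositive_def.2 ⟨isSymmetric_diagOp hb ha, fun x => ?_⟩
  rw [reApplyInnerSelf_apply, inner_re_symm]
  exact (hasSum_inner_diagOp_self hb ha x).nonneg fun i => mul_nonneg (h0 i) (sq_nonneg _)

theorem isCompactOperator_diagOp (hb : Orthonormal ℂ b) (ha : Summable a) :
    IsCompactOperator (diagOp a b) :=
  isCompactOperator_of_tendsto (hasSum_diagOp hb ha) (Eventually.of_forall fun _ =>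
    isCompactOperator_sum _ _ fun _ _ => (isCompactOperator_rankOne _ _).smul _)

theorem diagOp_apply_self (hb : Orthonormal ℂ b) (ha : Summable a) (i : ι) :
    diagOp a b (b i) = (a i : ℂ) • b i := by
  classical
  refine (hasSum_diagOp_apply hb ha (b i)).unique ?_
  have h := hasSum_single (f := fun j => ((a j : ℂ) * ⟪b j, b i⟫_ℂ) • b j) i fun j hj => by
    rw [hb.2 hj]; simp
  convert h using 1
  rw [inner_self_eq_norm_sq_to_K, hb.1]; simp

theorem hasSum_trace_diagOp (hb : Orthonormal ℂ b) {c : ℝ} (ha : HasSum a c) (h0 : ∀ i, 0 ≤ a i)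
    {κ : Type*} (e : HilbertBasis κ ℂ K) :
    HasSum (fun k => (⟪e k, diagOp a b (e k)⟫_ℂ).re) c := by
  -- Tonelli: summing over k first gives a i by Parseval, summing over i first gives the diagonal
  -- entries of the operator.
  let F : ι × κ → ℝ := fun p => a p.1 * ‖⟪b p.1, e p.2⟫_ℂ‖ ^ 2
  have hrow : ∀ i, HasSum (fun k => F (i, k)) (a i) := by
    intro i
    have := (hasSum_norm_sq_inner e (b i)).mul_left (a i)
    rw [hb.1, one_pow, mul_one] at this
    refine hasSum_of_eq this fun k => ?_
    simp only [F]
    rw [norm_inner_symm]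
  have hF : Summable F := by
    rw [summable_prod_of_nonneg fun p => mul_nonneg (h0 _) (sq_nonneg _)]
    refine ⟨fun i => (hrow i).summable, ?_⟩
    exact ha.summable.congr fun i => (hrow i).tsum_eq.symm
  have hFc : HasSum F c := by
    have := hF.hasSum.prod_fiberwise hrow
    rw [ha.unique this]
    exact hF.hasSum
  have hsw : HasSum (fun p : κ × ι => F (p.2, p.1)) c := (Equiv.prodComm κ ι).hasSum_iff.2 hFc
  exact hsw.prod_fiberwise fun k => hasSum_inner_diagOp_self hb ha.summable (e k)

variable {f : (K →L[ℂ] K) → ℂ}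

/-- Identifies `diagOp a b` as the density operator of f, through its matrix elements. -/
theorem IsDiag.inner_diagOp (h : IsDiag f a b) (ha : Summable a) (x y : K) :
    ⟪y, diagOp a b x⟫_ℂ = f (rankOne ℂ x y) := by
  refine (hasSum_inner_diagOp h.orthonormal ha x y).unique ?_
  convert h.hasSum (rankOne ℂ x y) using 1
  ext i
  rw [rankOne_apply, inner_smul_right]; ring

/-- The minimax principle, in the form of a comparison of counting functions. -/
theorem nonempty_embedding_of_le {R T : K →L[ℂ] K} {κ : Type*} (hb : Orthonormal ℂ b)
    (ha : Summable a) (hR : ∀ x, HasSum (fun i => a i * ‖⟪b i, x⟫_ℂ‖ ^ 2) (⟪x, R x⟫_ℂ).re)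
    (u : HilbertBasis κ ℂ K) (τ : κ → ℝ) (hτ : Summable τ)
    (hT : ∀ x, HasSum (fun k => τ k * ‖⟪u k, x⟫_ℂ‖ ^ 2) (⟪x, T x⟫_ℂ).re)
    (hRT : ∀ x, (⟪x, R x⟫_ℂ).re ≤ (⟪x, T x⟫_ℂ).re) (h0 : ∀ i, 0 ≤ a i) (s : ℝ) (hs : 0 < s) :
    Nonempty ({i // s < a i} ↪ {k // s < τ k}) := by
  classical
  have hfa : Finite {i // s < a i} := (finite_lt_of_summable ha hs).to_subtype
  have hfτ : Finite {k // s < τ k} := (finite_lt_of_summable hτ hs).to_subtype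
  have := Fintype.ofFinite {i // s < a i}
  have := Fintype.ofFinite {k // s < τ k}
  -- V spans the vectors b i with weight above s, and L takes coordinates along the eigenvectors of
  -- T above s. On the kernel of L the form of T is at most s‖·‖², while a nonzero vector in the
  -- range of V has R-form above that. So L is injective and dimensions compare.
  let V : ({i // s < a i} → ℂ) →ₗ[ℂ] K := Fintype.linearCombination ℂ (fun i => b i.1)
  let L : ({i // s < a i} → ℂ) →ₗ[ℂ] ({k // s < τ k} → ℂ) :=
    LinearMap.pi fun k => (innerSL ℂ (u k.1)).toLinearMap ∘ₗ V
  have hVb : ∀ c (i : {i // s < a i}), ⟪b i.1, V c⟫_ℂ = c i := by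
    intro c i
    simp only [V, Fintype.linearCombination_apply, inner_sum, inner_smul_right,
      orthonormal_iff_ite.1 hb]
    rw [Finset.sum_eq_single i]
    · simp
    · intro j _ hj
      rw [if_neg fun h => hj (Subtype.ext h.symm), mul_zero]
    · simp
  have hVb' : ∀ c i, ¬ s < a i → ⟪b i, V c⟫_ℂ = 0 := by
    intro c i hi
    simp only [V, Fintype.linearCombination_apply, inner_sum, inner_smul_right,
      orthonormal_iff_ite.1 hb]
    refine Finset.sum_eq_zero fun j _ => ?_
    rw [if_neg (fun h => hi (by rw [h]; exact j.2)), mul_zero]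
  have hVn : ∀ c, ‖V c‖ ^ 2 = ∑ i, ‖c i‖ ^ 2 := by
    intro c
    have h1 : ⟪V c, V c⟫_ℂ = ∑ i, ((‖c i‖ ^ 2 : ℝ) : ℂ) := by
      conv_lhs => rw [show V c = ∑ i, c i • b i.1 from Fintype.linearCombination_apply _ _ _]
      rw [sum_inner]
      refine Finset.sum_congr rfl fun i _ => ?_
      rw [inner_smul_left, ← Fintype.linearCombination_apply ℂ (fun i : {i // s < a i} => b i.1)]
      change _ * ⟪b i.1, V c⟫_ℂ = _
      rw [hVb, RCLike.conj_mul]; simp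
    rw [inner_self_eq_norm_sq_to_K, ← Complex.ofReal_sum] at h1
    exact Complex.ofReal_injective (by simpa using h1)
  have hLinj : Function.Injective L := by
    rw [← LinearMap.ker_eq_bot, LinearMap.ker_eq_bot']
    intro c hc
    have hzero : ∀ k, s < τ k → ⟪u k, V c⟫_ℂ = 0 := fun k hk => congrFun hc ⟨k, hk⟩
    have h1 : (⟪V c, T (V c)⟫_ℂ).re ≤ s * ‖V c‖ ^ 2 := by
      refine hasSum_le (fun k => ?_) (hT (V c)) ((hasSum_norm_sq_inner u (V c)).mul_left s)
      by_cases hk : s < τ k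
      · rw [hzero k hk]; simp
      · exact mul_le_mul_of_nonneg_right (not_lt.1 hk) (sq_nonneg _)
    have h2 : ∑ i, a i.1 * ‖c i‖ ^ 2 ≤ (⟪V c, R (V c)⟫_ℂ).re := by
      have h3 := sum_le_hasSum (Finset.univ.map (Function.Embedding.subtype fun i => s < a i))
        (fun i _ => mul_nonneg (h0 i) (sq_nonneg _)) (hR (V c))
      rw [Finset.sum_map] at h3
      simpa [hVb] using h3
    have h4 : ∑ i, (a i.1 - s) * ‖c i‖ ^ 2 ≤ 0 := by
      have := (h2.trans (hRT _)).trans h1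
      rw [hVn, Finset.mul_sum, ← sub_nonpos, ← Finset.sum_sub_distrib] at this
      simpa [sub_mul] using this
    have h5 : ∀ i ∈ Finset.univ, 0 ≤ (a (i : {i // s < a i}).1 - s) * ‖c i‖ ^ 2 := fun i _ =>
      mul_nonneg (sub_nonneg.2 i.2.le) (sq_nonneg _)
    have h6 := (Finset.sum_eq_zero_iff_of_nonneg h5).1 (le_antisymm h4 (Finset.sum_nonneg h5))
    ext i
    have h7 := h6 i (Finset.mem_univ i)
    rcases mul_eq_zero.1 h7 with h | h
    · exact absurd i.2 (by linarith)
    · simpa using h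
  have hcard := LinearMap.finrank_le_finrank_of_injective hLinj
  rw [Module.finrank_fintype_fun_eq_card, Module.finrank_fintype_fun_eq_card] at hcard
  exact Function.Embedding.nonempty_of_card_le hcard

theorem eq_diagOp {κ : Type*} (u : HilbertBasis κ ℂ K) {T : K →L[ℂ] K} {τ : κ → ℝ}
    (hτ : Summable τ) (h : ∀ k, T (u k) = (τ k : ℂ) • u k) : T = diagOp τ u := by
  refine ContinuousLinearMap.ext_on (s := Set.range u)
    ((Submodule.dense_iff_topologicalClosure_eq_top).2 u.dense_span) ?_
  rintro _ ⟨k, rfl⟩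
  rw [h, diagOp_apply_self u.orthonormal hτ]

/-- Weyl monotonicity: R ≤ T as forms orders the counting functions, hence the decreasing lists. The
eigenbasis of T may include kernel vectors, so only its positive eigenvalues are listed. -/
theorem Lists.le_of_le {R T : K →L[ℂ] K} {κ : Type*} (hb : Orthonormal ℂ b)
    (ha : Summable a) (hR : ∀ x, HasSum (fun i => a i * ‖⟪b i, x⟫_ℂ‖ ^ 2) (⟪x, R x⟫_ℂ).re)
    (u : HilbertBasis κ ℂ K) (τ : κ → ℝ) (hτ : Summable τ)
    (hT : ∀ x, HasSum (fun k => τ k * ‖⟪u k, x⟫_ℂ‖ ^ 2) (⟪x, T x⟫_ℂ).re)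
    (hRT : ∀ x, (⟪x, R x⟫_ℂ).re ≤ (⟪x, T x⟫_ℂ).re) (h0 : ∀ i, 0 ≤ a i) {Λ ΛT : ℕ → ℝ}
    (hΛ : Antitone Λ) (hΛT : Antitone ΛT) (h0T : ∀ n, 0 ≤ ΛT n) (hl : Lists a Λ)
    (hlT : Lists (fun k : {k // 0 < τ k} => τ k) ΛT) (n : ℕ) : Λ n ≤ ΛT n := by
  refine le_of_embedding hΛ hΛT h0T (fun s hs => ?_) n
  obtain ⟨E⟩ := nonempty_embedding_of_le hb ha hR u τ hτ hT hRT h0 s hs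
  obtain ⟨e⟩ := hl.fiber (fun x => s < x) fun x hx => hs.trans hx
  obtain ⟨e'⟩ := hlT.fiber (fun x => s < x) fun x hx => hs.trans hx
  let e'' : {k // s < τ k} ≃ {k : {k // 0 < τ k} // s < τ k} :=
    ⟨fun k => ⟨⟨k, hs.trans k.2⟩, k.2⟩, fun k => ⟨k.1, k.2⟩, fun _ => rfl, fun _ => rfl⟩
  exact ⟨e.symm.toEmbedding.trans (E.trans (e''.trans e').toEmbedding)⟩

/-- The Jordan decomposition R - R' = D₊ - D₋ in the eigenbasis, rearranged so that both sides are
one common majorant of R and R'. -/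
theorem ext_of_pos_neg {κ : Type*} (e : HilbertBasis κ ℂ K) {R R' : K →L[ℂ] K} {d : κ → ℝ}
    (hd : ∀ k, (R - R') (e k) = (d k : ℂ) • e k) (hs : Summable d) :
    R + diagOp (fun k => (d k)⁻) e = R' + diagOp (fun k => (d k)⁺) e := by
  have hp : Summable fun k => (d k)⁺ := Summable.of_nonneg_of_le (fun k => posPart_nonneg _)
    (fun k => by rw [← posPart_add_negPart (d k)]; linarith [negPart_nonneg (d k)]) hs.abs
  have hm : Summable fun k => (d k)⁻ := Summable.of_nonneg_of_le (fun k => negPart_nonneg _)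
    (fun k => by rw [← posPart_add_negPart (d k)]; linarith [posPart_nonneg (d k)]) hs.abs
  refine ContinuousLinearMap.ext_on (s := Set.range e)
    ((Submodule.dense_iff_topologicalClosure_eq_top).2 e.dense_span) ?_
  rintro _ ⟨k, rfl⟩
  rw [add_apply, add_apply, diagOp_apply_self e.orthonormal hm,
    diagOp_apply_self e.orthonormal hp, ← sub_eq_zero, add_sub_add_comm, ← sub_apply, hd,
    ← sub_smul, ← add_smul, ← Complex.ofReal_sub, ← Complex.ofReal_add]
  have : d k + ((d k)⁻ - (d k)⁺) = 0 := by
    have := posPart_sub_negPart (d k); linarith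
  rw [this]; simp

/-- Evaluate g on the finite rank contraction ∑ sign(d k)|e k⟩⟨e k|: this is the easy half of the
duality between trace norm and operator norm. -/
theorem sum_abs_eigenvalues_le {κ : Type*} (e : HilbertBasis κ ℂ K) (d : κ → ℝ)
    (g : (K →L[ℂ] K) →ₗ[ℂ] ℂ) (hg : ∀ k, g (rankOne ℂ (e k) (e k)) = d k) {C : ℝ} (hC0 : 0 ≤ C)
    (hC : ∀ X, ‖g X‖ ≤ C * ‖X‖) (s : Finset κ) : ∑ k ∈ s, |d k| ≤ C := by
  let X : K →L[ℂ] K := ∑ k ∈ s, ((SignType.sign (d k) : ℝ) : ℂ) • rankOne ℂ (e k) (e k)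
  have hXn : ‖X‖ ≤ 1 := by
    refine opNorm_le_bound _ zero_le_one fun x => ?_
    rw [one_mul]
    have h1 : X x = ∑ k ∈ s, (((SignType.sign (d k) : ℝ) : ℂ) * ⟪e k, x⟫_ℂ) • e k := by
      simp only [X, sum_apply, mul_smul, smul_apply, rankOne_apply]
    have h2 : ‖X x‖ ^ 2 ≤ ‖x‖ ^ 2 := by
      have h3 : ‖X x‖ ^ 2 = ∑ k ∈ s, ‖((SignType.sign (d k) : ℝ) : ℂ) * ⟪e k, x⟫_ℂ‖ ^ 2 := by
        have h4 := e.orthonormal.inner_sum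
          (fun k => ((SignType.sign (d k) : ℝ) : ℂ) * ⟪e k, x⟫_ℂ)
          (fun k => ((SignType.sign (d k) : ℝ) : ℂ) * ⟪e k, x⟫_ℂ) s
        rw [← h1, inner_self_eq_norm_sq_to_K] at h4
        refine Complex.ofReal_injective ?_
        push_cast
        simp only [RCLike.conj_mul] at h4
        simpa using h4
      rw [h3]
      refine (Finset.sum_le_sum fun k _ => ?_).trans (e.orthonormal.sum_inner_products_le x)
      rw [norm_mul, mul_pow]
      refine mul_le_of_le_one_left (sq_nonneg _) ?_
      rcases lt_trichotomy (d k) 0 with hk | hk | hk <;> simp [hk]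
    exact (sq_le_sq₀ (norm_nonneg _) (norm_nonneg _)).1 h2
  have hgX : g X = ((∑ k ∈ s, |d k| : ℝ) : ℂ) := by
    simp only [X, map_sum, map_smul, hg]
    push_cast
    refine Finset.sum_congr rfl fun k _ => ?_
    rw [smul_eq_mul, ← Complex.ofReal_mul, sign_mul_self]
  have h1 : ‖g X‖ ≤ C := (hC X).trans (mul_le_of_le_one_right hC0 hXn)
  rw [hgX, Complex.norm_real] at h1
  exact (le_abs_self _).trans h1

/-- The eigenvalue lists of two diagonal functionals are at most as far apart as the
functionals. -/
theorem IsDiag.list_contraction {ι' : Type*} {a' : ι' → ℝ} {b' : ι' → K}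
    {f f' : (K →L[ℂ] K) →ₗ[ℂ] ℂ} (h : IsDiag f a b) (h' : IsDiag f' a' b')
    (ha : Summable a) (ha' : Summable a') {Λ Λ' : ℕ → ℝ}
    (hΛ : Antitone Λ) (hΛ' : Antitone Λ') (h0 : ∀ n, 0 ≤ Λ n) (h0' : ∀ n, 0 ≤ Λ' n)
    (hl : Lists a Λ) (hl' : Lists a' Λ') {C : ℝ} (hC0 : 0 ≤ C)
    (hC : ∀ X, ‖f X - f' X‖ ≤ C * ‖X‖) :
    listDist Λ Λ' ≤ C := by
  let R := diagOp a b
  let R' := diagOp a' b'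
  obtain ⟨κ, e, d, hd⟩ := exists_eigenbasis (R - R')
    ((isCompactOperator_diagOp h.orthonormal ha).sub (isCompactOperator_diagOp h'.orthonormal ha'))
    ((isSymmetric_diagOp h.orthonormal ha).sub (isSymmetric_diagOp h'.orthonormal ha'))
  have hdf : ∀ k, (f - f') (rankOne ℂ (e k) (e k)) = d k := by
    intro k
    rw [LinearMap.sub_apply, ← h.inner_diagOp ha, ← h'.inner_diagOp ha', ← inner_sub_right,
      ← sub_apply]
    change ⟪e k, (R - R') (e k)⟫_ℂ = _
    rw [hd, inner_smul_right, inner_self_eq_norm_sq_to_K, e.orthonormal.1]; simp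
  have hfin := sum_abs_eigenvalues_le e d (f - f') hdf hC0 hC
  have hds : Summable d :=
    (summable_of_sum_le (fun k => abs_nonneg (d k)) hfin).of_abs
  have hdabs : ∑' k, |d k| ≤ C := hds.abs.tsum_le_of_sum_le hfin
  have hp : Summable fun k => (d k)⁺ := Summable.of_nonneg_of_le (fun k => posPart_nonneg _)
    (fun k => by rw [← posPart_add_negPart (d k)]; linarith [negPart_nonneg (d k)]) hds.abs
  have hm : Summable fun k => (d k)⁻ := Summable.of_nonneg_of_le (fun k => negPart_nonneg _)
    (fun k => by rw [← posPart_add_negPart (d k)]; linarith [posPart_nonneg (d k)]) hds.abs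
  -- T = R + (R - R')₋ = R' + (R - R')₊ dominates both density operators with total excess exactly
  -- the trace norm of R - R'.
  let T := R + diagOp (fun k => (d k)⁻) e
  have hT' : T = R' + diagOp (fun k => (d k)⁺) e := ext_of_pos_neg e hd hds
  have hRp := isPositive_diagOp h.orthonormal ha fun i => (h.pos i).le
  have hmp := isPositive_diagOp e.orthonormal hm fun i => negPart_nonneg _
  have hpp := isPositive_diagOp e.orthonormal hp fun i => posPart_nonneg _
  have hTp : T.IsPositive := hRp.add hmp
  obtain ⟨κ', u, τ, hu⟩ := exists_eigenbasis T
    ((isCompactOperator_diagOp h.orthonormal ha).add (isCompactOperator_diagOp e.orthonormal hm))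
    hTp.isSymmetric
  have huτ : ∀ k, (⟪u k, T (u k)⟫_ℂ).re = τ k := by
    intro k
    rw [hu, inner_smul_right, inner_self_eq_norm_sq_to_K, u.orthonormal.1]; simp
  have hτ0 : ∀ k, 0 ≤ τ k := fun k => by
    rw [← huτ]; exact hTp.re_inner_nonneg_right (u k)
  -- The trace of T is computed from both representations; each computation measures the gap between
  -- T and one of the two operators.
  have hτ1 : HasSum τ (∑' i, a i + ∑' k, (d k)⁻) := by
    have := (hasSum_trace_diagOp h.orthonormal ha.hasSum (fun i => (h.pos i).le) u).add
      (hasSum_trace_diagOp e.orthonormal hm.hasSum (fun i => negPart_nonneg _) u)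
    simp only [← Complex.add_re, ← inner_add_right, ← add_apply] at this
    convert this using 1
    ext k; exact (huτ k).symm
  have hτ2 : HasSum τ (∑' i, a' i + ∑' k, (d k)⁺) := by
    have := (hasSum_trace_diagOp h'.orthonormal ha'.hasSum (fun i => (h'.pos i).le) u).add
      (hasSum_trace_diagOp e.orthonormal hp.hasSum (fun i => posPart_nonneg _) u)
    simp only [← Complex.add_re, ← inner_add_right, ← add_apply] at this
    convert this using 1
    ext k; rw [← huτ, hT']
  have hTd : T = diagOp τ u := eq_diagOp u hτ1.summable hu
  have hTq : ∀ x, HasSum (fun k => τ k * ‖⟪u k, x⟫_ℂ‖ ^ 2) (⟪x, T x⟫_ℂ).re := by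
    rw [hTd]; exact hasSum_inner_diagOp_self u.orthonormal hτ1.summable
  obtain ⟨ΛT, hΛT, h0T, hlT⟩ := exists_lists (a := fun k : {k // 0 < τ k} => τ k) (fun k => k.2)
    (hτ1.summable.subtype _)
  have hle : ∀ n, Λ n ≤ ΛT n := Lists.le_of_le h.orthonormal ha
    (hasSum_inner_diagOp_self h.orthonormal ha) u τ hτ1.summable hTq
    (fun x => by
      have : (⟪x, T x⟫_ℂ).re = (⟪x, R x⟫_ℂ).re + (⟪x, diagOp (fun k => (d k)⁻) e x⟫_ℂ).re := by
        rw [← Complex.add_re, ← inner_add_right]; rfl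
      rw [this]
      exact le_add_of_nonneg_right (hmp.re_inner_nonneg_right x))
    (fun i => (h.pos i).le) hΛ hΛT h0T hl hlT
  have hle' : ∀ n, Λ' n ≤ ΛT n := Lists.le_of_le h'.orthonormal ha'
    (hasSum_inner_diagOp_self h'.orthonormal ha') u τ hτ1.summable hTq
    (fun x => by
      have : (⟪x, T x⟫_ℂ).re = (⟪x, R' x⟫_ℂ).re + (⟪x, diagOp (fun k => (d k)⁺) e x⟫_ℂ).re := by
        rw [← Complex.add_re, ← inner_add_right, hT']; rfl
      rw [this]
      exact le_add_of_nonneg_right (hpp.re_inner_nonneg_right x))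
    (fun i => (h'.pos i).le) hΛ' hΛT h0T hl' hlT
  have hs1 := hl.hasSum h0 ha.hasSum
  have hs2 := hl'.hasSum h0' ha'.hasSum
  have hsT1 := hlT.hasSum h0T (hasSum_subtype_pos hτ0 hτ1)
  have hsT2 := hlT.hasSum h0T (hasSum_subtype_pos hτ0 hτ2)
  have hbig := (hsT1.sub hs1).add (hsT2.sub hs2)
  -- Both gaps are nonnegative by minimax, and their sums over n are the traces of the negative and
  -- positive parts of R - R'.
  have hpt : ∀ n, |Λ n - Λ' n| ≤ (ΛT n - Λ n) + (ΛT n - Λ' n) := by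
    intro n
    rw [abs_le]
    constructor <;> linarith [hle n, hle' n]
  have hsum : Summable fun n => |Λ n - Λ' n| :=
    Summable.of_nonneg_of_le (fun n => abs_nonneg _) hpt hbig.summable
  have habs : ∑' k, |d k| = ∑' k, (d k)⁺ + ∑' k, (d k)⁻ := by
    rw [← hp.tsum_add hm]
    exact tsum_congr fun k => (posPart_add_negPart (d k)).symm
  calc listDist Λ Λ' ≤ _ := hasSum_le hpt hsum.hasSum hbig
    _ = ∑' k, |d k| := by rw [habs]; ring
    _ ≤ C := hdabs

end Diag

/-! ### Eigenvalue lists of diagonal operators and of product states. -/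

section Eigen

variable {K L : Type u} [NormedAddCommGroup K] [InnerProductSpace ℂ K] [CompleteSpace K]
  [NormedAddCommGroup L] [InnerProductSpace ℂ L] [CompleteSpace L]
  {ι κ : Type*} {a : ι → ℝ} {b : ι → K}

theorem inner_diagOp_left (hb : Orthonormal ℂ b) (ha : Summable a) (i : ι) (x : K) :
    ⟪b i, diagOp a b x⟫_ℂ = a i * ⟪b i, x⟫_ℂ := by
  have h := isSymmetric_diagOp hb ha (b i) x
  change ⟪diagOp a b (b i), x⟫_ℂ = ⟪b i, diagOp a b x⟫_ℂ at h
  rw [← h, diagOp_apply_self hb ha, inner_smul_left]; simp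

/-- The coefficient of an eigenvector along b i vanishes unless a i = μ. Positivity of μ matters:
the orthogonal complement of the b i lies in the kernel, and dividing by μ recovers x from the
finitely many surviving terms. -/
theorem eigenspace_diagOp (hb : Orthonormal ℂ b) (ha : Summable a) {μ : ℝ} (hμ : 0 < μ) :
    Module.End.eigenspace (diagOp a b : K →ₗ[ℂ] K) (μ : ℂ) =
      Submodule.span ℂ (Set.range fun i : {i // a i = μ} => b i) := by
  have hfin := finite_eq_of_summable ha hμ
  have hμC : (μ : ℂ) ≠ 0 := by exact_mod_cast hμ.ne'
  ext x
  rw [Module.End.mem_eigenspace_iff]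
  change diagOp a b x = (μ : ℂ) • x ↔ _
  constructor
  · intro h
    have h0 : ∀ i, a i ≠ μ → ⟪b i, x⟫_ℂ = 0 := by
      intro i hi
      have h1 := inner_diagOp_left hb ha i x
      rw [h, inner_smul_right] at h1
      have h2 : ((a i : ℂ) - μ) * ⟪b i, x⟫_ℂ = 0 := by rw [sub_mul, h1, sub_self]
      refine (mul_eq_zero.1 h2).resolve_left ?_
      rw [sub_eq_zero]; exact_mod_cast hi
    have h2 := hasSum_diagOp_apply hb ha x
    have h3 : HasSum (fun i => ((a i : ℂ) * ⟪b i, x⟫_ℂ) • b i)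
        (∑ i ∈ hfin.toFinset, ((a i : ℂ) * ⟪b i, x⟫_ℂ) • b i) :=
      hasSum_sum_of_ne_finset_zero fun i hi => by
        rw [h0 i (fun h => hi (by simpa using h))]; simp
    have h4 := h2.unique h3
    rw [h] at h4
    have h5 : x = (μ : ℂ)⁻¹ • ∑ i ∈ hfin.toFinset, ((a i : ℂ) * ⟪b i, x⟫_ℂ) • b i := by
      rw [← h4, smul_smul, inv_mul_cancel₀ hμC, one_smul]
    rw [h5]
    refine Submodule.smul_mem _ _ (Submodule.sum_mem _ fun i hi => Submodule.smul_mem _ _ ?_)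
    exact Submodule.subset_span ⟨⟨i, by simpa using hi⟩, rfl⟩
  · intro h
    induction h using Submodule.span_induction with
    | mem x hx =>
      obtain ⟨i, rfl⟩ := hx
      simp only
      rw [diagOp_apply_self hb ha, i.2]
    | zero => simp
    | add x y _ _ hx hy => rw [map_add, hx, hy, smul_add]
    | smul c x _ hx => rw [map_smul, hx, smul_comm]

theorem finrank_eigenspace_diagOp (hb : Orthonormal ℂ b) (ha : Summable a) {μ : ℝ} (hμ : 0 < μ) :
    Module.Finite ℂ (Module.End.eigenspace (diagOp a b : K →ₗ[ℂ] K) (μ : ℂ)) ∧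
    Module.finrank ℂ (Module.End.eigenspace (diagOp a b : K →ₗ[ℂ] K) (μ : ℂ)) =
      Nat.card {i // a i = μ} := by
  rw [eigenspace_diagOp hb ha hμ]
  have hf : Finite {i // a i = μ} := (finite_eq_of_summable ha hμ).to_subtype
  have := Fintype.ofFinite {i // a i = μ}
  refine ⟨FiniteDimensional.span_of_finite ℂ (Set.finite_range _), ?_⟩
  have hli : LinearIndependent ℂ (fun i : {i // a i = μ} => b i) :=
    (hb.comp _ Subtype.val_injective).linearIndependent
  rw [finrank_span_eq_card hli, Nat.card_eq_fintype_card]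

theorem Lists.of_isEigenvalueList (hb : Orthonormal ℂ b) (ha : Summable a) (h0 : ∀ i, 0 < a i)
    {Λ : ℕ → ℝ} (h : IsEigenvalueList (diagOp a b) Λ) : Lists a Λ := by
  refine Lists.of_fibers h0 fun μ hμ => ?_
  have h1 := (h.multiplicity μ hμ).2
  rw [(finrank_eigenspace_diagOp hb ha hμ).2] at h1
  have hf1 : Finite {i // a i = μ} := (finite_eq_of_summable ha hμ).to_subtype
  have hf2 : Finite {n // Λ n = μ} := (finite_eq_of_summable h.summable hμ).to_subtype
  exact Finite.card_eq.1 h1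

theorem Lists.isEigenvalueList (hb : Orthonormal ℂ b) (ha : Summable a)
    {Λ : ℕ → ℝ} (hΛ : Antitone Λ) (hΛ0 : ∀ n, 0 ≤ Λ n) (h : Lists a Λ) :
    IsEigenvalueList (diagOp a b) Λ where
  antitone := hΛ
  nonneg := hΛ0
  summable := (h.hasSum hΛ0 ha.hasSum).summable
  multiplicity μ hμ := by
    refine ⟨(finrank_eigenspace_diagOp hb ha hμ).1, ?_⟩
    rw [(finrank_eigenspace_diagOp hb ha hμ).2]
    obtain ⟨e⟩ := h.fiber (fun x => x = μ) fun x hx => hx ▸ hμ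
    exact Nat.card_congr e

theorem summable_diag (hb : Orthonormal ℂ b) (ha : Summable a) (X : K →L[ℂ] K) :
    Summable fun i => (a i : ℂ) * ⟪b i, X (b i)⟫_ℂ := by
  refine Summable.of_norm_bounded (g := fun i => |a i| * ‖X‖) (ha.abs.mul_right _) fun i => ?_
  rw [norm_mul, Complex.norm_real, Real.norm_eq_abs]
  refine mul_le_mul_of_nonneg_left ?_ (abs_nonneg _)
  refine (norm_inner_le_norm _ _).trans ?_
  have := X.le_opNorm (b i)
  rw [hb.1, mul_one] at this
  rw [hb.1, one_mul]; exact this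

/-- The normal functional `X ↦ ∑ a i ⟪b i, X b i⟫`. -/
def diagFun (hb : Orthonormal ℂ b) (ha : Summable a) : (K →L[ℂ] K) →ₗ[ℂ] ℂ where
  toFun X := ∑' i, (a i : ℂ) * ⟪b i, X (b i)⟫_ℂ
  map_add' X Y := by
    rw [← (summable_diag hb ha X).tsum_add (summable_diag hb ha Y)]
    exact tsum_congr fun i => by rw [add_apply, inner_add_right, mul_add]
  map_smul' c X := by
    rw [RingHom.id_apply, smul_eq_mul, ← tsum_mul_left]
    exact tsum_congr fun i => by rw [smul_apply, inner_smul_right]; ring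

theorem hasSum_diagFun (hb : Orthonormal ℂ b) (ha : Summable a) (X : K →L[ℂ] K) :
    HasSum (fun i => (a i : ℂ) * ⟪b i, X (b i)⟫_ℂ) (diagFun hb ha X) :=
  (summable_diag hb ha X).hasSum

theorem hasTrace_diagOp_mul (hb : Orthonormal ℂ b) (ha : Summable a) (h0 : ∀ i, 0 ≤ a i)
    (X : K →L[ℂ] K) : HasTrace (diagOp a b * X) (diagFun hb ha X) := by
  intro κ e
  let F : ι × κ → ℂ := fun p => (a p.1 : ℂ) * (⟪b p.1, X (e p.2)⟫_ℂ * ⟪e p.2, b p.1⟫_ℂ)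
  have hrow : ∀ i, HasSum (fun k => F (i, k)) ((a i : ℂ) * ⟪b i, X (b i)⟫_ℂ) := by
    intro i
    have := (e.hasSum_inner_mul_inner (adjoint X (b i)) (b i)).mul_left (a i : ℂ)
    simpa only [adjoint_inner_left] using this
  have hrow' : ∀ i, Summable fun k => ‖F (i, k)‖ := fun i => (hrow i).summable.norm
  have hF : Summable F := by
    refine Summable.of_norm ?_
    rw [summable_prod_of_nonneg fun p => norm_nonneg _]
    refine ⟨hrow', ?_⟩
    -- From uv ≤ (u² + v²)/2 and Parseval, row i is absolutely summable with bound a i (‖X*b i‖² +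
    -- ‖b i‖²)/2. This justifies the exchange of sums.
    refine Summable.of_nonneg_of_le (fun i => tsum_nonneg fun k => norm_nonneg _) (fun i => ?_)
      (ha.mul_right ((‖X‖ ^ 2 + 1) / 2))
    have h1 := ((hasSum_norm_sq_inner e (adjoint X (b i))).add
      (hasSum_norm_sq_inner e (b i))).mul_left (a i / 2)
    refine (hasSum_le (fun k => ?_) (hrow' i).hasSum h1).trans ?_
    · simp only [F, norm_mul, Complex.norm_real, Real.norm_eq_abs, abs_of_nonneg (h0 i)]
      rw [← adjoint_inner_left, norm_inner_symm]
      nlinarith [sq_nonneg (‖⟪e k, adjoint X (b i)⟫_ℂ‖ - ‖⟪e k, b i⟫_ℂ‖), h0 i,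
        mul_nonneg (h0 i) (sq_nonneg (‖⟪e k, adjoint X (b i)⟫_ℂ‖ - ‖⟪e k, b i⟫_ℂ‖))]
    · have h2 : ‖adjoint X (b i)‖ ≤ ‖X‖ := by
        have := (adjoint X).le_opNorm (b i)
        rwa [hb.1, mul_one, LinearIsometryEquiv.norm_map] at this
      have h3 : ‖adjoint X (b i)‖ ^ 2 ≤ ‖X‖ ^ 2 := by gcongr
      rw [hb.1]
      nlinarith [h0 i, mul_nonneg (h0 i) (sub_nonneg.2 h3)]
  have hFc : HasSum F (diagFun hb ha X) := by
    have := hF.hasSum.prod_fiberwise hrow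
    rw [(hasSum_diagFun hb ha X).unique this]
    exact hF.hasSum
  have hsw : HasSum (fun p : κ × ι => F (p.2, p.1)) (diagFun hb ha X) :=
    (Equiv.prodComm κ ι).hasSum_iff.2 hFc
  exact hsw.prod_fiberwise fun k => hasSum_inner_diagOp hb ha (X (e k)) (e k)

/-- A trace functional evaluated at a rank one operator. -/
theorem HasTrace.rankOne {T : K →L[ℂ] K} {x y : K} {c : ℂ} (h : HasTrace (T * rankOne ℂ x y) c) :
    c = ⟪y, T x⟫_ℂ := by
  obtain ⟨w, e, -⟩ := _root_.exists_hilbertBasis ℂ K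
  refine (h _ e).unique ?_
  refine hasSum_of_eq (e.hasSum_inner_mul_inner y (T x)) fun i => ?_
  change _ = ⟪e i, T (InnerProductSpace.rankOne ℂ x y (e i))⟫_ℂ
  rw [rankOne_apply, map_smul, inner_smul_right]

theorem tensorOp_rankOne (k k' : K) (l l' : L) :
    tensorOp (rankOne ℂ k k') (rankOne ℂ l l') = rankOne ℂ (tmulL K L k l) (tmulL K L k' l') := by
  refine (isTens_tmulL (K := K) (G := L)).ext fun x y => ?_
  rw [tensorOp_tmulL, rankOne_apply, rankOne_apply, rankOne_apply, isTens_tmulL.inner, map_smul,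
    map_smul, smul_apply, smul_smul, mul_comm]

theorem orthonormal_tmulL {H : Type u} [NormedAddCommGroup H] [InnerProductSpace ℂ H]
    {m : K →L[ℂ] L →L[ℂ] H} (hm : IsTens m) {b' : κ → L} (hb : Orthonormal ℂ b)
    (hb' : Orthonormal ℂ b') : Orthonormal ℂ fun p : ι × κ => m (b p.1) (b' p.2) := by
  classical
  rw [orthonormal_iff_ite]
  intro p q
  rw [hm.inner, orthonormal_iff_ite.1 hb, orthonormal_iff_ite.1 hb']
  by_cases h1 : p.1 = q.1 <;> by_cases h2 : p.2 = q.2 <;> simp [h1, h2, Prod.ext_iff]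

theorem HasSum.prod_mul {f : ι → ℂ} {g : κ → ℂ} {c d : ℂ} (hf : HasSum f c) (hg : HasSum g d) :
    HasSum (fun p : ι × κ => f p.1 * g p.2) (c * d) := by
  have h := summable_mul_of_summable_norm hf.summable.norm hg.summable.norm
  have h2 := tsum_mul_tsum_of_summable_norm hf.summable.norm hg.summable.norm
  rw [hf.tsum_eq, hg.tsum_eq] at h2
  rw [h2]
  exact h.hasSum

theorem HasSum.prod_mul_real {f : ι → ℝ} {g : κ → ℝ} {c d : ℝ} (hf : HasSum f c)
    (hg : HasSum g d) : HasSum (fun p : ι × κ => f p.1 * g p.2) (c * d) := by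
  have := HasSum.prod_mul (Complex.hasSum_ofReal.2 hf) (Complex.hasSum_ofReal.2 hg)
  exact Complex.hasSum_ofReal.1 (by simpa using this)

variable {A B : Type u} [Ring A] [StarRing A] [Algebra ℂ A] [Ring B] [StarRing B] [Algebra ℂ B]
  {φ : A →ₗ[ℂ] ℂ} {ψ : B →ₗ[ℂ] ℂ} {a' : κ → ℝ} {b' : κ → L}

/-- The product state has density operator diagonal in the vectors b i ⊗ b' j with weights a i · a'
j; the list is their decreasing rearrangement. -/
theorem exists_isTensorEigenvalueList (θ : A ≃⋆ₐ[ℂ] (K →L[ℂ] K)) (η : B ≃⋆ₐ[ℂ] (L →L[ℂ] L))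
    (h : IsDiag (fun X => φ (θ.symm X)) a b) (h' : IsDiag (fun X => ψ (η.symm X)) a' b')
    (ha : HasSum a 1) (ha' : HasSum a' 1) :
    ∃ Λ : ℕ → ℝ, IsTensorEigenvalueList φ ψ Λ := by
  have hs : HasSum (fun p : ι × κ => a p.1 * a' p.2) 1 := by
    simpa using HasSum.prod_mul_real ha ha'
  have hpos : ∀ p : ι × κ, 0 < a p.1 * a' p.2 := fun p => mul_pos (h.pos _) (h'.pos _)
  have ho := orthonormal_tmulL (isTens_tmulL (K := K) (G := L)) h.orthonormal h'.orthonormal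
  obtain ⟨Λ, hΛ, hΛ0, hl⟩ := exists_lists hpos hs.summable
  have h1 : diagFun ho hs.summable 1 = 1 := by
    refine (hasSum_diagFun ho hs.summable 1).unique ?_
    refine hasSum_of_eq (by simpa using Complex.hasSum_ofReal.2 hs) fun p => ?_
    change _ = _ * ⟪tmulL K L (b p.1) (b' p.2), tmulL K L (b p.1) (b' p.2)⟫_ℂ
    rw [inner_self_eq_norm_sq_to_K, ho.1 p]; simp
  refine ⟨Λ, K, inferInstance, inferInstance, inferInstance, L, inferInstance, inferInstance,
    inferInstance, θ, η, diagFun ho hs.summable,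
    diagOp (fun p : ι × κ => a p.1 * a' p.2) (fun p => tmulL K L (b p.1) (b' p.2)), ?_,
    ⟨isPositive_diagOp ho hs.summable fun p => (hpos p).le, ?_,
      hasTrace_diagOp_mul ho hs.summable fun p => (hpos p).le⟩,
    hl.isEigenvalueList ho hs.summable hΛ hΛ0⟩
  · intro x y
    refine (hasSum_diagFun ho hs.summable _).unique ?_
    have h2 := HasSum.prod_mul (h.hasSum (θ x)) (h'.hasSum (η y))
    simp only [StarAlgEquiv.symm_apply_apply] at h2
    refine hasSum_of_eq h2 fun p => ?_
    rw [tensorOp_tmulL, isTens_tmulL.inner]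
    push_cast
    ring
  · have := hasTrace_diagOp_mul ho hs.summable (fun p => (hpos p).le) 1
    rwa [mul_one, h1] at this

/-- The product formula fixes χ on rank one operators between elementary tensors. These values are
matrix elements of T, so T must be the diagonal operator with the product weights. -/
theorem lists_of_density (θ : A ≃⋆ₐ[ℂ] (K →L[ℂ] K)) (η : B ≃⋆ₐ[ℂ] (L →L[ℂ] L))
    (h : IsDiag (fun X => φ (θ.symm X)) a b) (h' : IsDiag (fun X => ψ (η.symm X)) a' b')
    (ha : HasSum a 1) (ha' : HasSum a' 1)
    {χ : (HilbertTensor K L →L[ℂ] HilbertTensor K L) →ₗ[ℂ] ℂ}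
    {T : HilbertTensor K L →L[ℂ] HilbertTensor K L} {Λ : ℕ → ℝ}
    (hχ : ∀ (x : A) (y : B), χ (tensorOp (θ x) (η y)) = φ x * ψ y)
    (hT : IsDensityOperator χ T) (hΛ : IsEigenvalueList T Λ) :
    Lists (fun p : ι × κ => a p.1 * a' p.2) Λ := by
  have hs : HasSum (fun p : ι × κ => a p.1 * a' p.2) 1 := by
    simpa using HasSum.prod_mul_real ha ha'
  have hpos : ∀ p : ι × κ, 0 < a p.1 * a' p.2 := fun p => mul_pos (h.pos _) (h'.pos _)
  have ho := orthonormal_tmulL (isTens_tmulL (K := K) (G := L)) h.orthonormal h'.orthonormal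
  have hTeq : T = diagOp (fun p : ι × κ => a p.1 * a' p.2)
      (fun p => tmulL K L (b p.1) (b' p.2)) := by
    refine (isTens_tmulL (K := K) (G := L)).ext fun k l => ?_
    rw [← sub_eq_zero]
    refine (isTens_tmulL (K := K) (G := L)).total _ fun k' l' => ?_
    rw [inner_sub_right, sub_eq_zero, ← (hT.eq_trace _).rankOne, ← tensorOp_rankOne,
      ← θ.apply_symm_apply (rankOne ℂ k k'), ← η.apply_symm_apply (rankOne ℂ l l'), hχ]
    refine HasSum.unique ?_ (hasSum_inner_diagOp ho hs.summable _ _)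
    refine hasSum_of_eq (HasSum.prod_mul (h.hasSum (rankOne ℂ k k'))
      (h'.hasSum (rankOne ℂ l l'))) fun p => ?_
    rw [isTens_tmulL.inner, isTens_tmulL.inner, rankOne_apply, rankOne_apply, inner_smul_right,
      inner_smul_right]
    push_cast
    ring
  rw [hTeq] at hΛ
  exact Lists.of_isEigenvalueList ho hs.summable hpos hΛ

end Eigen

/-! ### Type I factors as first tensor factors, and their normal states. -/

section TypeI

variable {K G H : Type u} [NormedAddCommGroup K] [InnerProductSpace ℂ K] [CompleteSpace K]
  [NormedAddCommGroup G] [InnerProductSpace ℂ G] [CompleteSpace G]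
  [NormedAddCommGroup H] [InnerProductSpace ℂ H] [CompleteSpace H]

/-- A von Neumann algebra isomorphic to `B(K)` acts nondegenerately. -/
theorem nondegenerate_of_equiv [Nontrivial K] (M : VonNeumannAlgebra H)
    (θ : M.toStarSubalgebra ≃⋆ₐ[ℂ] (K →L[ℂ] K)) (h : H)
    (hh : ∀ k k', (θ.symm (rankOne ℂ k k') : H →L[ℂ] H) h = 0) : h = 0 := by
  let π : (K →L[ℂ] K) → (H →L[ℂ] H) := fun X => (θ.symm X : H →L[ℂ] H)
  have hπmul : ∀ X Y, π (X * Y) = π X * π Y := fun X Y => by simp [π]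
  have hπstar : ∀ X, π (star X) = star (π X) := fun X => by
    change ((θ.symm (star X) : M.toStarSubalgebra) : H →L[ℂ] H) = _
    rw [map_star]
    rfl
  -- W, the closure of V, is the essential subspace of the finite rank operators. The commutant
  -- leaves it invariant, so its projection lies in M; the preimage E in B(K) fixes every rank one
  -- operator, whence E = 1 and W is all of H. No continuity of θ is needed.
  let V : Submodule ℂ H := Submodule.span ℂ {x | ∃ k k' y, π (rankOne ℂ k k') y = x}
  let W := V.topologicalClosure
  have hWc : IsClosed (W : Set H) := V.isClosed_topologicalClosure
  have : CompleteSpace W := hWc.completeSpace_coe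
  let p := W.starProjection
  have hp : p ∈ M := by
    rw [VonNeumannAlgebra.IsStarProjection.mem_iff isStarProjection_starProjection]
    intro y hy
    rw [VonNeumannAlgebra.mem_commutant_iff] at hy
    rw [Module.End.mem_invtSubmodule]
    have hrange : p.range = W := Submodule.range_starProjection W
    rw [hrange]
    have hV : V ≤ V.comap (y : H →ₗ[ℂ] H) := by
      refine Submodule.span_le.2 ?_
      rintro _ ⟨k, k', x, rfl⟩
      refine Submodule.subset_span ⟨k, k', y x, ?_⟩
      exact congr($(hy _ (θ.symm (rankOne ℂ k k')).2) x)
    have hcl : IsClosed ((W.comap (y : H →ₗ[ℂ] H) : Submodule ℂ H) : Set H) :=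
      hWc.preimage y.continuous
    exact Submodule.topologicalClosure_minimal _
      (hV.trans (Submodule.comap_mono V.le_topologicalClosure)) hcl
  obtain ⟨E, hE⟩ : ∃ E, π E = p := ⟨θ ⟨p, hp⟩, by simp [π]⟩
  have hinj : Function.Injective π := fun X Y hXY => θ.symm.injective (Subtype.ext hXY)
  have hEr : ∀ k k', E * rankOne ℂ k k' = rankOne ℂ k k' := by
    intro k k'
    apply hinj
    rw [hπmul, hE]
    ext x
    exact Submodule.starProjection_eq_self_iff.2
      (V.le_topologicalClosure (Submodule.subset_span ⟨k, k', x, rfl⟩))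
  have hE1 : E = 1 := by
    obtain ⟨k₀, hk₀⟩ := exists_ne (0 : K)
    ext k
    have := congr($(hEr k k₀) k₀)
    change E (rankOne ℂ k k₀ k₀) = rankOne ℂ k k₀ k₀ at this
    rw [rankOne_apply, map_smul] at this
    exact smul_right_injective _ (inner_self_ne_zero.2 hk₀) this
  have hp1 : p = 1 := by
    rw [← hE, hE1]; simp [π]
  have hhW : h ∈ W := by
    rw [← Submodule.starProjection_eq_self_iff]
    change p h = h
    rw [hp1]; rfl
  have hperp : ∀ x ∈ V, ⟪x, h⟫_ℂ = 0 := by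
    intro x hx
    induction hx using Submodule.span_induction with
    | mem x hx =>
      obtain ⟨k, k', y, rfl⟩ := hx
      rw [← adjoint_inner_right, ← star_eq_adjoint, ← hπstar, star_eq_adjoint, adjoint_rankOne]
      change ⟪y, (θ.symm (rankOne ℂ k' k) : H →L[ℂ] H) h⟫_ℂ = 0
      rw [hh, inner_zero_right]
    | zero => simp
    | add x y _ _ hx hy => rw [inner_add_left, hx, hy, add_zero]
    | smul c x _ hx => rw [inner_smul_left, hx, mul_zero]
  have hperp' : h ∈ Wᗮ := by
    rw [Submodule.orthogonal_closure, Submodule.mem_orthogonal]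
    exact hperp
  exact inner_self_eq_zero.1 ((Submodule.mem_orthogonal _ _).1 hperp' h hhW)

/-- A type I factor is the first factor of a tensor decomposition. -/
theorem exists_isTens_of_equiv [Nontrivial H] [Nontrivial K] (M : VonNeumannAlgebra H)
    (θ : M.toStarSubalgebra ≃⋆ₐ[ℂ] (K →L[ℂ] K)) :
    ∃ (G : Type u) (_ : NormedAddCommGroup G) (_ : InnerProductSpace ℂ G) (_ : CompleteSpace G)
      (m : K →L[ℂ] G →L[ℂ] H) (hm : IsTens m), Nontrivial G ∧
        ∀ A, (θ.symm A : H →L[ℂ] H) = hm.amp A := by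
  let π : (K →L[ℂ] K) →⋆ₐ[ℂ] (H →L[ℂ] H) :=
    (StarSubalgebra.subtype M.toStarSubalgebra).comp θ.symm.toStarAlgHom
  obtain ⟨G, i1, i2, i3, m, hm, hπ⟩ := exists_isTens π
    (fun h hh => nondegenerate_of_equiv M θ h hh)
  refine ⟨G, i1, i2, i3, m, hm, ?_, fun A => hm.amp_unique (hπ A)⟩
  by_contra hG
  rw [not_nontrivial_iff_subsingleton] at hG
  obtain ⟨h, hh⟩ := exists_ne (0 : H)
  exact hh (hm.total h fun k g => by rw [Subsingleton.elim g 0, map_zero, inner_zero_left])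

variable {m : K →L[ℂ] G →L[ℂ] H}

theorem IsTens.nontrivial_right (hm : IsTens m) [Nontrivial H] : Nontrivial G := by
  by_contra hG
  rw [not_nontrivial_iff_subsingleton] at hG
  obtain ⟨h, hh⟩ := exists_ne (0 : H)
  exact hh (hm.total h fun k g => by rw [Subsingleton.elim g 0, map_zero, inner_zero_left])

theorem mem_iff_of_equiv {M : VonNeumannAlgebra H} (hm : IsTens m)
    {θ : M.toStarSubalgebra ≃⋆ₐ[ℂ] (K →L[ℂ] K)}
    (hθ : ∀ A, (θ.symm A : H →L[ℂ] H) = hm.amp A) (X : H →L[ℂ] H) :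
    X ∈ M.toStarSubalgebra ↔ ∃ A, X = hm.amp A := by
  constructor
  · intro hX
    exact ⟨θ ⟨X, hX⟩, by rw [← hθ, StarAlgEquiv.symm_apply_apply]⟩
  · rintro ⟨A, rfl⟩
    rw [← hθ]
    exact (θ.symm A).2

/-- The isomorphism of `B(K)` with a star subalgebra that consists of the operators `A ⊗ 1`. -/
theorem IsTens.exists_equiv_of_mem_iff [Nontrivial G] (hm : IsTens m)
    (S : StarSubalgebra ℂ (H →L[ℂ] H)) (hS : ∀ X, X ∈ S ↔ ∃ A, X = hm.amp A) :
    ∃ θ : S ≃⋆ₐ[ℂ] (K →L[ℂ] K), ∀ A, (θ.symm A : H →L[ℂ] H) = hm.amp A := by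
  let f : (K →L[ℂ] K) →⋆ₐ[ℂ] S := StarAlgHom.codRestrict hm.amp S fun A => (hS _).2 ⟨A, rfl⟩
  have hf : Function.Bijective f := by
    constructor
    · intro A B hAB
      exact hm.amp_injective (congrArg Subtype.val hAB)
    · rintro ⟨X, hX⟩
      obtain ⟨A, rfl⟩ := (hS X).1 hX
      exact ⟨A, rfl⟩
  exact ⟨(StarAlgEquiv.ofBijective f hf).symm, fun A => rfl⟩

theorem IsTens.mem_commutant_iff [Nontrivial K] {M : VonNeumannAlgebra H} (hm : IsTens m)
    (hM : ∀ X, X ∈ M.toStarSubalgebra ↔ ∃ A, X = hm.amp A) (X : H →L[ℂ] H) :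
    X ∈ M.commutant.toStarSubalgebra ↔ ∃ B, X = hm.flip.amp B := by
  change X ∈ M.commutant ↔ _
  rw [VonNeumannAlgebra.mem_commutant_iff]
  constructor
  · intro h
    exact hm.exists_of_commute X fun A => h _ ((hM _).2 ⟨A, rfl⟩)
  · rintro ⟨B, rfl⟩ Y hY
    obtain ⟨A, rfl⟩ := (hM Y).1 hY
    exact hm.amp_commute A B

theorem IsTens.inner_amp (hm : IsTens m) (A : K →L[ℂ] K) (k : K) (g : G) :
    ⟪m k g, hm.amp A (m k g)⟫_ℂ = ⟪k, A k⟫_ℂ * ((‖g‖ ^ 2 : ℝ) : ℂ) := by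
  rw [hm.amp_apply, hm.inner, inner_self_eq_norm_sq_to_K]; simp

/-- Normal states of a type I factor are given by density operators. -/
theorem IsNormalState.exists_isDiag [Nontrivial G] (hm : IsTens m)
    {S : StarSubalgebra ℂ (H →L[ℂ] H)} {φ : S →ₗ[ℂ] ℂ} (hφ : IsNormalState S φ)
    (θ : S ≃⋆ₐ[ℂ] (K →L[ℂ] K)) (hθ : ∀ A, (θ.symm A : H →L[ℂ] H) = hm.amp A) :
    ∃ (ι : Type u) (a : ι → ℝ) (b : ι → K), IsDiag (fun X => φ (θ.symm X)) a b ∧ HasSum a 1 := by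
  classical
  have hst : IsState (φ ∘ₗ (θ.symm.toStarAlgHom.toAlgHom.toLinearMap : (K →L[ℂ] K) →ₗ[ℂ] S)) :=
    hφ.toIsState.comp θ.symm.toStarAlgHom
  have hval : ∀ X, (φ ∘ₗ (θ.symm.toStarAlgHom.toAlgHom.toLinearMap : (K →L[ℂ] K) →ₗ[ℂ] S)) X =
    φ (θ.symm X) := fun X => rfl
  have key : ∃ (ι : Type u) (a : ι → ℝ) (b : ι → K), IsDiag (fun X => φ (θ.symm X)) a b := by
    refine NCDynamics.exists_isDiag hst fun ι e => ?_
    have hR : ∀ k : K, ∃ c : K →L[ℂ] K, rankOne ℂ k k = star c * c := fun k =>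
      CStarAlgebra.nonneg_iff_eq_star_mul_self.1
        ((nonneg_iff_isPositive _).2 (isPositive_rankOne_self (𝕜 := ℂ) k))
    have hnn : ∀ k : K, 0 ≤ φ (θ.symm (rankOne ℂ k k)) := fun k => by
      obtain ⟨c, hc⟩ := hR k
      rw [hc, ← hval]; exact hst.nonneg c
    let P : Finset ι → (K →L[ℂ] K) := fun s => ∑ i ∈ s, rankOne ℂ (e i) (e i)
    have hle : ∀ X Y : K →L[ℂ] K, (∃ c, Y - X = star c * c) → θ.symm X ≤ θ.symm Y := by
      rintro X Y ⟨c, hc⟩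
      have h1 : θ.symm Y - θ.symm X = star (θ.symm c) * θ.symm c := by
        rw [← map_sub, hc, map_mul, map_star]
      change (θ.symm X : H →L[ℂ] H) ≤ (θ.symm Y : H →L[ℂ] H)
      rw [← sub_nonneg]
      have h2 : (θ.symm Y : H →L[ℂ] H) - (θ.symm X : H →L[ℂ] H) =
          star (θ.symm c : H →L[ℂ] H) * (θ.symm c : H →L[ℂ] H) := congrArg Subtype.val h1
      rw [h2]
      exact star_mul_self_nonneg _
    have hPmono : ∀ s t : Finset ι, s ⊆ t → ∃ c, P t - P s = star c * c := by
      intro s t hst'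
      refine CStarAlgebra.nonneg_iff_eq_star_mul_self.1 ?_
      rw [sub_nonneg]
      exact Finset.sum_le_sum_of_subset_of_nonneg hst' fun i _ _ =>
        (nonneg_iff_isPositive _).2 (isPositive_rankOne_self (𝕜 := ℂ) _)
    let D : Set S := Set.range fun s => θ.symm (P s)
    have hPx : ∀ s x, (⟪x, P s x⟫_ℂ).re = ∑ i ∈ s, ‖⟪e i, x⟫_ℂ‖ ^ 2 := by
      intro s x
      simp only [P, sum_apply, rankOne_apply, inner_sum, inner_smul_right, Complex.re_sum]
      refine Finset.sum_congr rfl fun i _ => ?_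
      rw [inner_mul_inner_swap, Complex.ofReal_re]
    -- Normality is applied to the net of finite partial projections of the basis, whose supremum is
    -- 1. An upper bound Y in S is tested on vectors m x g with ‖g‖ = 1, where Y ⊗ 1 has the form of
    -- Y.
    have hlub : IsLUB D 1 := by
      constructor
      · rintro _ ⟨s, rfl⟩
        rw [← map_one θ.symm]
        refine hle _ _ (CStarAlgebra.nonneg_iff_eq_star_mul_self.1 ?_)
        rw [sub_nonneg, ContinuousLinearMap.le_def, isPositive_def]
        have hPs : (P s).IsPositive :=
          isPositive_sum _ fun i _ => isPositive_rankOne_self (𝕜 := ℂ) _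
        refine ⟨(isPositive_one (𝕜 := ℂ)).isSymmetric.sub hPs.isSymmetric, fun x => ?_⟩
        rw [reApplyInnerSelf_apply, inner_re_symm, sub_apply, inner_sub_right, map_sub, sub_nonneg]
        change (⟪x, P s x⟫_ℂ).re ≤ RCLike.re ⟪x, x⟫_ℂ
        rw [hPx, inner_self_eq_norm_sq]
        exact e.orthonormal.sum_inner_products_le x
      · intro y hy
        obtain ⟨Y, rfl⟩ := θ.symm.surjective y
        obtain ⟨g, hg⟩ := exists_norm_eq G (zero_le_one : (0 : ℝ) ≤ 1)
        have hYP : ∀ s x, (⟪x, P s x⟫_ℂ).re ≤ (⟪x, Y x⟫_ℂ).re ∧ (⟪x, Y x⟫_ℂ).im = 0 := by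
          intro s x
          have h1 : (θ.symm (P s) : H →L[ℂ] H) ≤ (θ.symm Y : H →L[ℂ] H) := hy ⟨s, rfl⟩
          rw [hθ, hθ, ContinuousLinearMap.le_def] at h1
          have h2 := h1.inner_nonneg_right (m x g)
          rw [sub_apply, inner_sub_right, hm.inner_amp, hm.inner_amp, hg, one_pow,
            Complex.ofReal_one, mul_one, mul_one] at h2
          have h3 := Complex.nonneg_iff.1 h2
          have h4 : (⟪x, P s x⟫_ℂ).im = 0 := by
            have h5 : (P s).IsPositive :=
              isPositive_sum _ fun i _ => isPositive_rankOne_self (𝕜 := ℂ) _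
            exact (Complex.nonneg_iff.1 (h5.inner_nonneg_right x)).2.symm
          rw [Complex.sub_re, Complex.sub_im, h4] at h3
          constructor <;> linarith [h3.1, h3.2]
        have hY1 : ∀ x, ‖x‖ ^ 2 ≤ (⟪x, Y x⟫_ℂ).re := fun x =>
          hasSum_le_of_sum_le (hasSum_norm_sq_inner e x) fun s => by
            rw [← hPx]; exact (hYP s x).1
        rw [← map_one θ.symm]
        refine hle _ _ (CStarAlgebra.nonneg_iff_eq_star_mul_self.1 ?_)
        rw [nonneg_iff_isPositive, isPositive_iff_complex]
        intro x
        have h1 : ⟪(Y - 1) x, x⟫_ℂ = (((⟪x, Y x⟫_ℂ).re - ‖x‖ ^ 2 : ℝ) : ℂ) := by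
          have h2 : ⟪x, Y x⟫_ℂ = (((⟪x, Y x⟫_ℂ).re : ℝ) : ℂ) := Complex.ext rfl (hYP ∅ x).2
          have h3 : ⟪x, x⟫_ℂ = ((‖x‖ : ℝ) : ℂ) ^ 2 := inner_self_eq_norm_sq_to_K x
          rw [← inner_conj_symm, sub_apply, inner_sub_right]
          change (starRingEnd ℂ) (⟪x, Y x⟫_ℂ - ⟪x, x⟫_ℂ) = _
          rw [h2, h3, ← Complex.ofReal_pow, ← Complex.ofReal_sub, Complex.conj_ofReal,
            Complex.ofReal_re]
        rw [h1]
        refine ⟨by rw [RCLike.re_eq_complex_re, Complex.ofReal_re], ?_⟩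
        rw [RCLike.re_eq_complex_re, Complex.ofReal_re]
        exact sub_nonneg.2 (hY1 x)
    have hdir : DirectedOn (· ≤ ·) D := by
      rintro _ ⟨s, rfl⟩ _ ⟨t, rfl⟩
      exact ⟨_, ⟨s ∪ t, rfl⟩, hle _ _ (hPmono _ _ Finset.subset_union_left),
        hle _ _ (hPmono _ _ Finset.subset_union_right)⟩
    have hD0 : ∀ x ∈ D, 0 ≤ x := by
      rintro _ ⟨s, rfl⟩
      rw [← map_zero θ.symm]
      have := hPmono ∅ s (Finset.empty_subset s)
      exact hle _ _ (by simpa [P] using this)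
    have hsup := hφ.normal D 1 ⟨_, ⟨∅, rfl⟩⟩ hdir hD0 hlub
    rw [hφ.map_one, Complex.one_re] at hsup
    have hre : ∀ i, φ (θ.symm (rankOne ℂ (e i) (e i))) =
        (((φ (θ.symm (rankOne ℂ (e i) (e i)))).re : ℝ) : ℂ) := fun i =>
      Complex.ext rfl (Complex.nonneg_iff.1 (hnn (e i))).2.symm
    have hsum : HasSum (fun i => (φ (θ.symm (rankOne ℂ (e i) (e i)))).re) 1 := by
      refine hasSum_of_isLUB_of_nonneg _ (fun i => (Complex.nonneg_iff.1 (hnn (e i))).1) ?_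
      have hran : (Set.range fun s : Finset ι =>
          ∑ i ∈ s, (φ (θ.symm (rankOne ℂ (e i) (e i)))).re) = (fun x => (φ x).re) '' D := by
        rw [← Set.range_comp]
        congr 1
        funext s
        simp only [P, Function.comp_apply, map_sum, Complex.re_sum]
      rw [hran]
      exact hsup
    have := Complex.hasSum_ofReal.2 hsum
    rw [Complex.ofReal_one] at this
    exact hasSum_of_eq this fun i => (hre i).symm
  obtain ⟨ι, a, b, h⟩ := key
  exact ⟨ι, a, b, h, h.hasSum_weights (by simpa using hst.map_one)⟩

end TypeI

/-! ### Independence of the identification with B(K). -/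

section Compare

variable {K K' H : Type u} [NormedAddCommGroup K] [InnerProductSpace ℂ K] [CompleteSpace K]
  [NormedAddCommGroup K'] [InnerProductSpace ℂ K'] [CompleteSpace K']
  {B : Type u} [Ring B] [StarRing B] [Algebra ℂ B]

/-- Faithful representations of `B(K)` and `B(K')` with the same range differ by a unitary. -/
theorem exists_unitary_of_range_eq (π : (K →L[ℂ] K) →⋆ₐ[ℂ] B) (π' : (K' →L[ℂ] K') →⋆ₐ[ℂ] B)
    (hπ : Function.Injective π) (hπ' : Function.Injective π')
    (hr : ∀ X, (∃ A, π A = X) ↔ ∃ A, π' A = X) :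
    ∃ V : K ≃ₗᵢ[ℂ] K', ∀ A, π' (V.conjStarAlgEquiv A) = π A := by
  choose α hα using fun A => (hr (π A)).1 ⟨A, rfl⟩
  let f : (K →L[ℂ] K) →⋆ₐ[ℂ] (K' →L[ℂ] K') :=
    { toFun := α
      map_one' := hπ' (by rw [hα, map_one, map_one])
      map_mul' := fun X Y => hπ' (by rw [hα, map_mul, map_mul, hα, hα])
      map_zero' := hπ' (by rw [hα, map_zero, map_zero])
      map_add' := fun X Y => hπ' (by rw [hα, map_add, map_add, hα, hα])
      commutes' := fun c => hπ' (by rw [hα, AlgHomClass.commutes, AlgHomClass.commutes])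
      map_star' := fun X => hπ' (by rw [hα, map_star, map_star, hα]) }
  have hf : ∀ A, π' (f A) = π A := hα
  have hfb : Function.Bijective f := by
    constructor
    · intro X Y h
      apply hπ
      rw [← hf, ← hf, h]
    · intro Y
      obtain ⟨A, hA⟩ := (hr (π' Y)).2 ⟨Y, rfl⟩
      exact ⟨A, hπ' (by rw [hf, hA])⟩
  -- Every *-isomorphism between B(K) and B(K') is implemented by a unitary.
  obtain ⟨V, hV⟩ := StarAlgEquiv.eq_linearIsometryEquivConjStarAlgEquiv
    (StarAlgEquiv.ofBijective f hfb) (map_continuous f)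
  refine ⟨V, fun A => ?_⟩
  rw [← hV]
  exact hf A

theorem IsDiag.conj {f : (K' →L[ℂ] K') → ℂ} {ι : Type*} {a : ι → ℝ} {b : ι → K'}
    (h : IsDiag f a b) (V : K ≃ₗᵢ[ℂ] K') :
    IsDiag (fun A => f (V.conjStarAlgEquiv A)) a (fun i => V.symm (b i)) where
  orthonormal := h.orthonormal.comp_linearIsometryEquiv V.symm
  pos := h.pos
  hasSum X := by
    refine hasSum_of_eq (h.hasSum (V.conjStarAlgEquiv X)) fun i => ?_
    rw [LinearIsometryEquiv.conjStarAlgEquiv_apply_apply, ← V.symm.inner_map_map,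
      LinearIsometryEquiv.symm_apply_apply]

/-- Form of the contraction needed for A_[0,t], which the past and the future present as a type I
factor on different Hilbert spaces. -/
theorem list_contraction_of_range_eq (π : (K →L[ℂ] K) →⋆ₐ[ℂ] B) (π' : (K' →L[ℂ] K') →⋆ₐ[ℂ] B)
    (hπ : Function.Injective π) (hπ' : Function.Injective π')
    (hr : ∀ X, (∃ A, π A = X) ↔ ∃ A, π' A = X) {f f' : B →ₗ[ℂ] ℂ}
    {ι ι' : Type*} {a : ι → ℝ} {b : ι → K} {a' : ι' → ℝ} {b' : ι' → K'}
    (h : IsDiag (fun A => f (π A)) a b) (h' : IsDiag (fun A => f' (π' A)) a' b')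
    (ha : Summable a) (ha' : Summable a') {Λ Λ' : ℕ → ℝ}
    (hΛ : Antitone Λ) (hΛ' : Antitone Λ') (h0 : ∀ n, 0 ≤ Λ n) (h0' : ∀ n, 0 ≤ Λ' n)
    (hl : Lists a Λ) (hl' : Lists a' Λ') {C : ℝ} (hC0 : 0 ≤ C)
    (hC : ∀ X, ‖f (π X) - f' (π X)‖ ≤ C * ‖X‖) : listDist Λ Λ' ≤ C := by
  obtain ⟨V, hV⟩ := exists_unitary_of_range_eq π π' hπ hπ' hr
  have h2 := h'.conj V
  simp only [hV] at h2
  exact IsDiag.list_contraction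
    (f := f ∘ₗ (π.toAlgHom.toLinearMap : (K →L[ℂ] K) →ₗ[ℂ] B))
    (f' := f' ∘ₗ (π.toAlgHom.toLinearMap : (K →L[ℂ] K) →ₗ[ℂ] B))
    h h2 ha ha' hΛ hΛ' h0 h0' hl hl' hC0 hC

end Compare

/-! ### Splitting a subfactor off a type I factor. -/

section Split

variable {K L K' L' H : Type u} [NormedAddCommGroup K] [InnerProductSpace ℂ K] [CompleteSpace K]
  [NormedAddCommGroup L] [InnerProductSpace ℂ L] [CompleteSpace L]
  [NormedAddCommGroup K'] [InnerProductSpace ℂ K'] [CompleteSpace K']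
  [NormedAddCommGroup L'] [InnerProductSpace ℂ L'] [CompleteSpace L']
  [NormedAddCommGroup H] [InnerProductSpace ℂ H] [CompleteSpace H]
  {m : K →L[ℂ] L →L[ℂ] H} {m' : K' →L[ℂ] L' →L[ℂ] H}

/-- The tensor decomposition transported by a unitary operator. -/
theorem IsTens.conj (hm : IsTens m) (V : unitary (H →L[ℂ] H)) :
    IsTens (compL ℂ L H H (V : H →L[ℂ] H) ∘L m) where
  inner k g k' g' := by
    change ⟪(V : H →L[ℂ] H) (m k g), (V : H →L[ℂ] H) (m k' g')⟫_ℂ = _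
    rw [← adjoint_inner_right, ← hm.inner]
    congr 1
    exact congr($(Unitary.star_mul_self_of_mem V.2) _)
  total h hh := by
    have h1 : adjoint (V : H →L[ℂ] H) h = 0 := hm.total _ fun k g => by
      rw [adjoint_inner_right]; exact hh k g
    have h2 : (V : H →L[ℂ] H) (adjoint (V : H →L[ℂ] H) h) = h :=
      congr($(Unitary.mul_star_self_of_mem V.2) h)
    rw [← h2, h1, map_zero]

theorem IsTens.amp_conj (hm : IsTens m) (V : unitary (H →L[ℂ] H)) (A : K →L[ℂ] K) :
    (hm.conj V).amp A = Unitary.conjStarAlgAut ℂ (H →L[ℂ] H) V (hm.amp A) := by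
  symm
  refine (hm.conj V).amp_unique fun k g => ?_
  rw [Unitary.conjStarAlgAut_apply]
  change (V : H →L[ℂ] H) (hm.amp A ((star (V : H →L[ℂ] H) * (V : H →L[ℂ] H)) (m k g))) =
    (V : H →L[ℂ] H) (m (A k) g)
  rw [Unitary.star_mul_self_of_mem V.2]
  change (V : H →L[ℂ] H) (hm.amp A (m k g)) = _
  rw [hm.amp_apply]

/-- If `B(K') ⊗ 1 ⊆ B(K) ⊗ 1`, then `K` splits off a factor `K'`. -/
theorem IsTens.exists_split [Nontrivial H] [Nontrivial K] [Nontrivial L] [Nontrivial K']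
    (hm : IsTens m) (hm' : IsTens m')
    (hsub : ∀ A, ∃ A', hm'.amp A = hm.amp A') :
    ∃ (G : Type u) (_ : NormedAddCommGroup G) (_ : InnerProductSpace ℂ G) (_ : CompleteSpace G)
      (w : HilbertTensor K' L →L[ℂ] G →L[ℂ] H) (hw : IsTens w),
      ∀ A B, hw.amp (tensorOp A B) = hm'.amp A * hm.flip.amp B := by
  have hex : ∀ B : L →L[ℂ] L, ∃ Z : L' →L[ℂ] L', hm.flip.amp B = hm'.flip.amp Z := by
    intro B
    refine hm'.exists_of_commute _ fun A => ?_
    obtain ⟨A', hA'⟩ := hsub A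
    rw [hA']
    exact hm.amp_commute A' B
  choose α hα using hex
  have hinj := hm'.flip.amp_injective
  let η : (L →L[ℂ] L) →⋆ₐ[ℂ] (L' →L[ℂ] L') :=
    { toFun := α
      map_one' := hinj (by rw [← hα, map_one, map_one])
      map_mul' := fun X Y => hinj (by rw [← hα, map_mul, map_mul, hα, hα])
      map_zero' := hinj (by rw [← hα, map_zero, map_zero])
      map_add' := fun X Y => hinj (by rw [← hα, map_add, map_add, hα, hα])
      commutes' := fun c => hinj (by rw [← hα, AlgHomClass.commutes, AlgHomClass.commutes])
      map_star' := fun X => hinj (by rw [← hα, map_star, map_star, hα]) }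
  have hη : ∀ B, hm.flip.amp B = hm'.flip.amp (η B) := hα
  obtain ⟨k₁, hk₁⟩ := exists_norm_eq K' (zero_le_one : (0 : ℝ) ≤ 1)
  obtain ⟨G, i1, i2, i3, n, hn, hηn⟩ := exists_isTens η (by
    intro l hl
    have h0 : m' k₁ l = 0 := by
      refine hm.total _ fun k g => ?_
      obtain ⟨g', hg'⟩ := exists_norm_eq L (zero_le_one : (0 : ℝ) ≤ 1)
      have h1 : m k g = hm.flip.amp (rankOne ℂ g g') (m k g') := by
        rw [hm.flip_amp_apply, rankOne_apply, inner_self_eq_norm_sq_to_K, hg']; simp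
      rw [h1, ← adjoint_inner_right, ← star_eq_adjoint, ← map_star, star_eq_adjoint,
        adjoint_rankOne, hη, hm'.flip_amp_apply, hl, map_zero, inner_zero_right]
    have h2 := hm'.norm k₁ l
    rw [h0, norm_zero, hk₁, one_mul] at h2
    exact norm_eq_zero.1 h2.symm)
  obtain ⟨w, hw, hwmn⟩ := hm'.exists_assoc hn
  refine ⟨G, i1, i2, i3, w, hw, fun A B => ?_⟩
  symm
  have key : ∀ g, (hm'.amp A * hm.flip.amp B) ∘L w.flip g = w.flip g ∘L tensorOp A B := by
    intro g
    refine (isTens_tmulL (K := K') (G := L)).ext fun k l => ?_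
    change hm'.amp A (hm.flip.amp B (w (tmulL K' L k l) g)) = w (tensorOp A B (tmulL K' L k l)) g
    rw [tensorOp_tmulL, hwmn, hwmn, hη, hm'.flip_amp_apply, hm'.amp_apply, hηn]
  exact hw.amp_unique fun z g => congr($(key g) z)

variable {G : Type u} [NormedAddCommGroup G] [InnerProductSpace ℂ G] [CompleteSpace G]
  {w : HilbertTensor K' L →L[ℂ] G →L[ℂ] H}

theorem dense_span_tmulL : Dense (Submodule.span ℂ {z | ∃ k l, tmulL K L k l = z} :
    Set (HilbertTensor K L)) := (isTens_tmulL (K := K) (G := L)).dense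

/-- The relative commutant of `B(K') ⊗ 1` in `B(K) ⊗ 1`. -/
theorem IsTens.split_mem_iff [Nontrivial L] [Nontrivial K'] (hm : IsTens m) (hm' : IsTens m')
    (hw : IsTens w) (h : ∀ A B, hw.amp (tensorOp A B) = hm'.amp A * hm.flip.amp B)
    (X : H →L[ℂ] H) : (∃ Z, X = hw.flip.amp Z) ↔
      (∃ A, X = hm.amp A) ∧ ∀ A, hm'.amp A * X = X * hm'.amp A := by
  have h1 : tensorOp (1 : K' →L[ℂ] K') (1 : L →L[ℂ] L) = 1 :=
    (isTens_tmulL (K := K') (G := L)).ext fun k l => by rw [tensorOp_tmulL]; rfl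
  constructor
  · rintro ⟨Z, rfl⟩
    constructor
    · refine hm.flip.exists_of_commute _ fun B => ?_
      have := h 1 B
      rw [map_one, one_mul] at this
      rw [← this]
      exact hw.amp_commute _ _
    · intro A
      have := h A 1
      rw [map_one, mul_one] at this
      rw [← this]
      exact hw.amp_commute _ _
  · rintro ⟨⟨A, rfl⟩, hX⟩
    obtain ⟨k₀, hk₀⟩ := exists_norm_eq K' (zero_le_one : (0 : ℝ) ≤ 1)
    obtain ⟨l₀, hl₀⟩ := exists_norm_eq L (zero_le_one : (0 : ℝ) ≤ 1)
    -- Only the products A ⊗ B are under control, hence the test on rank one operators between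
    -- elementary tensors.
    refine hw.exists_of_commute_rankOne _ dense_span_tmulL (tmulL K' L k₀ l₀) ?_ _ ?_
    · rw [← norm_ne_zero_iff, isTens_tmulL.norm, hk₀, hl₀]; norm_num
    · rintro _ ⟨k, l, rfl⟩
      rw [← tensorOp_rankOne, h, mul_assoc, ← hm.amp_commute, ← mul_assoc, hX, mul_assoc]

/-- The commutant of the relative commutant of `B(K') ⊗ 1` in `B(K) ⊗ 1` meets `B(K) ⊗ 1` in
`B(K') ⊗ 1`. -/
theorem IsTens.exists_amp_of_commute_split [Nontrivial G] [Nontrivial L] [Nontrivial K']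
    (hm : IsTens m) (hm' : IsTens m')
    (hw : IsTens w) (h : ∀ A B, hw.amp (tensorOp A B) = hm'.amp A * hm.flip.amp B)
    (A : K →L[ℂ] K) (hX : ∀ Z, hw.flip.amp Z * hm.amp A = hm.amp A * hw.flip.amp Z) :
    ∃ A', hm.amp A = hm'.amp A' := by
  have hE := isTens_tmulL (K := K') (G := L)
  have hE1 : ∀ B, hE.flip.amp B = tensorOp 1 B := fun B =>
    hE.ext fun k l => by rw [hE.flip_amp_apply, tensorOp_tmulL]; rfl
  have hE2 : ∀ B, hE.amp B = tensorOp B 1 := fun B =>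
    hE.ext fun k l => by rw [hE.amp_apply, tensorOp_tmulL]; rfl
  -- The operator lies in B(K' ⊗ L) ⊗ 1; as an element of B(K) ⊗ 1 it also commutes with B(L), so
  -- only the factor on K' remains.
  obtain ⟨Z, hZ⟩ := hw.flip.exists_of_commute _ hX
  change hm.amp A = hw.amp Z at hZ
  obtain ⟨A', hA'⟩ := hE.flip.exists_of_commute Z fun B => by
    apply hw.amp_injective
    rw [map_mul, map_mul, ← hZ, hE1, h, map_one, one_mul]
    exact (hm.amp_commute A B).symm
  refine ⟨A', ?_⟩
  rw [hZ, hA']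
  change hw.amp (hE.amp A') = _
  rw [hE2, h, map_one, mul_one]

end Split

/-! ### Weak limits along ultrafilters. -/

section WeakLimit

variable {H : Type u} [NormedAddCommGroup H] [InnerProductSpace ℂ H] [CompleteSpace H]

/-- Bounded families of functionals converge pointwise along ultrafilters. -/
theorem exists_ultralimit {E ι : Type*} [SeminormedAddCommGroup E] [NormedSpace ℂ E]
    (u : Ultrafilter ι) (f : ι → E →ₗ[ℂ] ℂ) (C : ℝ) (hf : ∀ i x, ‖f i x‖ ≤ C * ‖x‖) :
    ∃ F : E →L[ℂ] ℂ, (∀ x, Tendsto (fun i => f i x) u (𝓝 (F x))) ∧ ∀ x, ‖F x‖ ≤ C * ‖x‖ := by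
  have hex : ∀ x, ∃ c : ℂ, ‖c‖ ≤ C * ‖x‖ ∧ Tendsto (fun i => f i x) u (𝓝 c) := by
    intro x
    have hc : IsCompact (Metric.closedBall (0 : ℂ) (C * ‖x‖)) := isCompact_closedBall _ _
    obtain ⟨c, hc, hle⟩ := hc.ultrafilter_le_nhds (u.map fun i => f i x) (by
      rw [Ultrafilter.coe_map, le_principal_iff]
      exact Filter.mem_map.2 (Filter.univ_mem' fun i => by simpa using hf i x))
    exact ⟨c, by simpa using hc, hle⟩
  choose F hF hFt using hex
  refine ⟨LinearMap.mkContinuous ⟨⟨F, fun x y => ?_⟩, fun c x => ?_⟩ C hF, hFt, hF⟩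
  · refine tendsto_nhds_unique (hFt (x + y)) ?_
    simp only [map_add]
    exact (hFt x).add (hFt y)
  · refine tendsto_nhds_unique (hFt (c • x)) ?_
    simp only [map_smul]
    exact (hFt x).const_smul c

/-- Bounded families of operators converge weakly along ultrafilters. -/
theorem exists_weak_limit {ι : Type*} (u : Ultrafilter ι) (X : ι → H →L[ℂ] H) (C : ℝ)
    (hC : ∀ i, ‖X i‖ ≤ C) :
    ∃ Y : H →L[ℂ] H, ∀ x y, Tendsto (fun i => ⟪x, X i y⟫_ℂ) u (𝓝 ⟪x, Y y⟫_ℂ) := by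
  have hC0 : ∀ i x y, ‖⟪x, X i y⟫_ℂ‖ ≤ C * ‖x‖ * ‖y‖ := fun i x y => by
    refine (norm_inner_le_norm _ _).trans ?_
    have := (X i).le_opNorm y
    have h2 := mul_le_mul_of_nonneg_right (hC i) (norm_nonneg y)
    nlinarith [norm_nonneg x, mul_le_mul_of_nonneg_left (this.trans h2) (norm_nonneg x)]
  have h1 : ∀ x, ∃ F : H →L[ℂ] ℂ, (∀ y, Tendsto (fun i => ⟪x, X i y⟫_ℂ) u (𝓝 (F y))) ∧
      ∀ y, ‖F y‖ ≤ C * ‖x‖ * ‖y‖ := fun x =>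
    exists_ultralimit u (fun i => ((innerSL ℂ x) ∘L X i : H →L[ℂ] ℂ).toLinearMap) _
      fun i y => hC0 i x y
  choose F hF hFC using h1
  have hC' : 0 ≤ C := by
    obtain ⟨i⟩ := u.neBot.nonempty
    exact (norm_nonneg _).trans (hC i)
  let B : H →L⋆[ℂ] H →L[ℂ] ℂ := LinearMap.mkContinuous
    { toFun := F
      map_add' := fun x x' => by
        ext y
        refine tendsto_nhds_unique (hF (x + x') y) ?_
        simp only [inner_add_left]
        exact (hF x y).add (hF x' y)
      map_smul' := fun c x => by
        ext y
        refine tendsto_nhds_unique (hF (c • x) y) ?_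
        simp only [inner_smul_left]
        exact (hF x y).const_mul _ } C fun x =>
      (F x).opNorm_le_bound (mul_nonneg hC' (norm_nonneg _)) fun y => hFC x y
  refine ⟨adjoint (continuousLinearMapOfBilin B), fun x y => ?_⟩
  rw [adjoint_inner_right, continuousLinearMapOfBilin_apply]
  exact hF x y

end WeakLimit

/-! ### Decreasing families of type I factors and their relative commutants. -/

section Shift

variable {K L H : Type u} [NormedAddCommGroup K] [InnerProductSpace ℂ K] [CompleteSpace K]
  [NormedAddCommGroup L] [InnerProductSpace ℂ L] [CompleteSpace L]
  [NormedAddCommGroup H] [InnerProductSpace ℂ H] [CompleteSpace H]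
  {m : K →L[ℂ] L →L[ℂ] H} {U : Multiplicative ℝ →* unitary (H →L[ℂ] H)}

theorem flow_add (s t : ℝ) (X : H →L[ℂ] H) : flow U (s + t) X = flow U s (flow U t X) := by
  simp only [flow, ofAdd_add, map_mul]
  rfl

theorem flow_zero (X : H →L[ℂ] H) : flow U 0 X = X := by
  simp only [flow, ofAdd_zero, map_one]
  rfl

theorem flow_neg_flow (t : ℝ) (X : H →L[ℂ] H) : flow U (-t) (flow U t X) = X := by
  rw [← flow_add, neg_add_cancel, flow_zero]

theorem flow_flow_neg (t : ℝ) (X : H →L[ℂ] H) : flow U t (flow U (-t) X) = X := by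
  rw [← flow_add, add_neg_cancel, flow_zero]

/-- The semigroup `γ_{-t}`, `t ≥ 0`, maps `B(K) ⊗ 1` into itself, and the images decrease to the
scalars. -/
structure IsPureShift (hm : IsTens m) (U : Multiplicative ℝ →* unitary (H →L[ℂ] H)) : Prop where
  invariant : ∀ t, 0 ≤ t → ∀ A, ∃ A', flow U (-t) (hm.amp A) = hm.amp A'
  trivial : ∀ X, (∀ t, 0 ≤ t → ∃ A, X = flow U (-t) (hm.amp A)) → ∃ c : ℂ, X = c • 1

/-- Membership in the relative commutant of `γ_{-t}(B(K) ⊗ 1)` in `B(K) ⊗ 1`. -/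
def RelCommutant (hm : IsTens m) (U : Multiplicative ℝ →* unitary (H →L[ℂ] H)) (t : ℝ)
    (X : H →L[ℂ] H) : Prop :=
  (∃ A, X = hm.amp A) ∧ ∀ A, flow U (-t) (hm.amp A) * X = X * flow U (-t) (hm.amp A)

theorem RelCommutant.mono {hm : IsTens m} (h : IsPureShift hm U) {s t : ℝ} (hst : s ≤ t)
    {X : H →L[ℂ] H} (hX : RelCommutant hm U s X) : RelCommutant hm U t X := by
  refine ⟨hX.1, fun A => ?_⟩
  obtain ⟨A', hA'⟩ := h.invariant (t - s) (sub_nonneg.2 hst) A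
  have : flow U (-t) (hm.amp A) = flow U (-s) (hm.amp A') := by
    rw [← hA', ← flow_add]; congr 2; ring
  rw [this]
  exact hX.2 A'

variable [Nontrivial K] [Nontrivial L] [Nontrivial H] {hm : IsTens m}

/-- Applies the splitting to γ_{-t}(B(K) ⊗ 1) inside B(K) ⊗ 1: the relative commutant becomes B(G),
and its commutant becomes B(K ⊗ L), generated by γ_{-t}(B(K) ⊗ 1) and 1 ⊗ B(L). -/
theorem IsPureShift.exists_split (h : IsPureShift hm U) {t : ℝ} (ht : 0 ≤ t) :
    ∃ (G : Type u) (_ : NormedAddCommGroup G) (_ : InnerProductSpace ℂ G) (_ : CompleteSpace G)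
      (w : HilbertTensor K L →L[ℂ] G →L[ℂ] H) (hw : IsTens w), Nontrivial G ∧
      (∀ A B, hw.amp (tensorOp A B) = flow U (-t) (hm.amp A) * hm.flip.amp B) ∧
      (∀ X, (∃ Z, X = hw.flip.amp Z) ↔ RelCommutant hm U t X) ∧
      ∀ A, (∀ Y, RelCommutant hm U t Y → Y * hm.amp A = hm.amp A * Y) →
        ∃ A', hm.amp A = flow U (-t) (hm.amp A') := by
  let V := U (Multiplicative.ofAdd (-t))
  have hV : ∀ A, (hm.conj V).amp A = flow U (-t) (hm.amp A) := hm.amp_conj V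
  obtain ⟨G, i1, i2, i3, w, hw, hwV⟩ := hm.exists_split (hm.conj V) fun A => by
    rw [hV]; exact h.invariant t ht A
  have hG : Nontrivial G := hw.nontrivial_right
  have hmem := hm.split_mem_iff (hm.conj V) hw hwV
  have hcom := hm.exists_amp_of_commute_split (hm.conj V) hw hwV
  simp only [hV] at hwV hmem hcom
  refine ⟨G, i1, i2, i3, w, hw, hG, hwV, hmem, fun A hA => hcom A fun Z => ?_⟩
  exact hA _ ((hmem _).1 ⟨Z, rfl⟩)

theorem inner_slice (X : H →L[ℂ] H) (l l' : L) (k k' : K) :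
    ⟪k', (adjoint (m.flip l) ∘L X ∘L m.flip l') k⟫_ℂ = ⟪m k' l, X (m k l')⟫_ℂ := by
  rw [comp_apply, adjoint_inner_right]
  rfl

/-- The relative commutants generate `B(K) ⊗ 1`. -/
theorem IsPureShift.exists_of_commute (h : IsPureShift hm U) (X : H →L[ℂ] H)
    (hX : ∀ t, 0 ≤ t → ∀ Y, RelCommutant hm U t Y → Y * X = X * Y) :
    ∃ B, X = hm.flip.amp B := by
  have key : ∀ l l', ∃ c : ℂ, ∀ k k', ⟪m k' l, X (m k l')⟫_ℂ = c * ⟪k', k⟫_ℂ := by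
    intro l l'
    -- A slice of X over the second factor still commutes with every relative commutant. By the
    -- double commutant property in B(K) ⊗ 1 it lies in all γ_{-t}(B(K) ⊗ 1), hence is scalar.
    -- Scalar slices mean that X acts on the second factor only.
    let Z : K →L[ℂ] K := adjoint (m.flip l) ∘L X ∘L m.flip l'
    obtain ⟨c, hc⟩ := h.trivial (hm.amp Z) fun t ht => by
      obtain ⟨G, i1, i2, i3, w, hw, hG, -, -, hcom⟩ := h.exists_split ht
      refine hcom Z fun Y hY => ?_
      have hYX := hX t ht Y hY
      obtain ⟨⟨y, rfl⟩, -⟩ := hY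
      rw [← map_mul, ← map_mul]
      congr 1
      ext k
      refine ext_inner_left ℂ fun k' => ?_
      change ⟪k', y (Z k)⟫_ℂ = ⟪k', Z (y k)⟫_ℂ
      rw [← adjoint_inner_left, inner_slice, inner_slice, ← hm.amp_apply, ← hm.amp_apply,
        ← star_eq_adjoint, map_star, star_eq_adjoint, adjoint_inner_left]
      exact congr(⟪m k' l, $hYX (m k l')⟫_ℂ)
    have hZ : Z = c • 1 := hm.amp_injective (by rw [hc, map_smul, map_one])
    refine ⟨c, fun k k' => ?_⟩
    rw [← inner_slice]
    change ⟪k', Z k⟫_ℂ = _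
    rw [hZ, smul_apply, inner_smul_right]
    rfl
  refine hm.exists_of_commute X fun A => hm.ext fun k l' => ?_
  rw [← sub_eq_zero]
  refine hm.total _ fun k' l => ?_
  obtain ⟨c, hc⟩ := key l l'
  change ⟪m k' l, hm.amp A (X (m k l')) - X (hm.amp A (m k l'))⟫_ℂ = 0
  rw [inner_sub_right, ← adjoint_inner_left, ← star_eq_adjoint, ← map_star, hm.amp_apply,
    hm.amp_apply, hc, hc, star_eq_adjoint, adjoint_inner_left, sub_self]

/-- Normal functionals which agree on `1 ⊗ B(L)` are asymptotically close on the commutants of the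
relative commutants. -/
theorem IsPureShift.exists_norm_sub_le (h : IsPureShift hm U) (ξ : H) {σ : (H →L[ℂ] H) →ₗ[ℂ] ℂ}
    {ι : Type*} {c : ι → ℝ} {v : ι → H} (hσ : IsDiag σ c v) (hc : Summable c)
    (hagree : ∀ B, vec ξ (hm.flip.amp B) = σ (hm.flip.amp B)) {ε : ℝ} (hε : 0 < ε) :
    ∃ T, 0 ≤ T ∧ ∀ t, T ≤ t → ∀ X : H →L[ℂ] H,
      (∀ Y, RelCommutant hm U t Y → Y * X = X * Y) → ‖vec ξ X - σ X‖ ≤ ε * ‖X‖ := by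
  by_contra! hcon
  have h1 : ∀ n : ℕ, ∃ t, (n : ℝ) ≤ t ∧ ∃ X : H →L[ℂ] H, ‖X‖ = 1 ∧
      (∀ Y, RelCommutant hm U t Y → Y * X = X * Y) ∧ ε ≤ ‖vec ξ X - σ X‖ := by
    intro n
    obtain ⟨t, ht, X, hX, hlt⟩ := hcon n n.cast_nonneg
    have hX0 : ‖X‖ ≠ 0 := by
      intro h0
      rw [norm_eq_zero] at h0
      simp [h0] at hlt
    have hX1 : 0 < ‖X‖ := lt_of_le_of_ne (norm_nonneg _) (Ne.symm hX0)
    refine ⟨t, ht, ((‖X‖⁻¹ : ℝ) : ℂ) • X, ?_, fun Y hY => ?_, ?_⟩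
    · rw [norm_smul, Complex.norm_real, norm_inv, norm_norm, inv_mul_cancel₀ hX0]
    · rw [mul_smul_comm, smul_mul_assoc, hX Y hY]
    · rw [map_smul, map_smul, ← smul_sub, norm_smul, Complex.norm_real, norm_inv, norm_norm,
        ← div_eq_inv_mul, le_div_iff₀ hX1]
      exact hlt.le
  choose t ht X hX1 hX hXε using h1
  let u : Ultrafilter ℕ := Filter.hyperfilter ℕ
  have hu : (u : Filter ℕ) ≤ atTop := Nat.hyperfilter_le_atTop
  obtain ⟨Y, hY⟩ := exists_weak_limit u X 1 fun n => (hX1 n).le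
  -- Each relative commutant is contained in all later ones, so it commutes with X n for all large n
  -- and therefore with the weak limit Y.
  obtain ⟨B, hB⟩ := h.exists_of_commute Y fun s _ Z hZ => by
    ext y
    refine ext_inner_left ℂ fun x => ?_
    change ⟪x, Z (Y y)⟫_ℂ = ⟪x, Y (Z y)⟫_ℂ
    rw [← adjoint_inner_left]
    refine tendsto_nhds_unique (hY _ _) ((hY _ _).congr' ?_)
    filter_upwards [hu (eventually_ge_atTop ⌈s⌉₊)] with n hn
    rw [adjoint_inner_left]
    have hs : s ≤ t n := (Nat.le_ceil s).trans ((Nat.cast_le.2 hn).trans (ht n))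
    exact congr(⟪x, $(hX n Z (hZ.mono h hs)) y⟫_ℂ).symm
  have hvec : Tendsto (fun n => vec ξ (X n)) u (𝓝 (vec ξ Y)) := hY ξ ξ
  -- Normal functionals are weakly continuous on bounded sets: dominated convergence with the
  -- summable weights as majorant.
  have hσY : Tendsto (fun n => σ (X n)) u (𝓝 (σ Y)) := by
    have : ∀ Z, σ Z = ∑' i, (c i : ℂ) * ⟪v i, Z (v i)⟫_ℂ := fun Z => (hσ.hasSum Z).tsum_eq.symm
    simp only [this]
    refine tendsto_tsum_of_dominated_convergence hc (fun i => (hY _ _).const_mul _)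
      (Eventually.of_forall fun n i => ?_)
    rw [norm_mul, Complex.norm_real, Real.norm_eq_abs, abs_of_pos (hσ.pos i)]
    refine mul_le_of_le_one_right (hσ.pos i).le ?_
    refine (norm_inner_le_norm _ _).trans ?_
    have := (X n).le_opNorm (v i)
    rw [hX1, hσ.orthonormal.1 i] at this
    rw [hσ.orthonormal.1 i, one_mul]
    linarith
  have hlim := (hvec.sub hσY).norm
  have hge : ε ≤ ‖vec ξ Y - σ Y‖ := ge_of_tendsto hlim (Eventually.of_forall hXε)
  rw [hB, hagree, sub_self, norm_zero] at hge
  linarith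

end Shift

/-! ### Asymptotics of the eigenvalue lists on relative commutants. -/

section Near

variable {K L H : Type u} [NormedAddCommGroup K] [InnerProductSpace ℂ K] [CompleteSpace K]
  [NormedAddCommGroup L] [InnerProductSpace ℂ L] [CompleteSpace L]
  [NormedAddCommGroup H] [InnerProductSpace ℂ H] [CompleteSpace H]
  {m : K →L[ℂ] L →L[ℂ] H} {U : Multiplicative ℝ →* unitary (H →L[ℂ] H)}

/-- A product state of diagonal states is diagonal. -/
theorem IsDiag.tensor {f : (HilbertTensor K L →L[ℂ] HilbertTensor K L) →ₗ[ℂ] ℂ} (hf : IsState f)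
    {f₁ : (K →L[ℂ] K) → ℂ} {f₂ : (L →L[ℂ] L) → ℂ} {ι κ : Type*} {a : ι → ℝ} {b : ι → K}
    {a' : κ → ℝ} {b' : κ → L} (h₁ : IsDiag f₁ a b) (h₂ : IsDiag f₂ a' b')
    (ha : HasSum a 1) (ha' : HasSum a' 1) (h : ∀ A B, f (tensorOp A B) = f₁ A * f₂ B) :
    IsDiag f (fun p : ι × κ => a p.1 * a' p.2) (fun p => tmulL K L (b p.1) (b' p.2)) := by
  refine isDiag_of_rankOne hf (orthonormal_tmulL isTens_tmulL h₁.orthonormal h₂.orthonormal)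
    (fun p => mul_pos (h₁.pos _) (h₂.pos _))
    (by simpa using HasSum.prod_mul_real ha ha') fun p x => ?_
  -- The value at |x⟩⟨b ⊗ b'| is a bounded linear function of x, so elementary tensors suffice. This
  -- is what makes the product formula determine f.
  let F : HilbertTensor K L →L[ℂ] ℂ := (LinearMap.mkContinuous f 1 fun X => by
    simpa using hf.norm_le X) ∘L
      ((rankOne ℂ).flip (tmulL K L (b p.1) (b' p.2)) : HilbertTensor K L →L[ℂ] _)
  have hF : F = ((a p.1 * a' p.2 : ℝ) : ℂ) • innerSL ℂ (tmulL K L (b p.1) (b' p.2)) := by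
    refine (isTens_tmulL (K := K) (G := L)).ext fun k l => ?_
    change f (rankOne ℂ (tmulL K L k l) (tmulL K L (b p.1) (b' p.2))) =
      ((a p.1 * a' p.2 : ℝ) : ℂ) * ⟪tmulL K L (b p.1) (b' p.2), tmulL K L k l⟫_ℂ
    rw [← tensorOp_rankOne, h, h₁.apply_rankOne, h₂.apply_rankOne, isTens_tmulL.inner]
    push_cast
    ring
  exact congr($hF x)

theorem isState_diagFun {ι : Type*} {a : ι → ℝ} {b : ι → K} (hb : Orthonormal ℂ b)
    (ha : HasSum a 1) (h0 : ∀ i, 0 ≤ a i) : IsState (diagFun hb ha.summable) where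
  map_one := by
    refine (hasSum_diagFun hb ha.summable 1).unique ?_
    refine hasSum_of_eq (by simpa using Complex.hasSum_ofReal.2 ha) fun p => ?_
    change _ = _ * ⟪b p, b p⟫_ℂ
    rw [inner_self_eq_norm_sq_to_K, hb.1 p]; simp
  nonneg X := by
    refine (hasSum_diagFun hb ha.summable _).nonneg fun i => ?_
    exact mul_nonneg (Complex.zero_le_real.2 (h0 i)) ((isState_vec (b i) (hb.1 i)).nonneg X)

variable [Nontrivial K] [Nontrivial L] [Nontrivial H] {hm : IsTens m}

/-- The eigenvalue list of the restriction of the state `φ` to the relative commutants of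
`γ_{-t}(B(K) ⊗ 1)` converges to the one of `φ ⊗ φ`. -/
theorem IsPureShift.exists_list_near (h : IsPureShift hm U) {ξ : H} (hξ : ‖ξ‖ = 1)
    (hinv : ∀ t, 0 ≤ t → ∀ A, vec ξ (flow U (-t) (hm.amp A)) = vec ξ (hm.amp A))
    {ι : Type u} {a : ι → ℝ} {b : ι → K} (hd : IsDiag (fun A => vec ξ (hm.amp A)) a b)
    {Λ : ℕ → ℝ} (hΛ : Antitone Λ) (h0 : ∀ n, 0 ≤ Λ n)
    (hl : Lists (fun p : ι × ι => a p.1 * a p.2) Λ) {ε : ℝ} (hε : 0 < ε) :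
    ∃ T, 0 ≤ T ∧ ∀ t, T ≤ t → ∃ (G : Type u) (_ : NormedAddCommGroup G) (_ : InnerProductSpace ℂ G)
      (_ : CompleteSpace G) (π : (G →L[ℂ] G) →⋆ₐ[ℂ] (H →L[ℂ] H)) (κ : Type u) (a' : κ → ℝ)
      (b' : κ → G) (Λ' : ℕ → ℝ), Function.Injective π ∧
      (∀ X, (∃ Z, π Z = X) ↔ RelCommutant hm U t X) ∧ IsDiag (fun Z => vec ξ (π Z)) a' b' ∧
      HasSum a' 1 ∧ Antitone Λ' ∧ (∀ n, 0 ≤ Λ' n) ∧ Lists a' Λ' ∧ listDist Λ' Λ ≤ ε := by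
  have hst := isState_vec ξ hξ
  have ha : HasSum a 1 := hd.hasSum_weights (by simpa using hst.map_one)
  obtain ⟨g, hg⟩ := hm.exists_isDiag_flip ξ hξ hd
  have ho := orthonormal_tmulL hm hd.orthonormal hg.orthonormal
  have hs : HasSum (fun p : ι × ι => a p.1 * a p.2) 1 := by
    simpa using HasSum.prod_mul_real ha ha
  have hpos : ∀ p : ι × ι, 0 < a p.1 * a p.2 := fun p => mul_pos (hd.pos _) (hd.pos _)
  -- σ is the product of the marginals of ξ on B(K) ⊗ 1 and 1 ⊗ B(L). By the Schmidt decomposition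
  -- both marginals have the weights a, so σ has the weights a i · a j.
  let σ := diagFun ho hs.summable
  have hσst : IsState σ := isState_diagFun ho hs fun p => (hpos p).le
  have hσd : IsDiag σ _ _ := ⟨ho, hpos, hasSum_diagFun ho hs.summable⟩
  have hσ : ∀ A B, σ (hm.amp A * hm.flip.amp B) = vec ξ (hm.amp A) * vec ξ (hm.flip.amp B) := by
    intro A B
    refine (hσd.hasSum _).unique ?_
    refine hasSum_of_eq (HasSum.prod_mul (hd.hasSum A) (hg.hasSum B)) fun p => ?_
    change _ = _ * ⟪m (b p.1) (g p.2), hm.amp A (hm.flip.amp B (m (b p.1) (g p.2)))⟫_ℂ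
    rw [hm.flip_amp_apply, hm.amp_apply, hm.inner]
    push_cast
    ring
  obtain ⟨T, hT0, hT⟩ := h.exists_norm_sub_le ξ hσd hs.summable (fun B => by
    have := hσ 1 B
    rw [map_one, one_mul, hst.map_one, one_mul] at this
    exact this.symm) hε
  refine ⟨T, hT0, fun t ht => ?_⟩
  obtain ⟨G, i1, i2, i3, w, hw, hG, hwt, hmem, -⟩ := h.exists_split (hT0.trans ht)
  -- In the t-dependent decomposition σ is still a product with the same weights: γ_{-t}(A ⊗ 1)
  -- stays in B(K) ⊗ 1, and ξ is invariant there.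
  have hσw : IsDiag (fun Z => σ (hw.amp Z)) _ _ :=
    IsDiag.tensor (hσst.comp hw.amp) hd hg ha ha fun A B => by
      change σ (hw.amp (tensorOp A B)) = _
      obtain ⟨A', hA'⟩ := h.invariant t (hT0.trans ht) A
      rw [hwt, hA', hσ, ← hA', hinv t (hT0.trans ht)]
  obtain ⟨κ, a', c, hξd⟩ := hw.exists_isDiag_vec ξ hξ
  have ha' : HasSum a' 1 := hξd.hasSum_weights (by simpa using hst.map_one)
  -- The comparison with σ takes place on B(K ⊗ L); Schmidt transfers its weights to the relative
  -- commutant B(G).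
  obtain ⟨b', hb'⟩ := hw.exists_isDiag_flip ξ hξ hξd
  obtain ⟨Λ', hΛ', hΛ'0, hl'⟩ := exists_lists hξd.pos ha'.summable
  have : Nontrivial (HilbertTensor K L) := hw.flip.nontrivial_right
  refine ⟨G, i1, i2, i3, hw.flip.amp, κ, a', b', Λ', hw.flip.amp_injective, fun X => ?_, hb', ha',
    hΛ', hΛ'0, hl', ?_⟩
  · rw [← hmem]
    exact exists_congr fun Z => eq_comm
  · refine IsDiag.list_contraction
      (f := vec ξ ∘ₗ (hw.amp.toAlgHom.toLinearMap)) (f' := σ ∘ₗ (hw.amp.toAlgHom.toLinearMap))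
      hξd hσw ha'.summable hs.summable hΛ' hΛ hΛ'0 h0 hl' hl hε.le fun Z => ?_
    refine (hT t ht (hw.amp Z) fun Y hY => ?_).trans ?_
    · obtain ⟨Y, rfl⟩ := (hmem Y).2 hY
      exact (hw.amp_commute Z Y).symm
    · exact mul_le_mul_of_nonneg_left (NonUnitalStarAlgHom.norm_apply_le hw.amp Z) hε.le

end Near

/-! ### Vector representatives of normal states. -/

section Vector

variable {K L H : Type u} [NormedAddCommGroup K] [InnerProductSpace ℂ K] [CompleteSpace K]
  [NormedAddCommGroup L] [InnerProductSpace ℂ L] [CompleteSpace L]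
  [NormedAddCommGroup H] [InnerProductSpace ℂ H] [CompleteSpace H]
  {m : K →L[ℂ] L →L[ℂ] H} {U : Multiplicative ℝ →* unitary (H →L[ℂ] H)}

/-- A diagonal state of `B(K) ⊗ 1` is a vector state if the second factor is infinite
dimensional. -/
theorem IsTens.exists_vec_eq (hm : IsTens m) (hL : ¬ FiniteDimensional ℂ L)
    {f : (K →L[ℂ] K) → ℂ} {ι : Type u} {a : ι → ℝ} {b : ι → K} (hd : IsDiag f a b)
    (ha : HasSum a 1) : ∃ ξ : H, ‖ξ‖ = 1 ∧ ∀ A, vec ξ (hm.amp A) = f A := by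
  classical
  obtain ⟨w, e, -⟩ := _root_.exists_hilbertBasis ℂ L
  have hw : Infinite w := by
    by_contra hfin
    rw [not_infinite_iff_finite] at hfin
    have := Fintype.ofFinite w
    exact hL (e.toOrthonormalBasis.toBasis.finiteDimensional_of_finite)
  have hcount : Countable ι := by
    have := ha.summable.countable_support
    rw [Function.support_eq_univ fun i => (hd.pos i).ne'] at this
    exact Set.countable_univ_iff.1 this
  obtain ⟨j, hj⟩ := exists_injective_nat ι
  -- Purification: ξ = ∑ √(a i) b i ⊗ g i with orthonormal g i. Summability makes the index set
  -- countable, so an infinite dimensional L has room for the g i.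
  let g : ι → L := fun i => e (Infinite.natEmbedding w (j i))
  have hg : Orthonormal ℂ g :=
    e.orthonormal.comp _ ((Infinite.natEmbedding w).injective.comp hj)
  have hv : Orthonormal ℂ fun i => m (b i) (g i) := by
    rw [orthonormal_iff_ite]
    intro i i'
    rw [hm.inner, orthonormal_iff_ite.1 hd.orthonormal, orthonormal_iff_ite.1 hg]
    split_ifs <;> simp
  have hsq : ∀ i, Real.sqrt (a i) * Real.sqrt (a i) = a i := fun i =>
    Real.mul_self_sqrt (hd.pos i).le
  let c : lp (fun _ : ι => ℂ) 2 := ⟨fun i => (Real.sqrt (a i) : ℂ), by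
    refine memℓp_gen ?_
    refine ha.summable.congr fun i => ?_
    simp [abs_of_nonneg (Real.sqrt_nonneg _), Real.sq_sqrt (hd.pos i).le]⟩
  let ξ : H := hv.orthogonalFamily.linearIsometry c
  have hξ : HasSum (fun i => (Real.sqrt (a i) : ℂ) • m (b i) (g i)) ξ :=
    hv.orthogonalFamily.hasSum_linearIsometry c
  have hin : ∀ i k, ⟪m k (g i), ξ⟫_ℂ = Real.sqrt (a i) * ⟪k, b i⟫_ℂ := by
    intro i k
    have h1 := hξ.mapL (innerSL ℂ (m k (g i)))
    refine h1.unique ?_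
    convert hasSum_single i _ using 1
    · simp [hm.inner, hg.1]
    · intro i' hi'
      simp [hm.inner, hg.2 (Ne.symm hi')]
  have hval : ∀ A, HasSum (fun i => (a i : ℂ) * ⟪b i, A (b i)⟫_ℂ) (vec ξ (hm.amp A)) := by
    intro A
    have h1 := hξ.mapL ((innerSL ℂ ξ) ∘L hm.amp A)
    refine hasSum_of_eq h1 fun i => ?_
    rw [comp_apply, map_smul, map_smul, hm.amp_apply, innerSL_apply_apply, smul_eq_mul,
      ← inner_conj_symm, hin, map_mul, Complex.conj_ofReal, inner_conj_symm, ← mul_assoc]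
    congr 1
    exact_mod_cast hsq i
  have hξ1 : ⟪ξ, ξ⟫_ℂ = 1 := by
    have h1 := hval 1
    rw [map_one] at h1
    refine h1.unique ?_
    refine hasSum_of_eq (by simpa using Complex.hasSum_ofReal.2 ha) fun i => ?_
    change _ = _ * ⟪b i, b i⟫_ℂ
    rw [inner_self_eq_norm_sq_to_K, hd.orthonormal.1 i]; simp
  refine ⟨ξ, ?_, fun A => (hval A).unique (hd.hasSum A)⟩
  have h2 : ⟪ξ, ξ⟫_ℂ = ((‖ξ‖ : ℝ) : ℂ) ^ 2 := inner_self_eq_norm_sq_to_K ξ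
  rw [h2] at hξ1
  have h3 : ‖ξ‖ ^ 2 = 1 := by exact_mod_cast hξ1
  nlinarith [norm_nonneg ξ]

theorem IsTens.finiteDimensional [FiniteDimensional ℂ K] [FiniteDimensional ℂ L]
    (hm : IsTens m) : FiniteDimensional ℂ H := by
  obtain ⟨w, e, -⟩ := _root_.exists_hilbertBasis ℂ K
  obtain ⟨w', e', -⟩ := _root_.exists_hilbertBasis ℂ L
  have : Finite w := e.orthonormal.linearIndependent.finite
  have : Finite w' := e'.orthonormal.linearIndependent.finite
  obtain ⟨b, -⟩ := hm.exists_hilbertBasis e e'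
  have := Fintype.ofFinite (w × w')
  exact b.toOrthonormalBasis.toBasis.finiteDimensional_of_finite

/-- If L were finite dimensional, the injective maps γ_t of 1 ⊗ B(L) into itself would be onto. Then
γ_t would also preserve the commutant B(K) ⊗ 1, every γ_{-t}(B(K) ⊗ 1) would be all of B(K) ⊗ 1, and
pureness would leave only scalars. So K would be one dimensional and H finite dimensional. -/
theorem IsPureShift.not_finiteDimensional [Nontrivial K] [Nontrivial L] {hm : IsTens m}
    (h : IsPureShift hm U) (hH : ¬ FiniteDimensional ℂ H) : ¬ FiniteDimensional ℂ L := by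
  intro hL
  apply hH
  let R : Submodule ℂ (H →L[ℂ] H) := LinearMap.range hm.flip.amp.toAlgHom.toLinearMap
  have hR : ∀ X, X ∈ R ↔ ∃ B, X = hm.flip.amp B := fun X => exists_congr fun B => eq_comm
  have hRfin : FiniteDimensional ℂ R := by
    have : FiniteDimensional ℂ (L →L[ℂ] L) :=
      Module.Finite.equiv (LinearMap.toContinuousLinearMap (𝕜 := ℂ) (E := L) (F' := L))
    infer_instance
  have hmap : ∀ t, 0 ≤ t → ∀ Y ∈ R, flow U t Y ∈ R := by
    intro t ht Y hY
    obtain ⟨B, rfl⟩ := (hR _).1 hY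
    rw [hR]
    refine hm.exists_of_commute _ fun A => ?_
    obtain ⟨A', hA'⟩ := h.invariant t ht A
    have h1 : hm.amp A = flow U t (hm.amp A') := by rw [← hA', flow_flow_neg]
    rw [h1, ← map_mul, ← map_mul, hm.amp_commute]
  have hmap' : ∀ t, 0 ≤ t → ∀ Y ∈ R, flow U (-t) Y ∈ R := by
    intro t ht Y hY
    let f : R →ₗ[ℂ] R := LinearMap.restrict
      ((flow U t).toStarAlgHom.toAlgHom.toLinearMap : (H →L[ℂ] H) →ₗ[ℂ] (H →L[ℂ] H)) (hmap t ht)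
    have hf : ∀ Y : R, (f Y : H →L[ℂ] H) = flow U t (Y : H →L[ℂ] H) := fun Y => rfl
    have hfi : Function.Injective f := fun Y Z hYZ =>
      Subtype.ext ((flow U t).injective (congrArg Subtype.val hYZ))
    obtain ⟨Z, hZ⟩ := LinearMap.injective_iff_surjective.1 hfi ⟨Y, hY⟩
    have : Y = flow U t (Z : H →L[ℂ] H) := by rw [← hf, hZ]
    rw [this, flow_neg_flow]
    exact Z.2
  have hscalar : ∀ A : K →L[ℂ] K, ∃ c : ℂ, A = c • 1 := by
    intro A
    obtain ⟨c, hc⟩ := h.trivial (hm.amp A) fun t ht => by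
      obtain ⟨A', hA'⟩ := hm.flip.exists_of_commute (flow U t (hm.amp A)) fun B => by
        obtain ⟨B', hB'⟩ := (hR _).1 (hmap' t ht _ ((hR _).2 ⟨B, rfl⟩))
        have h1 : hm.flip.amp B = flow U t (hm.flip.amp B') := by rw [← hB', flow_flow_neg]
        rw [h1, ← map_mul, ← map_mul, hm.amp_commute]
      exact ⟨A', by
        change _ = hm.amp A' at hA'
        rw [← hA', flow_neg_flow]⟩
    exact ⟨c, hm.amp_injective (by rw [hc, map_smul, map_one])⟩
  obtain ⟨k₀, hk₀⟩ := exists_ne (0 : K)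
  have hK : FiniteDimensional ℂ K := by
    refine .of_finrank_pos ?_
    have : Module.finrank ℂ K = 1 := finrank_eq_one k₀ hk₀ fun k => by
      obtain ⟨c, hc⟩ := hscalar (rankOne ℂ k k₀)
      refine ⟨(⟪k₀, k₀⟫_ℂ)⁻¹ * c, ?_⟩
      have h1 : rankOne ℂ k k₀ k₀ = c • k₀ := congr($hc k₀)
      rw [rankOne_apply] at h1
      rw [mul_smul, ← h1, inv_smul_smul₀ (inner_self_ne_zero.2 hk₀)]
    rw [this]; norm_num
  exact hm.finiteDimensional

end Vector

/-! ### The ℓ¹ distance of lists. -/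

section Lists

theorem listDist_triangle {a b c : ℕ → ℝ} (ha : Summable a) (hb : Summable b) (hc : Summable c) :
    listDist a c ≤ listDist a b + listDist b c := by
  have h1 := (ha.sub hb).abs
  have h2 := (hb.sub hc).abs
  rw [listDist, listDist, listDist, ← h1.tsum_add h2]
  exact (ha.sub hc).abs.tsum_le_tsum (fun _ => abs_sub_le _ _ _) (h1.add h2)

theorem listDist_comm (a b : ℕ → ℝ) : listDist a b = listDist b a :=
  tsum_congr fun _ => abs_sub_comm _ _

theorem eq_of_listDist_le_zero {a b : ℕ → ℝ} (ha : Summable a) (hb : Summable b)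
    (h : listDist a b ≤ 0) : a = b := by
  funext n
  have h1 := (ha.sub hb).abs.le_tsum n fun _ _ => abs_nonneg _
  exact sub_eq_zero.1 (abs_nonpos_iff.1 (h1.trans h))

end Lists

/-! ### Uniqueness of the weights and of the lists of product states. -/

section Weights

variable {K K' H : Type u} [NormedAddCommGroup K] [InnerProductSpace ℂ K] [CompleteSpace K]
  [NormedAddCommGroup K'] [InnerProductSpace ℂ K'] [CompleteSpace K']
  [NormedAddCommGroup H] [InnerProductSpace ℂ H] [CompleteSpace H]

/-- The weights of a diagonalization do not depend on the identification with `B(K)`. -/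
theorem exists_weights_equiv {B : Type u} [Ring B] [StarRing B] [Algebra ℂ B] {ω : B →ₗ[ℂ] ℂ}
    (θ : B ≃⋆ₐ[ℂ] (K →L[ℂ] K)) (θ' : B ≃⋆ₐ[ℂ] (K' →L[ℂ] K')) {ι ι' : Type*} {a : ι → ℝ}
    {b : ι → K} {a' : ι' → ℝ} {b' : ι' → K'} (h : IsDiag (fun X => ω (θ.symm X)) a b)
    (h' : IsDiag (fun X => ω (θ'.symm X)) a' b') (ha : HasSum a 1) (ha' : HasSum a' 1) :
    ∃ e : ι ≃ ι', ∀ i, a' (e i) = a i := by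
  obtain ⟨Λ, hΛ, hΛ0, hl⟩ := exists_lists h.pos ha.summable
  obtain ⟨Λ', hΛ', hΛ'0, hl'⟩ := exists_lists h'.pos ha'.summable
  -- The contraction estimate with both functionals equal and C = 0 doubles as the uniqueness of
  -- eigenvalues.
  have hd : listDist Λ Λ' ≤ 0 :=
    list_contraction_of_range_eq θ.symm.toStarAlgHom θ'.symm.toStarAlgHom θ.symm.injective
      θ'.symm.injective (fun X => ⟨fun _ => ⟨θ' X, θ'.symm_apply_apply X⟩,
        fun _ => ⟨θ X, θ.symm_apply_apply X⟩⟩) (f := ω) (f' := ω)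
      h h' ha.summable ha'.summable hΛ hΛ' hΛ0 hΛ'0 hl hl' le_rfl fun X => by simp
  have hΛΛ' := eq_of_listDist_le_zero (hl.hasSum hΛ0 ha).summable (hl'.hasSum hΛ'0 ha').summable hd
  rw [← hΛΛ'] at hl'
  exact hl.equiv hl'

theorem IsNormalState.exists_isDiag_of_equiv [Nontrivial H] {M : VonNeumannAlgebra H}
    {ω : M.toStarSubalgebra →ₗ[ℂ] ℂ} (hω : IsNormalState M.toStarSubalgebra ω)
    (θ : M.toStarSubalgebra ≃⋆ₐ[ℂ] (K →L[ℂ] K)) :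
    ∃ (ι : Type u) (a : ι → ℝ) (b : ι → K), IsDiag (fun X => ω (θ.symm X)) a b ∧ HasSum a 1 := by
  have hK : Nontrivial K := by
    by_contra hK
    rw [not_nontrivial_iff_subsingleton] at hK
    have h1 : (1 : M.toStarSubalgebra) = 0 := θ.injective (Subsingleton.elim _ _)
    have h2 : (1 : H →L[ℂ] H) = 0 := congrArg Subtype.val h1
    exact one_ne_zero h2
  obtain ⟨G, i1, i2, i3, m, hm, hG, hθ⟩ := exists_isTens_of_equiv M θ
  exact hω.exists_isDiag hm θ hθ

/-- The list may come from two different identifications of M for the two tensor factors; both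
produce the weights a up to reindexing. -/
theorem IsTensorEigenvalueList.lists [Nontrivial H] {M : VonNeumannAlgebra H}
    {ω : M.toStarSubalgebra →ₗ[ℂ] ℂ} (hω : IsNormalState M.toStarSubalgebra ω)
    (θ : M.toStarSubalgebra ≃⋆ₐ[ℂ] (K →L[ℂ] K)) {ι : Type u} {a : ι → ℝ} {b : ι → K}
    (h : IsDiag (fun X => ω (θ.symm X)) a b) (ha : HasSum a 1) {Λ : ℕ → ℝ}
    (hΛ : IsTensorEigenvalueList ω ω Λ) :
    Antitone Λ ∧ (∀ n, 0 ≤ Λ n) ∧ Lists (fun p : ι × ι => a p.1 * a p.2) Λ := by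
  obtain ⟨K₁, _, _, _, K₂, _, _, _, θ₁, θ₂, χ, T, hχ, hT, hTΛ⟩ := hΛ
  obtain ⟨ι₁, a₁, b₁, h₁, ha₁⟩ := hω.exists_isDiag_of_equiv θ₁
  obtain ⟨ι₂, a₂, b₂, h₂, ha₂⟩ := hω.exists_isDiag_of_equiv θ₂
  obtain ⟨e₁, he₁⟩ := exists_weights_equiv θ θ₁ h h₁ ha ha₁
  obtain ⟨e₂, he₂⟩ := exists_weights_equiv θ θ₂ h h₂ ha ha₂
  refine ⟨hTΛ.antitone, hTΛ.nonneg,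
    (lists_of_density θ₁ θ₂ h₁ h₂ ha₁ ha₂ hχ hT hTΛ).congr (e₁.prodCongr e₂) fun p => ?_⟩
  simp [he₁, he₂]

end Weights

/-! ### Invariant vectors and asymptotic states. -/

section Shift

variable {K L H : Type u} [NormedAddCommGroup K] [InnerProductSpace ℂ K] [CompleteSpace K]
  [NormedAddCommGroup L] [InnerProductSpace ℂ L] [CompleteSpace L]
  [NormedAddCommGroup H] [InnerProductSpace ℂ H] [CompleteSpace H]
  {m : K →L[ℂ] L →L[ℂ] H} {U : Multiplicative ℝ →* unitary (H →L[ℂ] H)} {hm : IsTens m}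

theorem norm_flow_le (t : ℝ) (X : H →L[ℂ] H) : ‖flow U t X‖ ≤ ‖X‖ :=
  NonUnitalStarAlgHom.norm_apply_le (flow U t) X

theorem continuous_flow (t : ℝ) : Continuous (flow U t) :=
  AddMonoidHomClass.continuous_of_bound (flow U t) 1 fun X => by
    rw [one_mul]; exact norm_flow_le t X

/-- An invariant normal state of `B(K) ⊗ 1` is implemented by a unit vector. -/
theorem IsPureShift.exists_vector [Nontrivial K] [Nontrivial L] (h : IsPureShift hm U)
    (hH : ¬ FiniteDimensional ℂ H) {S : StarSubalgebra ℂ (H →L[ℂ] H)} {ω : S →ₗ[ℂ] ℂ}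
    (hω : IsNormalState S ω) (θ : S ≃⋆ₐ[ℂ] (K →L[ℂ] K))
    (hθ : ∀ A, (θ.symm A : H →L[ℂ] H) = hm.amp A)
    (hinv : ∀ t : ℝ, 0 ≤ t → ∀ x y : S, (y : H →L[ℂ] H) = flow U (-t) x → ω y = ω x) :
    ∃ (ξ : H) (ι : Type u) (a : ι → ℝ) (b : ι → K), IsDiag (fun X => ω (θ.symm X)) a b ∧
      HasSum a 1 ∧ ‖ξ‖ = 1 ∧ (∀ A, vec ξ (hm.amp A) = ω (θ.symm A)) ∧
      ∀ t, 0 ≤ t → ∀ A, vec ξ (flow U (-t) (hm.amp A)) = vec ξ (hm.amp A) := by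
  obtain ⟨ι, a, b, hd, ha⟩ := hω.exists_isDiag hm θ hθ
  obtain ⟨ξ, hξ, hvec⟩ := hm.exists_vec_eq (h.not_finiteDimensional hH) hd ha
  refine ⟨ξ, ι, a, b, hd, ha, hξ, hvec, fun t ht A => ?_⟩
  obtain ⟨A', hA'⟩ := h.invariant t ht A
  rw [hA', hvec, hvec]
  exact hinv t ht _ _ (by rw [hθ, hθ, hA'])

/-- The asymptotic state of `B(H)` which extends an invariant state of `B(K) ⊗ 1`. -/
theorem IsTens.exists_asymptotic_state (hm : IsTens m) {ξ : H} (hξ : ‖ξ‖ = 1)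
    (hinv : ∀ t, 0 ≤ t → ∀ A, vec ξ (flow U (-t) (hm.amp A)) = vec ξ (hm.amp A)) :
    ∃ Φ : (H →L[ℂ] H) →L[ℂ] ℂ, IsState (Φ : (H →L[ℂ] H) →ₗ[ℂ] ℂ) ∧
      ∀ X t A, flow U (-t) X = hm.amp A → Φ X = vec ξ (hm.amp A) := by
  have hst := isState_vec ξ hξ
  let u : Ultrafilter ℝ := Ultrafilter.of atTop
  have hu : (u : Filter ℝ) ≤ atTop := Ultrafilter.of_le _
  obtain ⟨Φ, hΦ, -⟩ := exists_ultralimit u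
    (fun t => vec ξ ∘ₗ ((flow U (-t)).toStarAlgHom.toAlgHom.toLinearMap :
      (H →L[ℂ] H) →ₗ[ℂ] (H →L[ℂ] H))) 1 fun t X => by
        rw [one_mul]
        exact (hst.norm_le (flow U (-t) X)).trans (norm_flow_le _ _)
  have hΦ' : ∀ X, Tendsto (fun t => vec ξ (flow U (-t) X)) u (𝓝 (Φ X)) := hΦ
  refine ⟨Φ, ⟨?_, fun X => ?_⟩, fun X t A hX => ?_⟩
  · refine tendsto_nhds_unique (hΦ' 1) ?_
    simp only [map_one, hst.map_one]
    exact tendsto_const_nhds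
  · refine ge_of_tendsto (hΦ' (star X * X)) (Eventually.of_forall fun t => ?_)
    rw [map_mul, map_star]
    exact hst.nonneg _
  · refine tendsto_nhds_unique (hΦ' X) (tendsto_const_nhds.congr' ?_)
    -- Once γ_{-t} has moved X into B(K) ⊗ 1, invariance makes the values constant in time, so on
    -- such X the limit does not depend on the ultrafilter.
    filter_upwards [hu (eventually_ge_atTop t)] with s hs
    rw [← hinv (s - t) (sub_nonneg.2 hs) A, ← hX, ← flow_add]
    congr 3
    ring

end Shift

/-! ### Histories as pure shifts, in both directions of time. -/

section History

variable {K L H : Type u} [NormedAddCommGroup K] [InnerProductSpace ℂ K] [CompleteSpace K]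
  [NormedAddCommGroup L] [InnerProductSpace ℂ L] [CompleteSpace L]
  [NormedAddCommGroup H] [InnerProductSpace ℂ H] [CompleteSpace H]
  {m : K →L[ℂ] L →L[ℂ] H} {U : Multiplicative ℝ →* unitary (H →L[ℂ] H)} {hm : IsTens m}
  {M : VonNeumannAlgebra H}

theorem mem_translate_iff (t : ℝ) (X : H →L[ℂ] H) :
    X ∈ translate U M t ↔ flow U (-t) X ∈ M.toStarSubalgebra := by
  constructor
  · rintro ⟨x, hx, rfl⟩
    change flow U (-t) (flow U t x) ∈ _
    rw [flow_neg_flow]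
    exact hx
  · exact fun h => ⟨_, h, flow_flow_neg t X⟩

theorem mem_intervalAlgebra_iff (s t : ℝ) (X : H →L[ℂ] H) : X ∈ intervalAlgebra U M s t ↔
    flow U (-t) X ∈ M.toStarSubalgebra ∧ flow U (-s) X ∈ M.commutant.toStarSubalgebra := by
  rw [intervalAlgebra, StarSubalgebra.mem_inf, mem_translate_iff]
  refine and_congr_right fun _ => ?_
  change _ ↔ flow U (-s) X ∈ M.commutant
  rw [StarSubalgebra.mem_centralizer_iff, VonNeumannAlgebra.mem_commutant_iff]
  constructor
  · intro h y hy
    have := (h (flow U s y) ⟨y, hy, rfl⟩).1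
    rw [← flow_flow_neg s X, ← map_mul, ← map_mul] at this
    exact (flow U s).injective this
  · have key : (∀ y ∈ M, y * flow U (-s) X = flow U (-s) X * y) →
        ∀ g ∈ translate U M s, g * X = X * g := by
      intro h g hg
      have := h _ ((mem_translate_iff s g).1 hg)
      rw [← map_mul, ← map_mul] at this
      exact (flow U (-s)).injective this
    exact fun h g hg => ⟨key h g hg, key h _ (star_mem hg)⟩

theorem flow_mem_intervalAlgebra {s t : ℝ} {X : H →L[ℂ] H} (r : ℝ)
    (hX : X ∈ intervalAlgebra U M s t) : flow U r X ∈ intervalAlgebra U M (s + r) (t + r) := by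
  rw [mem_intervalAlgebra_iff] at hX ⊢
  rw [← flow_add, ← flow_add]
  convert hX using 4 <;> ring

variable [Nontrivial K] [Nontrivial L]

theorem IsHistory.isPureShift (h : IsHistory U M)
    (hM : ∀ X, X ∈ M.toStarSubalgebra ↔ ∃ A, X = hm.amp A) : IsPureShift hm U where
  invariant t ht A := by
    rw [← hM]
    have h1 := translate_mono h (neg_nonpos.2 ht) ⟨_, (hM _).2 ⟨A, rfl⟩, rfl⟩
    rw [mem_translate_iff, neg_zero, flow_zero] at h1
    exact h1
  trivial X hX := by
    have h1 : X ∈ ⋂ t : ℝ, (translate U M t : Set (H →L[ℂ] H)) := by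
      rw [Set.mem_iInter]
      intro t
      -- The hypothesis covers nonpositive times only; γ_{min(t,0)}(M) ⊆ γ_t(M) gives all t.
      obtain ⟨A, hA⟩ := hX (max (-t) 0) (le_max_right _ _)
      refine translate_mono h (s := -max (-t) 0) (by linarith [le_max_left (-t) 0])
        ⟨_, (hM _).2 ⟨A, rfl⟩, hA.symm⟩
    rw [h.remote_past] at h1
    obtain ⟨c, hc⟩ := h1
    exact ⟨c, hc.symm⟩

/-- The time reversed flow. -/
def reversed (U : Multiplicative ℝ →* unitary (H →L[ℂ] H)) :
    Multiplicative ℝ →* unitary (H →L[ℂ] H) := U.comp invMonoidHom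

theorem flow_reversed (t : ℝ) : flow (reversed U) t = flow U (-t) := rfl

theorem flow_reversed_neg (t : ℝ) : flow (reversed U) (-t) = flow U t := by
  rw [flow_reversed, neg_neg]

/-- Passing to commutants reverses the direction of time. An operator in every γ_t(M') commutes with
all γ_t(M), which generate B(H), so it is central; irreducibility plays the role that the trivial
remote past plays for M. -/
theorem IsHistory.isPureShift_reversed (h : IsHistory U M)
    (hM : ∀ X, X ∈ M.toStarSubalgebra ↔ ∃ A, X = hm.amp A) :
    IsPureShift hm.flip (reversed U) where
  invariant t ht B := by
    rw [flow_reversed_neg]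
    refine hm.exists_of_commute _ fun A => ?_
    obtain ⟨A', hA'⟩ := (h.isPureShift hM).invariant t ht A
    have h1 : hm.amp A = flow U t (hm.amp A') := by rw [← hA', flow_flow_neg]
    rw [h1, ← map_mul, ← map_mul, hm.amp_commute]
  trivial X hX := by
    have h1 : X ∈ Set.centralizer (⋃ t : ℝ, (translate U M t : Set (H →L[ℂ] H))) := by
      intro Y hY
      obtain ⟨t, hY⟩ := Set.mem_iUnion.1 hY
      obtain ⟨Z, hZ, rfl⟩ := translate_mono h (le_max_left t 0) hY
      obtain ⟨A, rfl⟩ := (hM _).1 hZ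
      obtain ⟨B, rfl⟩ := hX (max t 0) (le_max_right _ _)
      rw [flow_reversed_neg]
      change flow U _ _ * _ = _ * flow U _ _
      rw [← map_mul, ← map_mul, hm.amp_commute]
    have h2 : X ∈ Subalgebra.center ℂ (H →L[ℂ] H) := by
      rw [Subalgebra.mem_center_iff]
      intro Y
      have hY : Y ∈ Set.centralizer (Set.centralizer
          (⋃ t : ℝ, (translate U M t : Set (H →L[ℂ] H)))) := by
        rw [h.irreducible]; trivial
      exact (hY X h1).symm
    rw [Algebra.IsCentral.center_eq_bot] at h2
    obtain ⟨c, hc⟩ := Algebra.mem_bot.1 h2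
    exact ⟨c, by rw [← hc, Algebra.algebraMap_eq_smul_one]⟩

/-! ### The local algebra -/

theorem mem_localAlgebra_of_mem (h : IsHistory U M) {s t : ℝ} (hst : s ≤ t) {X : H →L[ℂ] H}
    (hX : X ∈ intervalAlgebra U M s t) : X ∈ localAlgebra U M := by
  rw [← SetLike.mem_coe, coe_localAlgebra h]
  exact subset_closure (Set.mem_iUnion.2 ⟨⟨(s, t), hst⟩, hX⟩)

/-- The union of the interval algebras is dense, which gives uniqueness of the extensions. -/
theorem IsHistory.localAlgebra_ext (h : IsHistory U M) {φ ψ : localAlgebra U M →L[ℂ] ℂ}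
    (hφψ : ∀ s t, s ≤ t → ∀ x : localAlgebra U M,
      (x : H →L[ℂ] H) ∈ intervalAlgebra U M s t → φ x = ψ x) : φ = ψ := by
  let D : Set (localAlgebra U M) :=
    {x | ∃ s t, s ≤ t ∧ (x : H →L[ℂ] H) ∈ intervalAlgebra U M s t}
  have hD : Dense D := by
    rw [Subtype.dense_iff]
    intro x hx
    rw [SetLike.mem_coe, ← SetLike.mem_coe, coe_localAlgebra h] at hx
    refine closure_mono ?_ hx
    rintro y hy
    obtain ⟨⟨⟨s, t⟩, hst⟩, hy⟩ := Set.mem_iUnion.1 hy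
    exact ⟨⟨y, mem_localAlgebra_of_mem h hst hy⟩, ⟨s, t, hst, hy⟩, rfl⟩
  refine ContinuousLinearMap.coeFn_injective
    (Continuous.ext_on hD φ.continuous ψ.continuous ?_)
  rintro x ⟨s, t, hst, hx⟩
  exact hφψ s t hst x hx

/-- A state of `B(H)` that is invariant on local observables restricts to an invariant state of the
local algebra. -/
theorem IsHistory.isInvariantState (h : IsHistory U M) {Φ : (H →L[ℂ] H) →L[ℂ] ℂ}
    (hΦ : IsState (Φ : (H →L[ℂ] H) →ₗ[ℂ] ℂ))
    (hinv : ∀ s t, s ≤ t → ∀ X ∈ intervalAlgebra U M s t, ∀ r, Φ (flow U r X) = Φ X) :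
    IsInvariantState (Φ ∘L (localAlgebra U M).toSubalgebra.toSubmodule.subtypeL :
      localAlgebra U M →L[ℂ] ℂ) where
  isState := hΦ.comp (localAlgebra U M).subtype
  invariant r x y hxy := by
    change Φ (y : H →L[ℂ] H) = Φ (x : H →L[ℂ] H)
    rw [hxy]
    have hx : (x : H →L[ℂ] H) ∈ (localAlgebra U M : Set (H →L[ℂ] H)) := x.2
    rw [coe_localAlgebra h] at hx
    have hcl : IsClosed {X | Φ (flow U r X) = Φ X} :=
      isClosed_eq (Φ.continuous.comp (continuous_flow r)) Φ.continuous
    refine closure_minimal ?_ hcl hx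
    intro X hX
    obtain ⟨⟨⟨s, t⟩, hst⟩, hX⟩ := Set.mem_iUnion.1 hX
    exact hinv s t hst X hX r

theorem IsInvariantState.apply_flow (h : IsHistory U M) {φ : localAlgebra U M →L[ℂ] ℂ}
    (hφ : IsInvariantState φ) {s t : ℝ} (hst : s ≤ t) (r : ℝ) (x : localAlgebra U M)
    (hx : (x : H →L[ℂ] H) ∈ intervalAlgebra U M s t) :
    ∃ y : localAlgebra U M, (y : H →L[ℂ] H) = flow U r x ∧ φ x = φ y :=
  ⟨⟨flow U r x, mem_localAlgebra_of_mem h (add_le_add_left hst r) (flow_mem_intervalAlgebra r hx)⟩,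
    rfl, (hφ.invariant r _ _ rfl).symm⟩

/-- Invariance lets one move [s, t] by -t into (-∞, 0], where the extension is prescribed. The
future version moves by -s instead. -/
theorem IsPastExtension.apply (h : IsHistory U M) {ω : M.toStarSubalgebra →ₗ[ℂ] ℂ}
    {φ : localAlgebra U M →L[ℂ] ℂ} (hφ : IsPastExtension ω φ) {s t : ℝ} (hst : s ≤ t)
    (x : localAlgebra U M) (hx : (x : H →L[ℂ] H) ∈ intervalAlgebra U M s t)
    (z : M.toStarSubalgebra) (hz : (z : H →L[ℂ] H) = flow U (-t) x) : φ x = ω z := by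
  obtain ⟨y, hy, hxy⟩ := hφ.toIsInvariantState.apply_flow h hst (-t) x hx
  rw [hxy]
  refine hφ.extends_past (s + -t) (t + -t) (by linarith) (by linarith) z y (by rw [hz, hy]) ?_
  rw [hy]
  exact flow_mem_intervalAlgebra _ hx

theorem IsFutureExtension.apply (h : IsHistory U M) {ω : M.commutant.toStarSubalgebra →ₗ[ℂ] ℂ}
    {φ : localAlgebra U M →L[ℂ] ℂ} (hφ : IsFutureExtension ω φ) {s t : ℝ} (hst : s ≤ t)
    (x : localAlgebra U M) (hx : (x : H →L[ℂ] H) ∈ intervalAlgebra U M s t)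
    (z : M.commutant.toStarSubalgebra) (hz : (z : H →L[ℂ] H) = flow U (-s) x) : φ x = ω z := by
  obtain ⟨y, hy, hxy⟩ := hφ.toIsInvariantState.apply_flow h hst (-s) x hx
  rw [hxy]
  refine hφ.extends_future (s + -s) (t + -s) (by linarith) (by linarith) z y (by rw [hz, hy]) ?_
  rw [hy]
  exact flow_mem_intervalAlgebra _ hx

theorem IsPastExtension.unique (h : IsHistory U M) {ω : M.toStarSubalgebra →ₗ[ℂ] ℂ}
    {φ ψ : localAlgebra U M →L[ℂ] ℂ} (hφ : IsPastExtension ω φ) (hψ : IsPastExtension ω ψ) :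
    φ = ψ :=
  h.localAlgebra_ext fun s t hst x hx => by
    have hz := ((mem_intervalAlgebra_iff s t _).1 hx).1
    rw [hφ.apply h hst x hx ⟨_, hz⟩ rfl, hψ.apply h hst x hx ⟨_, hz⟩ rfl]

theorem IsFutureExtension.unique (h : IsHistory U M)
    {ω : M.commutant.toStarSubalgebra →ₗ[ℂ] ℂ} {φ ψ : localAlgebra U M →L[ℂ] ℂ}
    (hφ : IsFutureExtension ω φ) (hψ : IsFutureExtension ω ψ) : φ = ψ :=
  h.localAlgebra_ext fun s t hst x hx => by
    have hz := ((mem_intervalAlgebra_iff s t _).1 hx).2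
    rw [hφ.apply h hst x hx ⟨_, hz⟩ rfl, hψ.apply h hst x hx ⟨_, hz⟩ rfl]

/-! ### Existence of the extensions and the relative commutants -/

theorem IsHistory.exists_isPastExtension (h : IsHistory U M)
    {ω : M.toStarSubalgebra →ₗ[ℂ] ℂ} (θ : M.toStarSubalgebra ≃⋆ₐ[ℂ] (K →L[ℂ] K))
    (hθ : ∀ A, (θ.symm A : H →L[ℂ] H) = hm.amp A) {ξ : H} (hξ : ‖ξ‖ = 1)
    (hvec : ∀ A, vec ξ (hm.amp A) = ω (θ.symm A))
    (hinv : ∀ t, 0 ≤ t → ∀ A, vec ξ (flow U (-t) (hm.amp A)) = vec ξ (hm.amp A)) :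
    ∃ φ : localAlgebra U M →L[ℂ] ℂ, IsPastExtension ω φ := by
  obtain ⟨Φ, hΦ, hΦa⟩ := hm.exists_asymptotic_state hξ hinv
  refine ⟨_, h.isInvariantState hΦ fun s t _ X hX r => ?_, fun s t _ _ x y hxy _ => ?_⟩
  · obtain ⟨A, hA⟩ := (mem_iff_of_equiv hm hθ _).1 ((mem_intervalAlgebra_iff s t _).1 hX).1
    rw [hΦa X t A hA, hΦa (flow U r X) (t + r) A]
    rw [← hA, ← flow_add]
    congr 2
    ring
  · change Φ (y : H →L[ℂ] H) = _
    have hx : hm.amp (θ x) = x := by rw [← hθ, StarAlgEquiv.symm_apply_apply]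
    rw [hΦa y 0 (θ x) (by rw [neg_zero, flow_zero, hx, hxy]), hvec,
      StarAlgEquiv.symm_apply_apply]

theorem IsHistory.exists_isFutureExtension (h : IsHistory U M)
    {ω : M.commutant.toStarSubalgebra →ₗ[ℂ] ℂ}
    (θ : M.commutant.toStarSubalgebra ≃⋆ₐ[ℂ] (L →L[ℂ] L))
    (hθ : ∀ B, (θ.symm B : H →L[ℂ] H) = hm.flip.amp B) {ξ : H} (hξ : ‖ξ‖ = 1)
    (hvec : ∀ B, vec ξ (hm.flip.amp B) = ω (θ.symm B))
    (hinv : ∀ t, 0 ≤ t → ∀ B,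
      vec ξ (flow (reversed U) (-t) (hm.flip.amp B)) = vec ξ (hm.flip.amp B)) :
    ∃ φ : localAlgebra U M →L[ℂ] ℂ, IsFutureExtension ω φ := by
  obtain ⟨Φ, hΦ, hΦa⟩ := hm.flip.exists_asymptotic_state hξ hinv
  simp only [flow_reversed_neg] at hΦa
  refine ⟨_, h.isInvariantState hΦ fun s t _ X hX r => ?_, fun s t _ _ x y hxy _ => ?_⟩
  · obtain ⟨B, hB⟩ := (mem_iff_of_equiv hm.flip hθ _).1 ((mem_intervalAlgebra_iff s t _).1 hX).2
    rw [hΦa X (-s) B hB, hΦa (flow U r X) (-s + -r) B]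
    rw [← hB, ← flow_add]
    congr 2
    ring
  · change Φ (y : H →L[ℂ] H) = _
    have hx : hm.flip.amp (θ x) = x := by rw [← hθ, StarAlgEquiv.symm_apply_apply]
    rw [hΦa y 0 (θ x) (by rw [flow_zero, hx, hxy]), hvec, StarAlgEquiv.symm_apply_apply]

/-- The past relative commutant M ∩ γ_{-t}(M)' is A_[-t,0], so it has to be moved by γ_t to become
A_[0,t]. No shift is needed in the reversed version, where M' ∩ γ_t(M')' is already A_[0,t]. -/
theorem relCommutant_iff (hM : ∀ X, X ∈ M.toStarSubalgebra ↔ ∃ A, X = hm.amp A) (t : ℝ)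
    (X : H →L[ℂ] H) :
    RelCommutant hm U t (flow U (-t) X) ↔ X ∈ intervalAlgebra U M 0 t := by
  rw [mem_intervalAlgebra_iff, RelCommutant, hM, neg_zero, flow_zero]
  refine and_congr_right fun _ => ?_
  change _ ↔ X ∈ M.commutant
  rw [VonNeumannAlgebra.mem_commutant_iff]
  constructor
  · intro h Y hY
    obtain ⟨A, rfl⟩ := (hM Y).1 hY
    have := h A
    rw [← map_mul, ← map_mul] at this
    exact (flow U (-t)).injective this
  · intro h A
    rw [← map_mul, ← map_mul, h _ ((hM _).2 ⟨A, rfl⟩)]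

theorem relCommutant_reversed_iff (hM : ∀ X, X ∈ M.toStarSubalgebra ↔ ∃ A, X = hm.amp A) (t : ℝ)
    (X : H →L[ℂ] H) :
    RelCommutant hm.flip (reversed U) t X ↔ X ∈ intervalAlgebra U M 0 t := by
  rw [mem_intervalAlgebra_iff, RelCommutant, ← hm.mem_commutant_iff hM, neg_zero, flow_zero,
    and_comm]
  refine and_congr_left fun _ => ?_
  rw [hM]
  simp only [flow_reversed_neg]
  constructor
  · intro h
    refine hm.flip.exists_of_commute _ fun B => ?_
    have := h B
    rw [← flow_flow_neg t X, ← map_mul, ← map_mul] at this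
    exact (flow U t).injective this
  · rintro ⟨A, hA⟩ B
    rw [← flow_flow_neg t X, hA, ← map_mul, ← map_mul, hm.amp_commute]

end History

/-! ### The interaction inequality for implementing vectors. -/

section Inequality

variable {K L H : Type u} [NormedAddCommGroup K] [InnerProductSpace ℂ K] [CompleteSpace K]
  [NormedAddCommGroup L] [InnerProductSpace ℂ L] [CompleteSpace L]
  [NormedAddCommGroup H] [InnerProductSpace ℂ H] [CompleteSpace H]
  [Nontrivial K] [Nontrivial L] [Nontrivial H]
  {m : K →L[ℂ] L →L[ℂ] H} {U : Multiplicative ℝ →* unitary (H →L[ℂ] H)} {hm : IsTens m}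
  {M : VonNeumannAlgebra H}

/-- The interaction inequality, in terms of vectors that implement the past and future states. -/
theorem IsHistory.listDist_le (h : IsHistory U M)
    (hM : ∀ X, X ∈ M.toStarSubalgebra ↔ ∃ A, X = hm.amp A)
    {ξ η : H} (hξ : ‖ξ‖ = 1) (hη : ‖η‖ = 1)
    (hξinv : ∀ t, 0 ≤ t → ∀ A, vec ξ (flow U (-t) (hm.amp A)) = vec ξ (hm.amp A))
    (hηinv : ∀ t, 0 ≤ t → ∀ B,
      vec η (flow (reversed U) (-t) (hm.flip.amp B)) = vec η (hm.flip.amp B))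
    {ι κ : Type u} {a : ι → ℝ} {b : ι → K} {c : κ → ℝ} {d : κ → L}
    (hξd : IsDiag (fun A => vec ξ (hm.amp A)) a b)
    (hηd : IsDiag (fun B => vec η (hm.flip.amp B)) c d) (ha : HasSum a 1) (hc : HasSum c 1)
    {Λ Λ' : ℕ → ℝ} (hΛ : Antitone Λ) (hΛ' : Antitone Λ') (hΛ0 : ∀ n, 0 ≤ Λ n)
    (hΛ'0 : ∀ n, 0 ≤ Λ' n) (hl : Lists (fun p : ι × ι => a p.1 * a p.2) Λ)
    (hl' : Lists (fun p : κ × κ => c p.1 * c p.2) Λ') {C : ℝ} (hC0 : 0 ≤ C)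
    (hC : ∀ t, 0 ≤ t → ∀ X ∈ intervalAlgebra U M 0 t,
      ‖vec ξ (flow U (-t) X) - vec η X‖ ≤ C * ‖X‖) : listDist Λ Λ' ≤ C := by
  refine le_of_forall_pos_le_add fun ε hε => ?_
  obtain ⟨T, hT0, hT⟩ := (h.isPureShift hM).exists_list_near hξ hξinv hξd hΛ hΛ0 hl (half_pos hε)
  obtain ⟨T', hT'0, hT'⟩ := (h.isPureShift_reversed hM).exists_list_near hη hηinv hηd hΛ' hΛ'0 hl'
    (half_pos hε)
  -- One time serves both directions, so that both lists belong to the same algebra A_[0,t]; each is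
  -- within ε/2 of its limit.
  let t := max T T'
  have ht : 0 ≤ t := hT0.trans (le_max_left _ _)
  obtain ⟨G₁, _, _, _, π₁, κ₁, a₁, b₁, Λ₁, hπ₁, hr₁, hd₁, ha₁, hΛ₁, hΛ₁0, hl₁, hle₁⟩ :=
    hT t (le_max_left _ _)
  obtain ⟨G₂, _, _, _, π₂, κ₂, a₂, b₂, Λ₂, hπ₂, hr₂, hd₂, ha₂, hΛ₂, hΛ₂0, hl₂, hle₂⟩ :=
    hT' t (le_max_right _ _)
  have hs : Summable Λ := (hl.hasSum hΛ0 (HasSum.prod_mul_real ha ha)).summable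
  have hs' : Summable Λ' := (hl'.hasSum hΛ'0 (HasSum.prod_mul_real hc hc)).summable
  have hs₁ : Summable Λ₁ := (hl₁.hasSum hΛ₁0 ha₁).summable
  have hs₂ : Summable Λ₂ := (hl₂.hasSum hΛ₂0 ha₂).summable
  -- Composing with γ_t gives the past representation the range A_[0,t], and composing the vector
  -- state with γ_{-t} keeps its weights.
  let π : (G₁ →L[ℂ] G₁) →⋆ₐ[ℂ] (H →L[ℂ] H) := (flow U t).toStarAlgHom.comp π₁
  have hπ : ∀ Z, π Z = flow U t (π₁ Z) := fun Z => rfl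
  have hπr : ∀ X, (∃ Z, π Z = X) ↔ X ∈ intervalAlgebra U M 0 t := by
    intro X
    rw [← relCommutant_iff (U := U) (hm := hm) hM, ← hr₁]
    refine exists_congr fun Z => ?_
    rw [hπ]
    constructor
    · rintro rfl
      rw [flow_neg_flow]
    · intro hZ
      rw [hZ, flow_flow_neg]
  have hmid : listDist Λ₁ Λ₂ ≤ C := by
    refine list_contraction_of_range_eq π π₂
      (fun X Y hXY => hπ₁ ((flow U t).injective hXY)) hπ₂
      (fun X => by rw [hπr, hr₂, relCommutant_reversed_iff hM])
      (f := vec ξ ∘ₗ ((flow U (-t)).toStarAlgHom.toAlgHom.toLinearMap :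
        (H →L[ℂ] H) →ₗ[ℂ] (H →L[ℂ] H))) (f' := vec η)
      (a := a₁) (b := b₁) ?_ hd₂ ha₁.summable ha₂.summable hΛ₁ hΛ₂ hΛ₁0 hΛ₂0 hl₁ hl₂ hC0 fun Z => ?_
    · have : ∀ Z, flow U (-t) (π Z) = π₁ Z := fun Z => flow_neg_flow t _
      change IsDiag (fun Z => vec ξ (flow U (-t) (π Z))) a₁ b₁
      simpa only [this] using hd₁
    · exact (hC t ht (π Z) ((hπr _).1 ⟨Z, rfl⟩)).trans
        (mul_le_mul_of_nonneg_left (NonUnitalStarAlgHom.norm_apply_le π Z) hC0)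
  have h1 := listDist_triangle hs hs₁ hs'
  have h2 := listDist_triangle hs₁ hs₂ hs'
  rw [listDist_comm] at hle₁
  linarith

end Inequality

end

end NCDynamics

/-! ### The theorem for a given interaction. -/

open NCDynamics in
theorem theoremB {H : Type u} [NormedAddCommGroup H] [InnerProductSpace ℂ H] [CompleteSpace H]
    [TopologicalSpace.SeparableSpace H] (hH : ¬ FiniteDimensional ℂ H)
    (U : Multiplicative ℝ →* unitary (H →L[ℂ] H)) (M : VonNeumannAlgebra H)
    (ωPast : M.toStarSubalgebra →ₗ[ℂ] ℂ) (ωFut : M.commutant.toStarSubalgebra →ₗ[ℂ] ℂ)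
    (hUM : IsInteraction U M ωPast ωFut) :
    -- the invariant extensions and the two eigenvalue lists exist
    (∃! φPast : localAlgebra U M →L[ℂ] ℂ, IsPastExtension ωPast φPast) ∧
    (∃! φFut : localAlgebra U M →L[ℂ] ℂ, IsFutureExtension ωFut φFut) ∧
    (∃ ΛPast : ℕ → ℝ, IsTensorEigenvalueList ωPast ωPast ΛPast) ∧
    (∃ ΛFut : ℕ → ℝ, IsTensorEigenvalueList ωFut ωFut ΛFut) ∧
    -- and they satisfy the interaction inequality
    ∀ (φPast φFut : localAlgebra U M →L[ℂ] ℂ) (ΛPast ΛFut : ℕ → ℝ),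
      IsPastExtension ωPast φPast → IsFutureExtension ωFut φFut →
      IsTensorEigenvalueList ωPast ωPast ΛPast → IsTensorEigenvalueList ωFut ωFut ΛFut →
      listDist ΛPast ΛFut ≤ ‖φPast - φFut‖ := by
  have h := hUM.toIsHistory
  have hHn : Nontrivial H := by
    by_contra hn
    rw [not_nontrivial_iff_subsingleton] at hn
    exact hH inferInstance
  obtain ⟨K, _, _, _, hK, ⟨θ⟩⟩ := h.typeI
  obtain ⟨L, _, _, _, m, hm, hL, hθ⟩ := exists_isTens_of_equiv M θ
  have hM := mem_iff_of_equiv hm hθ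
  obtain ⟨η, hη⟩ := hm.flip.exists_equiv_of_mem_iff M.commutant.toStarSubalgebra
    (hm.mem_commutant_iff hM)
  obtain ⟨x, ι, a, b, hxd, ha, hx, hxvec, hxinv⟩ :=
    (h.isPureShift hM).exists_vector hH hUM.normal_past θ hθ hUM.invariant_past
  obtain ⟨y, κ, c, d, hyd, hc, hy, hyvec, hyinv⟩ :=
    (h.isPureShift_reversed hM).exists_vector hH hUM.normal_future η hη
      (fun t ht X Y hXY => hUM.invariant_future t ht X Y (by rwa [flow_reversed_neg] at hXY))
  obtain ⟨φ, hφ⟩ := h.exists_isPastExtension (hm := hm) θ hθ hx hxvec hxinv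
  obtain ⟨ψ, hψ⟩ := h.exists_isFutureExtension (hm := hm) η hη hy hyvec hyinv
  refine ⟨⟨φ, hφ, fun φ' hφ' => hφ'.unique h hφ⟩, ⟨ψ, hψ, fun ψ' hψ' => hψ'.unique h hψ⟩,
    exists_isTensorEigenvalueList θ θ hxd hxd ha ha,
    exists_isTensorEigenvalueList η η hyd hyd hc hc, ?_⟩
  intro φPast φFut ΛPast ΛFut hPast hFut hΛP hΛF
  obtain ⟨hP1, hP2, hP3⟩ := hΛP.lists hUM.normal_past θ hxd ha
  obtain ⟨hF1, hF2, hF3⟩ := hΛF.lists hUM.normal_future η hyd hc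
  simp only [← hxvec] at hxd
  simp only [← hyvec] at hyd
  refine h.listDist_le hM hx hy hxinv hyinv hxd hyd ha hc hP1 hF1 hP2 hF2 hP3 hF3
    (norm_nonneg _) fun t ht X hX => ?_
  -- The functional norm enters only through A_[0,t], where the past extension is the state of x
  -- composed with γ_{-t} and the future extension is the state of y.
  let X' : localAlgebra U M := ⟨X, mem_localAlgebra_of_mem h ht hX⟩
  obtain ⟨hX1, hX2⟩ := (mem_intervalAlgebra_iff 0 t X).1 hX
  have h1 : φPast X' = vec x (flow U (-t) X) := by
    rw [hPast.apply h ht X' hX ⟨_, hX1⟩ rfl]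
    obtain ⟨A, hA⟩ := (hM _).1 hX1
    rw [show (⟨flow U (-t) X, hX1⟩ : M.toStarSubalgebra) = θ.symm A from
      Subtype.ext (hA.trans (hθ A).symm), hA, hxvec]
  have h2 : φFut X' = vec y X := by
    rw [neg_zero, flow_zero] at hX2
    rw [hFut.apply h ht X' hX ⟨_, hX2⟩ (by rw [neg_zero, flow_zero])]
    obtain ⟨B, hB⟩ := (hm.mem_commutant_iff hM _).1 hX2
    subst hB
    rw [hyvec]
    congr 1
    exact Subtype.ext (by rw [hη])
  rw [← h1, ← h2]
  exact (φPast - φFut).le_opNorm X'
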